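/- Let $n\ge 2$ and let $O_n$ be the Cuntz algebra, the universal $C^*$-algebra generated by isometries $S_1,\dots,S_n$ with $\sum_i S_iS_i^*=1$. Write $S_\mu=S_{\mu_1}\cdots S_{\mu_r}$ for a word $\mu$ of length $|\mu|=r$, and $O_{nc}=\operatorname{span}\{S_\mu S_\nu^*\}$. Let $\sigma_z$ ($|z|=1$, $\sigma_z(S_i)=zS_i$) be the gauge action, $F$ its fixed point algebra, $\Phi(a)=\frac1{2\pi}\int_0^{2\pi}\sigma_{e^{i\theta}}(a)\,d\theta$ the expectation onto $F$, $\tau$ the faithful normalised trace on $F$, $\psi=\tau\circ\Phi$, and $\mathcal H=L^2(O_n,\psi)$ the GNS space, with $\langle a,b\rangle=\psi(a^*b)$ and $O_n$ acting by left multiplication $\pi$. Let $\Phi_m$ be the projection of $\mathcal H$ onto the $m$-th spectral subspace of the gauge action and $\mathcal D=\sum_{m\in\mathbb Z}m\Phi_m$, a self-adjoint operator. Let $\Delta$ be the modular operator of $\psi$ ($\Delta=\mathcal F\mathcal S$, where $\mathcal S$ is the closure of $a\mapsto a^*$ on $O_{nc}\subset\mathcal H$ and $\mathcal F$ is its conjugate-linear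 adjoint), $\sigma=\Delta^{-1}$ the corresponding algebra automorphism of $O_{nc}$, and $\sigma_i(T)=\Delta^{-1}T\Delta$. Let $\mathcal N\subset\mathcal B(\mathcal H)$ be the double commutant of the span of the rank one operators $\Theta_{x,y}z=x\Phi(y^*z)$, $x,y\in O_{nc}$, let $$\tilde\tau(T)=\langle 1,T1\rangle+\sum_{|\mu|\ge1}\Big(\langle S_\mu,TS_\mu\rangle+n^{-|\mu|}\langle S_\mu^*,TS_\mu^*\rangle\Big),$$ and let $\tau_\Delta$ be the weight $\tau_\Delta(T)=\sup_N\tilde\tau(\Delta_NT)$, $\Delta_N=\Delta\sum_{|m|\le N}\Phi_m$, on $\mathcal N^+$, extended linearly to the span of the positive elements of finite weight. For $k\times k$ matrices let $M_k(O_n)$ and $M_k(\mathcal N)$ act on $\mathcal H\otimes\mathbb C^k$, put $\mathcal D_k=\mathcal D\otimes 1_k$, let $\sigma$ act entrywise, form $\sigma_i$ with $\Delta\otimes 1_k$, and write $\tau_\Delta$ and $\tau$ also for $\tau_\Delta\otimes\mathrm{Tr}$ and $\tau\otimes\mathrm{Tr}$, with $\mathrm{Tr}$ the unnormalised trace. For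 an operator $T$ put $$\eta_\epsilon(T)=\frac1{\sqrt\pi}\int_\epsilon^\infty\tau_\Delta\big(Te^{-tT^2}\big)\,t^{-1/2}\,dt,$$ and let $[\ker T]$ denote the projection onto $\ker T$. Let $u\in M_k(O_{nc})$ be a modular unitary, that is, a unitary such that all entries of $u\sigma(u^*)$ and of $u^*\sigma(u)$ are in the fixed point algebra of $\sigma$ in $O_{nc}$. Then $\sigma(u^*)u\in M_k(F)$, all the quantities below are well defined (the operators to which $\tau_\Delta$ is applied are in its domain, $\pi(u^*)$ is in the domain of $\sigma_i$, and the integrals converge), $$\tau_\Delta\big([\ker\mathcal D_k]-[\ker(u\mathcal D_ku^*)]\big)=\tau_\Delta\big((1-\sigma_i(\pi(u^*))\pi(u))[\ker\mathcal D_k]\big)=\tau\big(1-\sigma(u^*)u\big),$$ and for all $\epsilon>0$ $$\eta_\epsilon(u\mathcal D_ku^*)=\tau(\sigma(u^*)u)\,\eta_\epsilon(\mathcal D)=\tau(\sigma(u^*)u)\,\eta_\epsilon(\mathcal D_k).$$ -/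

import Mathlib

open scoped ComplexOrder InnerProductSpace ENNReal

universe u

noncomputable section

namespace CuntzModular

/-! ## Operators on a Hilbert space -/

section Operators

variable {E : Type*} [NormedAddCommGroup E] [InnerProductSpace ℂ E] [CompleteSpace E]

/-- The value at `x` of an unbounded operator (and `0` outside of its domain). -/
def applyZero (T : E →ₗ.[ℂ] E) (x : E) : E := by
  classical exact if h : x ∈ T.domain then T ⟨x, h⟩ else 0

/-- `[ker T]`, the orthogonal projection onto the (closure of the) kernel of `T`. -/
def kerProj (T : E →ₗ.[ℂ] E) : E →L[ℂ] E :=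
  ((LinearMap.ker T.toFun).map T.domain.subtype).topologicalClosure.starProjection

/-- `U T U*` on its natural domain `{x | U* x ∈ dom T}`. -/
def conjBy (U : E →L[ℂ] E) (T : E →ₗ.[ℂ] E) : E →ₗ.[ℂ] E where
  domain := T.domain.comap (ContinuousLinearMap.adjoint U).toLinearMap
  toFun :=
    { toFun := fun x => U (T ⟨ContinuousLinearMap.adjoint U x, x.2⟩)
      map_add' := fun x y => by
        rw [← map_add, ← T.map_add]
        congr 2
        exact Subtype.ext (map_add (ContinuousLinearMap.adjoint U) (x : E) (y : E))
      map_smul' := fun c x => by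
        rw [RingHom.id_apply, ← map_smul, ← T.map_smul]
        congr 2
        exact Subtype.ext (map_smul (ContinuousLinearMap.adjoint U) c (x : E)) }

/-- Functional calculus of an operator with a complete set of eigenvectors: `B = h(T)`,
that is, the eigenvectors of `T` with real eigenvalues span a dense subspace, and
`B x = h(l) x` whenever `T x = l x`. -/
def IsFunctionOf (T : E →ₗ.[ℂ] E) (h : ℝ → ℝ) (B : E →L[ℂ] E) : Prop :=
  (Submodule.span ℂ {x : E | ∃ (l : ℝ) (hx : x ∈ T.domain),
      T ⟨x, hx⟩ = (l : ℂ) • x}).topologicalClosure = ⊤ ∧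
    ∀ (l : ℝ) (x : E) (hx : x ∈ T.domain), T ⟨x, hx⟩ = (l : ℂ) • x → B x = (h l : ℂ) • x

/-- The bounded operator `h(T)`. -/
def functionOf (T : E →ₗ.[ℂ] E) (h : ℝ → ℝ) : E →L[ℂ] E :=
  Classical.epsilon (IsFunctionOf T h)

/-- The function `l ↦ l exp(-t l²)`, so that `functionOf T (heat t) = T exp(-t T²)`. -/
def heat (t : ℝ) (l : ℝ) : ℝ := l * Real.exp (-t * l ^ 2)

/-- `R = P⁻¹ T P` for an unbounded operator `P`: the bounded operator `R` maps `dom P` to `dom P`,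
and `P R x = T P x` for `x ∈ dom P`. -/
def IsSpatial (P : E →ₗ.[ℂ] E) (T R : E →L[ℂ] E) : Prop :=
  ∀ (x : E) (hx : x ∈ P.domain), ∃ hR : R x ∈ P.domain, P ⟨R x, hR⟩ = T (P ⟨x, hx⟩)

/-- The bounded operator `P⁻¹ T P`. -/
def spatial (P : E →ₗ.[ℂ] E) (T : E →L[ℂ] E) : E →L[ℂ] E :=
  Classical.epsilon (IsSpatial P T)

/-- The linear extension of a weight `φ` on the positive part of `N` to the span of the positive
elements of finite weight: `φ(T) = z`. -/
def IsWeightValue (N : Set (E →L[ℂ] E)) (φ : (E →L[ℂ] E) → ℝ≥0∞) (T : E →L[ℂ] E) (z : ℂ) : Prop :=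
  ∃ P : Fin 4 → (E →L[ℂ] E), (∀ j, P j ∈ N ∧ (P j).IsPositive ∧ φ (P j) < ∞) ∧
    T = P 0 - P 1 + Complex.I • (P 2 - P 3) ∧
    z = (φ (P 0)).toReal - (φ (P 1)).toReal +
      Complex.I * ((φ (P 2)).toReal - (φ (P 3)).toReal)

/-- `T` is in the span of the positive elements of finite weight. -/
def WeightFinite (N : Set (E →L[ℂ] E)) (φ : (E →L[ℂ] E) → ℝ≥0∞) (T : E →L[ℂ] E) : Prop :=
  ∃ z, IsWeightValue N φ T z

/-- The value `φ(T)` of the linear extension. -/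
def weightValue (N : Set (E →L[ℂ] E)) (φ : (E →L[ℂ] E) → ℝ≥0∞) (T : E →L[ℂ] E) : ℂ :=
  Classical.epsilon (IsWeightValue N φ T)

/-- The integrand `t ↦ φ(T exp(-t T²)) t^{-1/2}` of the eta invariant. -/
def etaIntegrand (N : Set (E →L[ℂ] E)) (φ : (E →L[ℂ] E) → ℝ≥0∞) (T : E →ₗ.[ℂ] E) (t : ℝ) : ℂ :=
  weightValue N φ (functionOf T (heat t)) * ((t ^ (-(1 / 2) : ℝ) : ℝ) : ℂ)

/-- The eta invariant `η_ε(T) = π^{-1/2} ∫_ε^∞ φ(T exp(-t T²)) t^{-1/2} dt` relative to `φ`. -/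
def eta (N : Set (E →L[ℂ] E)) (φ : (E →L[ℂ] E) → ℝ≥0∞) (T : E →ₗ.[ℂ] E) (ε : ℝ) : ℂ :=
  ((1 / Real.sqrt Real.pi : ℝ) : ℂ) * ∫ t in Set.Ioi ε, etaIntegrand N φ T t

/-- Everything in the definition of `η_ε(T)` makes sense: `T exp(-t T²)` is a bounded operator in
the domain of `φ` for `t > 0`, and the integral converges. -/
def EtaDefined (N : Set (E →L[ℂ] E)) (φ : (E →L[ℂ] E) → ℝ≥0∞) (T : E →ₗ.[ℂ] E) (ε : ℝ) : Prop :=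
  (∀ t : ℝ, 0 < t → IsFunctionOf T (heat t) (functionOf T (heat t)) ∧
    WeightFinite N φ (functionOf T (heat t))) ∧
  MeasureTheory.IntegrableOn (etaIntegrand N φ T) (Set.Ioi ε)

end Operators

theorem closure_add {E : Type*} [NormedAddCommGroup E] {G : Set (E × E)} (hG : ∀ p ∈ G, ∀ q ∈ G, p + q ∈ G) {p q : E × E}
    (hp : p ∈ closure G) (hq : q ∈ closure G) : p + q ∈ closure G :=
  map_mem_closure₂ continuous_add hp hq fun a ha b hb => hG a ha b hb

theorem closure_conj_smul {E : Type*} [NormedAddCommGroup E] [NormedSpace ℂ E] {G : Set (E × E)} (c : ℂ)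
    (hG : ∀ p ∈ G, (c • p.1, star c • p.2) ∈ G) {p : E × E} (hp : p ∈ closure G) :
    (c • p.1, star c • p.2) ∈ closure G := by
  have hc : Continuous fun p : E × E => (c • p.1, star c • p.2) := by fun_prop
  exact map_mem_closure (f := fun p : E × E => (c • p.1, star c • p.2)) hc hp
    fun a ha => hG a ha

section Amplification

variable {E : Type*} [NormedAddCommGroup E] [InnerProductSpace ℂ E]

/-- The Hilbert space `E ⊗ ℂ^k`. -/
abbrev Amp (E : Type*) [NormedAddCommGroup E] (k : ℕ) : Type _ := PiLp 2 (fun _ : Fin k => E)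

/-- The operator on `E ⊗ ℂ^k` given by a matrix of operators. -/
def opMatrix {k : ℕ} (m : Matrix (Fin k) (Fin k) (E →L[ℂ] E)) : Amp E k →L[ℂ] Amp E k :=
  (PiLp.continuousLinearEquiv 2 ℂ (fun _ : Fin k => E)).symm.toContinuousLinearMap ∘L
    (ContinuousLinearMap.pi fun i => ∑ j, m i j ∘L ContinuousLinearMap.proj j) ∘L
    (PiLp.continuousLinearEquiv 2 ℂ (fun _ : Fin k => E)).toContinuousLinearMap

/-- The `(i, j)` entry of an operator on `E ⊗ ℂ^k`. -/
def entry {k : ℕ} (T : Amp E k →L[ℂ] Amp E k) (i j : Fin k) : E →L[ℂ] E :=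
  ContinuousLinearMap.proj i ∘L
    (PiLp.continuousLinearEquiv 2 ℂ (fun _ : Fin k => E)).toContinuousLinearMap ∘L T ∘L
    (PiLp.continuousLinearEquiv 2 ℂ (fun _ : Fin k => E)).symm.toContinuousLinearMap ∘L
    ContinuousLinearMap.single ℂ (fun _ : Fin k => E) j

/-- `T ⊗ 1_k` for an unbounded operator `T`. -/
def ampl (T : E →ₗ.[ℂ] E) (k : ℕ) : Amp E k →ₗ.[ℂ] Amp E k where
  domain :=
    { carrier := {x | ∀ i, x i ∈ T.domain}
      add_mem' := fun hx hy i => T.domain.add_mem (hx i) (hy i)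
      zero_mem' := fun _ => T.domain.zero_mem
      smul_mem' := fun c _ hx i => T.domain.smul_mem c (hx i) }
  toFun :=
    { toFun := fun x => WithLp.toLp 2 fun i => T ⟨x.1 i, x.2 i⟩
      map_add' := fun x y => by
        ext i
        exact T.map_add ⟨x.1 i, x.2 i⟩ ⟨y.1 i, y.2 i⟩
      map_smul' := fun c x => by
        ext i
        exact T.map_smul c ⟨x.1 i, x.2 i⟩ }

end Amplification

/-! ## The Cuntz algebra -/

/-- `T₁, …, Tₙ` are isometries with `∑ Tᵢ Tᵢ* = 1`. -/
def CuntzRelations {n : ℕ} {B : Type*} [CStarAlgebra B] (T : Fin n → B) : Prop :=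
  (∀ i, star (T i) * T i = 1) ∧ ∑ i, T i * star (T i) = 1

/-- `A` is the universal C*-algebra generated by `n` isometries `S₁, …, Sₙ` subject to
`∑ Sᵢ Sᵢ* = 1`. -/
structure CuntzAlgebra (n : ℕ) (A : Type u) [CStarAlgebra A] where
  S : Fin n → A
  rel : CuntzRelations S
  generates : (StarAlgebra.adjoin ℂ (Set.range S)).topologicalClosure = ⊤
  universal : ∀ (B : Type u) [CStarAlgebra B] (T : Fin n → B), CuntzRelations T →
    ∃ φ : A →⋆ₐ[ℂ] B, ∀ i, φ (S i) = T i

namespace CuntzAlgebra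

variable {n : ℕ} {A : Type u} [CStarAlgebra A] (O : CuntzAlgebra n A)

/-- `S_μ` for a word `μ`. -/
def word (μ : List (Fin n)) : A := (μ.map O.S).prod

/-- `O_{nc} = span {S_μ S_ν*}`. -/
def alg : Submodule ℂ A :=
  Submodule.span ℂ {a | ∃ μ ν : List (Fin n), a = O.word μ * star (O.word ν)}

theorem rel_smul (z : Circle) : CuntzRelations fun i => (z : ℂ) • O.S i := by
  have hz : star (z : ℂ) * (z : ℂ) = 1 := by
    rw [Complex.star_def, ← Complex.normSq_eq_conj_mul_self]; simp
  have hz' : (z : ℂ) * star (z : ℂ) = 1 := by rw [mul_comm]; exact hz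
  refine ⟨fun i => ?_, ?_⟩
  · simp only [star_smul, smul_mul_smul_comm, hz, one_smul, O.rel.1 i]
  · simp only [star_smul, smul_mul_smul_comm, hz', one_smul, O.rel.2]

/-- The gauge action `σ_z`, determined by `σ_z(Sᵢ) = z Sᵢ`. -/
def gauge (z : Circle) : A →⋆ₐ[ℂ] A :=
  (O.universal A _ (O.rel_smul z)).choose

theorem gauge_S (z : Circle) (i : Fin n) : O.gauge z (O.S i) = (z : ℂ) • O.S i :=
  (O.universal A _ (O.rel_smul z)).choose_spec i

theorem continuous_hom (φ : A →⋆ₐ[ℂ] A) : Continuous φ :=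
  AddMonoidHomClass.continuous_of_bound φ 1 fun a => by
    rw [one_mul]; exact NonUnitalStarAlgHom.norm_apply_le φ a

/-- Induction over the generators. -/
theorem induction {p : A → Prop} (hS : ∀ i, p (O.S i)) (hc : ∀ c : ℂ, p (algebraMap ℂ A c))
    (hadd : ∀ a b, p a → p b → p (a + b)) (hmul : ∀ a b, p a → p b → p (a * b))
    (hstar : ∀ a, p a → p (star a)) (hcl : IsClosed {a | p a}) (a : A) : p a := by
  have h1 : ((StarAlgebra.adjoin ℂ (Set.range O.S) : StarSubalgebra ℂ A) : Set A) ⊆ {a | p a} := by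
    intro x hx
    induction hx using StarAlgebra.adjoin_induction with
    | mem x hx => obtain ⟨i, rfl⟩ := hx; exact hS i
    | algebraMap c => exact hc c
    | add x y _ _ hx hy => exact hadd x y hx hy
    | mul x y _ _ hx hy => exact hmul x y hx hy
    | star x _ hx => exact hstar x hx
  have h2 : a ∈ (StarAlgebra.adjoin ℂ (Set.range O.S)).topologicalClosure := by
    rw [O.generates]; trivial
  exact closure_minimal h1 hcl h2

theorem gauge_mul (w z : Circle) (a : A) : O.gauge w (O.gauge z a) = O.gauge (w * z) a := by
  refine O.induction (p := fun a => O.gauge w (O.gauge z a) = O.gauge (w * z) a)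
    (fun i => ?_) (fun c => ?_) (fun a b ha hb => ?_) (fun a b ha hb => ?_) (fun a ha => ?_)
    ?_ a
  · simp only [gauge_S, map_smul, smul_smul, Circle.coe_mul, mul_comm]
  · simp only [AlgHomClass.commutes]
  · simp only [map_add, ha, hb]
  · simp only [map_mul, ha, hb]
  · simp only [map_star, ha]
  · exact isClosed_eq ((continuous_hom _).comp (continuous_hom _)) (continuous_hom _)

theorem continuous_gauge (a : A) : Continuous fun z : Circle => O.gauge z a := by
  refine O.induction (p := fun a => Continuous fun z : Circle => O.gauge z a)
    (fun i => ?_) (fun c => ?_) (fun a b ha hb => ?_) (fun a b ha hb => ?_) (fun a ha => ?_)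
    ?_ a
  · simp only [gauge_S]
    exact Continuous.smul (by fun_prop) continuous_const
  · simp only [AlgHomClass.commutes]
    exact continuous_const
  · simp only [map_add]; exact ha.add hb
  · simp only [map_mul]; exact ha.mul hb
  · simp only [map_star]; exact ha.star
  · refine isClosed_of_closure_subset fun a ha => ?_
    refine Metric.continuous_iff'.2 fun z ε hε => ?_
    obtain ⟨b, hb, hab⟩ := Metric.mem_closure_iff.1 ha (ε / 3) (by positivity)
    have hb' : Continuous fun z : Circle => O.gauge z b := hb
    filter_upwards [Metric.continuous_iff'.1 hb' z (ε / 3) (by positivity)] with w hw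
    have h : ∀ v : Circle, dist (O.gauge v a) (O.gauge v b) < ε / 3 := fun v => by
      rw [dist_eq_norm, ← map_sub]
      refine lt_of_le_of_lt (NonUnitalStarAlgHom.norm_apply_le (O.gauge v) (a - b)) ?_
      rwa [← dist_eq_norm]
    have h3 := h z
    rw [dist_comm] at h3
    calc dist (O.gauge w a) (O.gauge z a)
        ≤ dist (O.gauge w a) (O.gauge w b) + dist (O.gauge w b) (O.gauge z b)
          + dist (O.gauge z b) (O.gauge z a) := dist_triangle4 _ _ _ _
      _ < ε := by linarith [h w]

theorem continuous_gauge_exp (a : A) : Continuous fun θ : ℝ => O.gauge (Circle.exp θ) a :=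
  (O.continuous_gauge a).comp Circle.exp.continuous

/-- `F`, the fixed point algebra of the gauge action. -/
def fixed : StarSubalgebra ℂ A where
  carrier := {a | ∀ z, O.gauge z a = a}
  add_mem' := fun ha hb z => by rw [map_add, ha z, hb z]
  mul_mem' := fun ha hb z => by rw [map_mul, ha z, hb z]
  algebraMap_mem' := fun c z => AlgHomClass.commutes _ c
  star_mem' := fun ha z => by rw [map_star, ha z]

/-- The spectral subspace `{a | σ_z(a) = z^m a}` of the gauge action. -/
def spectral (m : ℤ) : Submodule ℂ A where
  carrier := {a | ∀ z : Circle, O.gauge z a = ((z : ℂ) ^ m) • a}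
  add_mem' := fun ha hb z => by rw [map_add, ha z, hb z, smul_add]
  zero_mem' := fun z => by rw [map_zero, smul_zero]
  smul_mem' := fun c a ha z => by rw [map_smul, ha z, smul_comm]

/-- The expectation `Φ(a) = (2π)⁻¹ ∫ σ_z(a) dθ`, `z = exp(iθ)`. -/
def expectation (a : A) : A :=
  ((1 / (2 * Real.pi) : ℝ) : ℂ) • ∫ θ in (0 : ℝ)..(2 * Real.pi), O.gauge (Circle.exp θ) a

theorem intervalIntegrable_gauge (a : A) (x y : ℝ) :
    IntervalIntegrable (fun θ : ℝ => O.gauge (Circle.exp θ) a) MeasureTheory.volume x y :=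
  (O.continuous_gauge_exp a).intervalIntegrable x y

theorem expectation_mem (a : A) : O.expectation a ∈ O.fixed := by
  intro w
  obtain ⟨s, rfl⟩ := Circle.exp_surjective w
  have hper : Function.Periodic (fun θ : ℝ => O.gauge (Circle.exp θ) a) (2 * Real.pi) := by
    intro θ
    simp only [Circle.exp_add, Circle.exp_two_pi, mul_one]
  let L : A →L[ℂ] A :=
    ⟨((O.gauge (Circle.exp s) : A →⋆ₐ[ℂ] A) : A →ₐ[ℂ] A).toLinearMap, continuous_hom _⟩
  have hL : ∀ b, O.gauge (Circle.exp s) b = L b := fun _ => rfl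
  have h := L.intervalIntegral_comp_comm (O.intervalIntegrable_gauge a 0 (2 * Real.pi))
  unfold expectation
  rw [map_smul]
  congr 1
  rw [hL, ← h]
  simp only [← hL, gauge_mul, ← Circle.exp_add]
  rw [intervalIntegral.integral_comp_add_left (fun θ => O.gauge (Circle.exp θ) a) s]
  have h2 := hper.intervalIntegral_add_eq s 0
  simpa using h2

/-- `Φ` as a linear map onto `F`. -/
def expectationMap : A →ₗ[ℂ] O.fixed where
  toFun a := ⟨O.expectation a, O.expectation_mem a⟩
  map_add' a b := by
    refine Subtype.ext ?_
    change O.expectation (a + b) = O.expectation a + O.expectation b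
    simp only [expectation, map_add]
    rw [intervalIntegral.integral_add (O.intervalIntegrable_gauge a _ _)
      (O.intervalIntegrable_gauge b _ _), smul_add]
  map_smul' c a := by
    refine Subtype.ext ?_
    change O.expectation (c • a) = c • O.expectation a
    simp only [expectation, map_smul]
    rw [intervalIntegral.integral_smul, smul_comm]

theorem expectation_nonneg [PartialOrder A] [StarOrderedRing A] {a : A} (ha : 0 ≤ a) :
    0 ≤ O.expectation a := by
  have h1 : 0 ≤ ∫ θ in (0 : ℝ)..(2 * Real.pi), O.gauge (Circle.exp θ) a := by
    rw [intervalIntegral.integral_of_le (by positivity)]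
    refine MeasureTheory.integral_nonneg fun θ => ?_
    exact map_nonneg (O.gauge (Circle.exp θ)) ha
  unfold expectation
  refine smul_nonneg ?_ h1
  rw [Complex.zero_le_real]
  positivity

/-- A faithful normalised trace `τ : F → ℂ`: a positive faithful linear functional on `F` with
`τ(1) = 1` and `τ(fg) = τ(gf)`. -/
structure FaithfulTrace [PartialOrder A] [StarOrderedRing A] where
  toLin : O.fixed →ₗ[ℂ] ℂ
  nonneg : ∀ f : O.fixed, 0 ≤ (f : A) → 0 ≤ toLin f
  faithful : ∀ f : O.fixed, 0 ≤ (f : A) → toLin f = 0 → f = 0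
  normalised : toLin 1 = 1
  trace : ∀ f g : O.fixed, toLin (f * g) = toLin (g * f)

end CuntzAlgebra

/-! ## The modular spectral triple -/

namespace CuntzAlgebra.FaithfulTrace

variable {n : ℕ} {A : Type u} [CStarAlgebra A] [PartialOrder A] [StarOrderedRing A]
  {O : CuntzAlgebra n A} (τ : O.FaithfulTrace)

/-- The state `ψ = τ ∘ Φ`. -/
def state : A →ₚ[ℂ] ℂ :=
  PositiveLinearMap.mk₀ (τ.toLin ∘ₗ O.expectationMap)
    fun _ ha => τ.nonneg _ (O.expectation_nonneg ha)

/-- The GNS space `H = L²(O_n, ψ)`, with `⟨a, b⟩ = ψ(a* b)`. -/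
abbrev H : Type u := τ.state.GNS

/-- The inclusion of `O_n` into `H`. -/
def vec : A →ₗ[ℂ] τ.H :=
  (UniformSpace.Completion.toComplₗᵢ (𝕜 := ℂ) (E := τ.state.PreGNS)).toLinearMap ∘ₗ
    τ.state.toPreGNS.toLinearMap

/-- The representation by left multiplication, `π(a) b = ab`. -/
def rep (a : A) : τ.H →L[ℂ] τ.H := τ.state.gnsStarAlgHom a

/-- `Φ_m` on `H`: the projection onto the `m`-th spectral subspace of the gauge action. -/
def proj (m : ℤ) : τ.H →L[ℂ] τ.H :=
  ((O.spectral m).map τ.vec).topologicalClosure.starProjection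

/-- The generator of the gauge action, `D = ∑ m Φ_m` on its maximal domain. -/
def D : τ.H →ₗ.[ℂ] τ.H where
  domain :=
    { carrier := {x | Summable fun m : ℤ => (m : ℂ) • τ.proj m x}
      add_mem' := fun {x y} hx hy => by
        simpa only [Set.mem_ofPred_eq, map_add, smul_add] using Summable.add hx hy
      zero_mem' := by
        simpa only [Set.mem_ofPred_eq, map_zero, smul_zero] using summable_zero
      smul_mem' := fun c x hx => by
        simpa only [Set.mem_ofPred_eq, map_smul, smul_comm c] using Summable.const_smul c hx }
  toFun :=
    { toFun := fun x => ∑' m : ℤ, (m : ℂ) • τ.proj m (x : τ.H)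
      map_add' := fun x y => by
        simp only [Submodule.coe_add, map_add, smul_add]
        exact Summable.tsum_add x.2 y.2
      map_smul' := fun c x => by
        simp only [Submodule.coe_smul, map_smul, RingHom.id_apply, smul_comm _ c]
        exact Summable.tsum_const_smul c x.2 }

/-- The graph of the closure of the conjugate-linear operator `a ↦ a*` on `O_{nc} ⊆ H`. -/
def tomitaGraph : Set (τ.H × τ.H) :=
  closure {p | ∃ a ∈ O.alg, p = (τ.vec a, τ.vec (star a))}

theorem tomitaGraph_add {p q : τ.H × τ.H} (hp : p ∈ τ.tomitaGraph) (hq : q ∈ τ.tomitaGraph) :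
    p + q ∈ τ.tomitaGraph := by
  refine closure_add ?_ hp hq
  rintro _ ⟨a, ha, rfl⟩ _ ⟨b, hb, rfl⟩
  refine ⟨a + b, O.alg.add_mem ha hb, ?_⟩
  rw [star_add, map_add, map_add, Prod.mk_add_mk]

theorem tomitaGraph_smul (c : ℂ) {p : τ.H × τ.H} (hp : p ∈ τ.tomitaGraph) :
    (c • p.1, star c • p.2) ∈ τ.tomitaGraph := by
  refine closure_conj_smul c ?_ hp
  rintro _ ⟨a, ha, rfl⟩
  refine ⟨c • a, O.alg.smul_mem c ha, ?_⟩
  rw [star_smul, map_smul, map_smul]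

theorem tomitaGraph_zero : (0 : τ.H × τ.H) ∈ τ.tomitaGraph :=
  subset_closure ⟨0, O.alg.zero_mem, by rw [star_zero, map_zero]; rfl⟩

/-- The graph of the modular operator `Δ = 𝓕 𝓢`, where `𝓢` is the closure of `a ↦ a*` and `𝓕` is
its conjugate-linear adjoint, `⟨𝓢 a, s⟩ = ⟨𝓕 s, a⟩`. -/
def modularGraph : Submodule ℂ (τ.H × τ.H) where
  carrier := {p | ∃ s : τ.H, (p.1, s) ∈ τ.tomitaGraph ∧
    ∀ a ∈ O.alg, ⟪τ.vec (star a), s⟫_ℂ = ⟪p.2, τ.vec a⟫_ℂ}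
  add_mem' := by
    rintro p q ⟨s, hs, hs'⟩ ⟨t, ht, ht'⟩
    refine ⟨s + t, τ.tomitaGraph_add hs ht, fun a ha => ?_⟩
    rw [inner_add_right, Prod.snd_add, inner_add_left, hs' a ha, ht' a ha]
  zero_mem' := ⟨0, τ.tomitaGraph_zero, fun a _ => by simp⟩
  smul_mem' := by
    rintro c p ⟨s, hs, hs'⟩
    refine ⟨star c • s, τ.tomitaGraph_smul c hs, fun a ha => ?_⟩
    rw [inner_smul_right, Prod.smul_snd, inner_smul_left, hs' a ha, Complex.star_def]

/-- The modular operator `Δ`. -/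
def modular : τ.H →ₗ.[ℂ] τ.H := τ.modularGraph.toLinearPMap

/-- The regular automorphism `σ = Δ⁻¹` of `O_{nc}`: `σ(a)` is the element of `O_{nc}`
with `Δ(σ(a)) = a`. -/
def sigma (a : A) : A :=
  Classical.epsilon fun c => c ∈ O.alg ∧ (τ.vec c, τ.vec a) ∈ τ.modular.graph

/-- The finite rank endomorphisms of the right `F_c`-module `O_{nc}`, as operators on `H`:
the span of the rank one endomorphisms `Θ_{x,y} z = x Φ(y* z)`. -/
def finiteRank : Submodule ℂ (τ.H →L[ℂ] τ.H) :=
  Submodule.span ℂ {T | ∃ x ∈ O.alg, ∃ y ∈ O.alg, ∀ z ∈ O.alg,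
    T (τ.vec z) = τ.vec (x * O.expectation (star y * z))}

/-- The von Neumann algebra `𝓝`, the double commutant of the finite rank endomorphisms. -/
def vN : Set (τ.H →L[ℂ] τ.H) :=
  Set.centralizer (Set.centralizer (τ.finiteRank : Set (τ.H →L[ℂ] τ.H)))

/-- The functional `τ̃(T) = ⟨1, T 1⟩ + ∑_{μ ≠ ∅} (⟨S_μ, T S_μ⟩ + n^{-|μ|} ⟨S_μ*, T S_μ*⟩)`. -/
def tildeTau (T : τ.H → τ.H) : ℂ :=
  ⟪τ.vec 1, T (τ.vec 1)⟫_ℂ + ∑' μ : {μ : List (Fin n) // μ ≠ []},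
    (⟪τ.vec (O.word μ), T (τ.vec (O.word μ))⟫_ℂ +
      (1 / (n : ℂ) ^ μ.1.length) *
        ⟪τ.vec (star (O.word μ)), T (τ.vec (star (O.word μ)))⟫_ℂ)

/-- `Δ_N = Δ ∑_{|m| ≤ N} Φ_m`. -/
def modularCut (N : ℕ) (x : τ.H) : τ.H :=
  applyZero τ.modular (∑ m ∈ Finset.Icc (-(N : ℤ)) N, τ.proj m x)

/-- The weight `τ_Δ(T) = sup_N τ̃(Δ_N T)` on positive `T`. -/
def weight (T : τ.H →L[ℂ] τ.H) : ℝ≥0∞ :=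
  ⨆ N : ℕ, ENNReal.ofReal (τ.tildeTau fun x => τ.modularCut N (T x)).re

/-! ### Matrices over the Cuntz algebra -/

/-- `M_k(𝓝)` acting on `H ⊗ ℂ^k`. -/
def vNMatrix (k : ℕ) : Set (Amp τ.H k →L[ℂ] Amp τ.H k) :=
  {T | ∀ i j, entry T i j ∈ τ.vN}

/-- The weight `τ_Δ ⊗ Tr` on the positive part of `M_k(𝓝)`. -/
def weightMatrix (k : ℕ) (T : Amp τ.H k →L[ℂ] Amp τ.H k) : ℝ≥0∞ :=
  ∑ i, τ.weight (entry T i i)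

/-- `T` is in the domain of the linear extension of `τ_Δ` (on `M_k(𝓝)`). -/
def TauFinite {k : ℕ} (T : Amp τ.H k →L[ℂ] Amp τ.H k) : Prop :=
  WeightFinite (τ.vNMatrix k) (τ.weightMatrix k) T

/-- The value of the linear extension of `τ_Δ` (on `M_k(𝓝)`). -/
def tauDelta {k : ℕ} (T : Amp τ.H k →L[ℂ] Amp τ.H k) : ℂ :=
  weightValue (τ.vNMatrix k) (τ.weightMatrix k) T

/-- The trace `τ ⊗ Tr` on `M_k(F)`. -/
def tauMatrix {k : ℕ} (f : Matrix (Fin k) (Fin k) O.fixed) : ℂ := ∑ i, τ.toLin (f i i)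

/-- The representation of `M_k(O_n)` on `H ⊗ ℂ^k`. -/
def repMatrix {k : ℕ} (a : Matrix (Fin k) (Fin k) A) : Amp τ.H k →L[ℂ] Amp τ.H k :=
  opMatrix (a.map τ.rep)

/-- The entries of the matrix lie in the fixed point algebra of `σ` on `O_{nc}`. -/
def IsFixedMatrix {k : ℕ} (a : Matrix (Fin k) (Fin k) A) : Prop :=
  ∀ i j, a i j ∈ O.alg ∧ τ.sigma (a i j) = a i j

/-- `D ⊗ 1_k`. -/
def DMatrix (k : ℕ) : Amp τ.H k →ₗ.[ℂ] Amp τ.H k := ampl τ.D k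

/-- `u (D ⊗ 1_k) u*`. -/
def DConj {k : ℕ} (u : Matrix (Fin k) (Fin k) A) : Amp τ.H k →ₗ.[ℂ] Amp τ.H k :=
  conjBy (τ.repMatrix u) (τ.DMatrix k)

/-- `σ_i(T) = Δ⁻¹ T Δ` on `H ⊗ ℂ^k`, where `Δ` stands for `Δ ⊗ 1_k`. -/
def sigmaI {k : ℕ} (T : Amp τ.H k →L[ℂ] Amp τ.H k) : Amp τ.H k →L[ℂ] Amp τ.H k :=
  spatial (ampl τ.modular k) T

/-- `T` is in the domain of `σ_i`. -/
def SigmaIDefined {k : ℕ} (T : Amp τ.H k →L[ℂ] Amp τ.H k) : Prop :=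
  IsSpatial (ampl τ.modular k) T (τ.sigmaI T)

/-- A modular unitary: a unitary `u ∈ M_k(O_{nc})` such that `u σ(u*)` and `u* σ(u)` are
matrices over the fixed point algebra of `σ`. -/
structure IsModularUnitary {k : ℕ} (u : Matrix (Fin k) (Fin k) A) : Prop where
  mem : ∀ i j, u i j ∈ O.alg
  star_mul_self : u.conjTranspose * u = 1
  mul_star_self : u * u.conjTranspose = 1
  modular_left : τ.IsFixedMatrix (u * u.conjTranspose.map τ.sigma)
  modular_right : τ.IsFixedMatrix (u.conjTranspose * u.map τ.sigma)

end CuntzAlgebra.FaithfulTrace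

end CuntzModular

end

noncomputable section

namespace CuntzModular

/-! ### Words in the generators and the grading of `O_{nc}` by degree. -/

namespace CuntzAlgebra

variable {n : ℕ} {A : Type u} [CStarAlgebra A] (O : CuntzAlgebra n A)

/-! Everything is computed from the ℤ-grading of `O_{nc}` in which `S_μ S_ν*` has degree `|μ| -
|ν|`. The trace property forces `ψ(S_μ S_ν*) = δ_{μν} n^{-|μ|}` (`state_word`), and hence the KMS
relation `ψ(ab) = n^{-m} ψ(ba)` for `a` of degree `m` (`state_homog_mul`). On the `m`-th spectral
subspace `D` is the scalar `m` and `Δ` is the scalar `n^{-m}` (`mem_modularGraph_iff`), so `σ`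
multiplies degree `m` by `n^m`. The two powers of `n` cancel and `ψ` becomes a twisted trace,
`ψ(σ(a) b) = ψ(ba)` (`state_sigma_mul`).

The central formula is `τ_Δ(π(a) h(D) π(a)*) = (∑ h(l)) ψ(aa*)` for `h ≥ 0` (`IsDiag.weight_conj`).
It holds because the coefficients in `τ̃` and the eigenvalues of `Δ` combine so that each spectral
subspace contributes exactly `ψ(b)` to the weight of `π(b)` (`sum_state_signedWord`); shifting
degrees by `a` then costs nothing.

For the kernels take `h` to be the indicator of `0`. The projection onto `ker(u D_k u*)` is `u Φ_0
u*`, of weight `ψ(uu*) = ψ(σ(u*)u)`, while `Φ_0 ⊗ 1_k` has weight `ψ(1)`. For the second expression,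
`σ_i(π(u*)) = π(σ(u*))` (`sigmaI_repMatrix`), and polarising the central formula gives `τ_Δ(π(g)
Φ_0) = ψ(g)` (`isWeightValue_repMatrix_mul_proj_zero`). Finally `σ(u*)u` is gauge invariant, being
inverse to the invariant matrix `u*σ(u)`, so `ψ` is `τ` on it. Since `uu* = 1`, the twisted trace
identity even gives `τ(σ(u*)u) = k`, so the common value of the three expressions is `0`.

For the eta invariants, `l ↦ l exp(-t l²)` is odd. Its positive and negative parts have the same sum
over ℤ, so by the central formula the heat operators of `D`, `D_k` and `u D_k u*` all have weight
`0` (`exists_isFunctionOf_heat`, `exists_isFunctionOf_D_heat`). All eta invariants vanish and both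
eta identities read `0 = 0`, whatever the trace factor. -/

/-- The span of the `S_μ S_ν*` with `|μ| - |ν| = m`. -/
def homog (m : ℤ) : Submodule ℂ A :=
  Submodule.span ℂ {a | ∃ μ ν : List (Fin n), (μ.length : ℤ) - ν.length = m ∧
    a = O.word μ * star (O.word ν)}

@[simp]
theorem word_nil : O.word [] = 1 := rfl

theorem word_cons (i : Fin n) (μ : List (Fin n)) : O.word (i :: μ) = O.S i * O.word μ := by
  simp [word]

theorem word_append (μ ν : List (Fin n)) : O.word (μ ++ ν) = O.word μ * O.word ν := by
  simp [word]

theorem word_mul_star_mem_homog (μ ν : List (Fin n)) :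
    O.word μ * star (O.word ν) ∈ O.homog (μ.length - ν.length) :=
  Submodule.subset_span ⟨μ, ν, rfl, rfl⟩

theorem word_mem_homog (μ : List (Fin n)) : O.word μ ∈ O.homog μ.length := by
  simpa using O.word_mul_star_mem_homog μ []

theorem star_word_mem_homog (μ : List (Fin n)) : star (O.word μ) ∈ O.homog (-μ.length) := by
  simpa using O.word_mul_star_mem_homog [] μ

theorem one_mem_homog : (1 : A) ∈ O.homog 0 := by
  simpa using O.word_mem_homog []

theorem homog_le_alg (m : ℤ) : O.homog m ≤ O.alg :=
  Submodule.span_mono fun _ ⟨μ, ν, _, h⟩ => ⟨μ, ν, h⟩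

theorem star_mem_homog {m : ℤ} {a : A} (ha : a ∈ O.homog m) : star a ∈ O.homog (-m) := by
  induction ha using Submodule.span_induction with
  | mem x hx =>
    obtain ⟨μ, ν, h, rfl⟩ := hx
    rw [star_mul, star_star]
    refine Submodule.subset_span ⟨ν, μ, by omega, rfl⟩
  | zero => simp
  | add x y _ _ hx hy => rw [star_add]; exact add_mem hx hy
  | smul c x _ hx => rw [star_smul]; exact Submodule.smul_mem _ _ hx

theorem alg_eq_iSup : O.alg = ⨆ m, O.homog m := by
  refine le_antisymm (Submodule.span_le.2 ?_) (iSup_le O.homog_le_alg)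
  rintro _ ⟨μ, ν, rfl⟩
  exact Submodule.mem_iSup_of_mem _ (O.word_mul_star_mem_homog μ ν)

theorem exists_decomp {a : A} (ha : a ∈ O.alg) :
    ∃ c : ℤ →₀ A, (∀ j, c j ∈ O.homog j) ∧ a = ∑ j ∈ c.support, c j := by
  rw [alg_eq_iSup, Submodule.mem_iSup_iff_exists_finsupp] at ha
  obtain ⟨c, hc, h⟩ := ha
  exact ⟨c, hc, h.symm⟩

theorem alg_induction {p : A → Prop} (hom : ∀ m, ∀ a ∈ O.homog m, p a)
    (add : ∀ a ∈ O.alg, ∀ b ∈ O.alg, p a → p b → p (a + b)) {a : A} (ha : a ∈ O.alg) : p a := by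
  have h : p a ∧ a ∈ O.alg := by
    rw [alg_eq_iSup] at ha
    refine Submodule.iSup_induction (motive := fun a => p a ∧ a ∈ O.alg) _ ha
      (fun m a ha => ⟨hom m a ha, O.homog_le_alg m ha⟩) ⟨hom 0 0 (zero_mem _), zero_mem _⟩
      fun a b ha hb => ⟨add a ha.2 b hb.2 ha.1 hb.1, add_mem ha.2 hb.2⟩
  exact h.1

theorem star_mem_alg {a : A} (ha : a ∈ O.alg) : star a ∈ O.alg :=
  O.alg_induction (fun m _ ha => O.homog_le_alg (-m) (O.star_mem_homog ha))
    (fun a _ b _ ha hb => by rw [star_add]; exact add_mem ha hb) ha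

theorem one_mem_alg : (1 : A) ∈ O.alg := O.homog_le_alg 0 O.one_mem_homog

theorem word_mem_alg (μ : List (Fin n)) : O.word μ ∈ O.alg := O.homog_le_alg _ (O.word_mem_homog μ)

theorem gauge_word (z : Circle) (μ : List (Fin n)) :
    O.gauge z (O.word μ) = ((z : ℂ) ^ (μ.length : ℤ)) • O.word μ := by
  induction μ with
  | nil => simp
  | cons i μ ih =>
    rw [word_cons, map_mul, ih, gauge_S, smul_mul_smul_comm, List.length_cons, Nat.cast_succ,
      zpow_add_one₀ z.coe_ne_zero, mul_comm]

theorem spectral_mul {m l : ℤ} {a b : A} (ha : a ∈ O.spectral m) (hb : b ∈ O.spectral l) :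
    a * b ∈ O.spectral (m + l) := fun z => by
  rw [map_mul, ha z, hb z, smul_mul_smul_comm, zpow_add₀ z.coe_ne_zero]

theorem spectral_star {m : ℤ} {a : A} (ha : a ∈ O.spectral m) : star a ∈ O.spectral (-m) :=
  fun z => by
  rw [map_star, ha z, star_smul, zpow_neg, star_zpow₀]
  congr 1
  rw [← inv_zpow, Complex.star_def, ← Circle.coe_inv_eq_conj, Circle.coe_inv]

theorem word_mem_spectral (μ : List (Fin n)) : O.word μ ∈ O.spectral μ.length :=
  fun z => O.gauge_word z μ

theorem homog_le_spectral (m : ℤ) : O.homog m ≤ O.spectral m := by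
  refine Submodule.span_le.2 ?_
  rintro _ ⟨μ, ν, rfl, rfl⟩
  exact O.spectral_mul (O.word_mem_spectral μ) (O.spectral_star (O.word_mem_spectral ν))

theorem mem_fixed_iff {a : A} : a ∈ O.fixed ↔ a ∈ O.spectral 0 := by
  change (∀ z, _) ↔ (∀ z, _)
  simp

/-- The average is the integral of `exp(imθ)` over a period, a Fourier coefficient of the constant
`1`. -/
theorem expectation_of_mem_spectral {m : ℤ} {a : A} (ha : a ∈ O.spectral m) :
    O.expectation a = if m = 0 then a else 0 := by
  have h : ∀ θ : ℝ, O.gauge (Circle.exp θ) a = Complex.exp ((m * Complex.I) * θ) • a := fun θ => by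
    rw [ha, Circle.coe_exp, ← Complex.exp_int_mul]
    congr 2
    ring
  unfold expectation
  simp only [h]
  rw [intervalIntegral.integral_smul_const]
  split_ifs with hm
  · subst hm
    have h1 : (∫ θ in (0 : ℝ)..(2 * Real.pi), Complex.exp (((0 : ℤ) * Complex.I) * θ)) =
        2 * Real.pi := by simp
    rw [h1, smul_smul]
    have h2 : ((1 / (2 * Real.pi) : ℝ) : ℂ) * (2 * Real.pi) = 1 := by
      have : (Real.pi : ℂ) ≠ 0 := by exact_mod_cast Real.pi_ne_zero
      push_cast
      field_simp
    rw [h2, one_smul]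
  · have hm' : (m : ℂ) * Complex.I ≠ 0 := by simp [hm]
    rw [integral_exp_mul_complex hm']
    have : Complex.exp ((m * Complex.I) * ((2 * Real.pi : ℝ) : ℂ)) = 1 := by
      rw [Complex.exp_eq_one_iff]
      exact ⟨m, by push_cast; ring⟩
    rw [this]
    simp

theorem S_mul_mem_homog (i : Fin n) {m : ℤ} {a : A} (ha : a ∈ O.homog m) :
    O.S i * a ∈ O.homog (m + 1) := by
  induction ha using Submodule.span_induction with
  | mem x hx =>
    obtain ⟨μ, ν, h, rfl⟩ := hx
    rw [← mul_assoc, ← word_cons]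
    exact Submodule.subset_span ⟨i :: μ, ν, by simp; omega, rfl⟩
  | zero => simp
  | add x y _ _ hx hy => rw [mul_add]; exact add_mem hx hy
  | smul c x _ hx => rw [mul_smul_comm]; exact Submodule.smul_mem _ _ hx

theorem word_mul_mem_homog (μ : List (Fin n)) {m : ℤ} {a : A} (ha : a ∈ O.homog m) :
    O.word μ * a ∈ O.homog (m + μ.length) := by
  induction μ with
  | nil => simpa
  | cons i μ ih =>
    rw [word_cons, mul_assoc]
    convert O.S_mul_mem_homog i ih using 2
    simp; ring

theorem star_word_mul_word (μ : List (Fin n)) : star (O.word μ) * O.word μ = 1 := by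
  induction μ with
  | nil => simp
  | cons i μ ih =>
    rw [word_cons, star_mul, mul_assoc, ← mul_assoc (star (O.S i)), O.rel.1, one_mul, ih]

section Order

variable [PartialOrder A] [StarOrderedRing A]

theorem star_S_mul_S (i j : Fin n) : star (O.S i) * O.S j = if i = j then 1 else 0 := by
  split_ifs with h
  · subst h; exact O.rel.1 i
  -- Compressing `∑ S_l S_l* = 1` by `S_j` gives a sum of positive elements equal to `1`. The term
  -- `l = j` is already `1`, so every other term vanishes.
  have h1 : ∑ l, star (star (O.S l) * O.S j) * (star (O.S l) * O.S j) = 1 := by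
    calc _ = ∑ l, star (O.S j) * (O.S l * star (O.S l)) * O.S j := by
          simp only [star_mul, star_star, mul_assoc]
      _ = 1 := by rw [← Finset.sum_mul, ← Finset.mul_sum, O.rel.2, mul_one, O.rel.1]
  have h2 : ∑ l ∈ Finset.univ.erase j, star (star (O.S l) * O.S j) * (star (O.S l) * O.S j) = 0 := by
    rw [← Finset.add_sum_erase _ _ (Finset.mem_univ j), O.rel.1 j, star_one, mul_one] at h1
    simpa using h1
  rw [Finset.sum_eq_zero_iff_of_nonneg fun l _ => star_mul_self_nonneg _] at h2
  exact CStarRing.star_mul_self_eq_zero_iff _ |>.1 (h2 i (by simp [h]))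

/-- Multiplying `S_μ S_ν*` by `S_i*` either cancels the first letter of `μ`, or gives `0`, or, for
empty `μ`, appends `i` to `ν`; the degree drops by one each time. -/
theorem star_S_mul_mem_homog (i : Fin n) {m : ℤ} {a : A} (ha : a ∈ O.homog m) :
    star (O.S i) * a ∈ O.homog (m - 1) := by
  induction ha using Submodule.span_induction with
  | mem x hx =>
    obtain ⟨μ, ν, h, rfl⟩ := hx
    cases μ with
    | nil =>
      have : star (O.S i) * (O.word [] * star (O.word ν)) =
          O.word [] * star (O.word (ν ++ [i])) := by simp [word_append, word_cons]
      rw [this]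
      refine Submodule.subset_span ⟨[], ν ++ [i], ?_, rfl⟩
      simp at h ⊢; omega
    | cons j μ =>
      rw [word_cons, ← mul_assoc, ← mul_assoc, star_S_mul_S]
      split_ifs
      · rw [one_mul]
        refine Submodule.subset_span ⟨μ, ν, ?_, rfl⟩
        simp at h; omega
      · simp
  | zero => simp
  | add x y _ _ hx hy => rw [mul_add]; exact add_mem hx hy
  | smul c x _ hx => rw [mul_smul_comm]; exact Submodule.smul_mem _ _ hx

theorem star_word_mul_mem_homog (μ : List (Fin n)) {m : ℤ} {a : A} (ha : a ∈ O.homog m) :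
    star (O.word μ) * a ∈ O.homog (m - μ.length) := by
  induction μ generalizing m a with
  | nil => simpa
  | cons i μ ih =>
    rw [word_cons, star_mul, mul_assoc]
    convert ih (O.star_S_mul_mem_homog i ha) using 2
    simp; ring

theorem mul_mem_homog {m l : ℤ} {a b : A} (ha : a ∈ O.homog m) (hb : b ∈ O.homog l) :
    a * b ∈ O.homog (m + l) := by
  induction ha using Submodule.span_induction with
  | mem x hx =>
    obtain ⟨μ, ν, rfl, rfl⟩ := hx
    rw [mul_assoc]
    convert O.word_mul_mem_homog μ (O.star_word_mul_mem_homog ν hb) using 2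
    ring
  | zero => simp
  | add x y _ _ hx hy => rw [add_mul]; exact add_mem hx hy
  | smul c x _ hx => rw [smul_mul_assoc]; exact Submodule.smul_mem _ _ hx

theorem mul_mem_alg {a b : A} (ha : a ∈ O.alg) (hb : b ∈ O.alg) : a * b ∈ O.alg := by
  refine O.alg_induction (p := fun a => a * b ∈ O.alg) (fun m a ha => ?_) (fun a _ a' _ h h' => ?_) ha
  · refine O.alg_induction (p := fun b => a * b ∈ O.alg) (fun l b hb => ?_)
      (fun b _ b' _ h h' => ?_) hb
    · exact O.homog_le_alg _ (O.mul_mem_homog ha hb)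
    · rw [mul_add]; exact add_mem h h'
  · rw [add_mul]; exact add_mem h h'

/-- `O_{nc}` is a unital star subalgebra containing the generators. -/
theorem dense_alg : Dense (O.alg : Set A) := by
  let B : StarSubalgebra ℂ A :=
    { carrier := O.alg
      mul_mem' := O.mul_mem_alg
      add_mem' := O.alg.add_mem
      algebraMap_mem' := fun c => by
        rw [Algebra.algebraMap_eq_smul_one]; exact O.alg.smul_mem c O.one_mem_alg
      star_mem' := O.star_mem_alg }
  have h : StarAlgebra.adjoin ℂ (Set.range O.S) ≤ B := by
    refine StarAlgebra.adjoin_le ?_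
    rintro _ ⟨i, rfl⟩
    have := O.word_mem_alg [i]
    rwa [word_cons, word_nil, mul_one] at this
  intro a
  have h2 : a ∈ (StarAlgebra.adjoin ℂ (Set.range O.S)).topologicalClosure := by
    rw [O.generates]; trivial
  exact closure_mono h h2

/-- Words of a fixed length have orthogonal ranges. -/
theorem star_word_mul_word_of_length_eq {μ ν : List (Fin n)} (h : μ.length = ν.length) :
    star (O.word μ) * O.word ν = if μ = ν then 1 else 0 := by
  induction μ generalizing ν with
  | nil =>
    obtain rfl := List.length_eq_zero_iff.1 h.symm
    simp
  | cons i μ ih =>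
    cases ν with
    | nil => simp at h
    | cons j ν =>
      rw [word_cons, word_cons, star_mul, mul_assoc, ← mul_assoc (star (O.S i)), star_S_mul_S]
      by_cases hij : i = j
      · subst hij
        simp only [if_true, one_mul, List.cons.injEq, true_and]
        exact ih (by simpa using h)
      · simp [hij]

end Order

/-- The words of length `r`. -/
def words (n r : ℕ) : Finset (List (Fin n)) :=
  (Finset.univ : Finset (Fin r → Fin n)).map ⟨List.ofFn, List.ofFn_injective⟩

theorem mem_words {r : ℕ} {μ : List (Fin n)} : μ ∈ words n r ↔ μ.length = r := by
  simp only [words, Finset.mem_map, Finset.mem_univ, true_and, Function.Embedding.coeFn_mk]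
  constructor
  · rintro ⟨f, rfl⟩; simp
  · rintro rfl; exact ⟨μ.get, List.ofFn_get μ⟩

theorem sum_word_mul_star (r : ℕ) : ∑ μ ∈ words n r, O.word μ * star (O.word μ) = 1 := by
  induction r with
  | zero =>
    have : words n 0 = {[]} := by ext; simp [mem_words]
    simp [this]
  | succ r ih =>
    have : words n (r + 1) = (Finset.univ ×ˢ words n r).image
        fun p : Fin n × List (Fin n) => p.1 :: p.2 := by
      ext μ
      simp only [mem_words, Finset.mem_image, Finset.mem_product, Finset.mem_univ, true_and,
        Prod.exists]
      constructor
      · intro h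
        cases μ with
        | nil => simp at h
        | cons i μ => exact ⟨i, μ, by simpa using h, rfl⟩
      · rintro ⟨i, ν, h, rfl⟩; simp [h]
    rw [this, Finset.sum_image fun p _ q _ h => by simpa [Prod.ext_iff] using h,
      Finset.sum_product]
    simp only [word_cons, star_mul]
    calc _ = ∑ i, O.S i * (∑ μ ∈ words n r, O.word μ * star (O.word μ)) * star (O.S i) := by
          simp only [Finset.mul_sum, Finset.sum_mul, mul_assoc]
      _ = 1 := by simp only [ih, mul_one, O.rel.2]

end CuntzAlgebra

/-! ### The state `ψ` on words and its KMS property. -/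

namespace CuntzAlgebra.FaithfulTrace

variable {n : ℕ} {A : Type u} [CStarAlgebra A] [PartialOrder A] [StarOrderedRing A]
  {O : CuntzAlgebra n A} (τ : O.FaithfulTrace)

theorem state_apply (a : A) : τ.state a = τ.toLin ⟨O.expectation a, O.expectation_mem a⟩ := rfl

theorem state_coe (f : O.fixed) : τ.state (f : A) = τ.toLin f := by
  rw [state_apply]
  congr 1
  refine Subtype.ext ?_
  simpa using O.expectation_of_mem_spectral (O.mem_fixed_iff.1 f.2)

theorem state_of_mem_spectral {m : ℤ} (hm : m ≠ 0) {a : A} (ha : a ∈ O.spectral m) :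
    τ.state a = 0 := by
  have h : (⟨O.expectation a, O.expectation_mem a⟩ : O.fixed) = 0 :=
    Subtype.ext (by simpa [hm] using O.expectation_of_mem_spectral ha)
  rw [state_apply, h, map_zero]

theorem state_one : τ.state 1 = 1 := by
  simpa [τ.normalised] using τ.state_coe 1

theorem state_mul_comm {f g : A} (hf : f ∈ O.fixed) (hg : g ∈ O.fixed) :
    τ.state (f * g) = τ.state (g * f) := by
  have := τ.trace ⟨f, hf⟩ ⟨g, hg⟩
  rwa [← state_coe, ← state_coe] at this

theorem state_star (a : A) : τ.state (star a) = star (τ.state a) := map_star τ.state a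

/-- The `S_μ S_μ*` with `|μ| = r` are equivalent projections in `F` with sum `1`, so the trace gives
each the value `n^{-r}`. Distinct words of equal length have orthogonal ranges, and words of
different lengths give nonzero degree. -/
theorem state_word (μ ν : List (Fin n)) :
    τ.state (O.word μ * star (O.word ν)) = if μ = ν then ((n : ℂ) ^ μ.length)⁻¹ else 0 := by
  have hs : ∀ μ ν : List (Fin n), O.word μ * star (O.word ν) ∈ O.spectral (μ.length - ν.length) :=
    fun μ ν => O.homog_le_spectral _ (O.word_mul_star_mem_homog μ ν)
  by_cases hl : μ.length = ν.length
  · have hf : ∀ {μ ν : List (Fin n)}, μ.length = ν.length → O.word μ * star (O.word ν) ∈ O.fixed :=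
      fun {μ ν} h => O.mem_fixed_iff.2 (by simpa [h] using hs μ ν)
    have key : ∀ {μ ν : List (Fin n)}, μ.length = ν.length → ∀ ρ : List (Fin n),
        ρ.length = ν.length → τ.state (O.word μ * star (O.word ν)) =
          if μ = ν then τ.state (O.word ρ * star (O.word ρ)) else 0 := by
      intro μ ν hl ρ hρ
      -- Both factors lie in `F` because the lengths agree. Interchanging them under the trace
      -- leaves `S_ν* S_μ` in the middle, which is `δ_{μν}`.
      have h1 : O.word μ * star (O.word ν) =
          (O.word μ * star (O.word ρ)) * (O.word ρ * star (O.word ν)) := by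
        rw [mul_assoc, ← mul_assoc (star (O.word ρ)), O.star_word_mul_word, one_mul]
      rw [h1, τ.state_mul_comm (hf (hl.trans hρ.symm)) (hf hρ), mul_assoc,
        ← mul_assoc (star (O.word ν)), O.star_word_mul_word_of_length_eq hl.symm]
      by_cases h : μ = ν
      · simp [h]
      · simp [h, Ne.symm h]
    by_cases h : μ = ν
    · subst h
      rw [if_pos rfl]
      -- The `n^r` projections have equal trace and add up to `1`.
      refine eq_inv_of_mul_eq_one_right ?_
      have h1 := congrArg τ.state (O.sum_word_mul_star μ.length)
      rw [map_sum, state_one] at h1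
      rw [← h1, Finset.sum_congr rfl fun ν hν => by
        rw [key rfl μ (mem_words.1 hν).symm, if_pos rfl]]
      simp [words]
    · rw [key hl ν rfl, if_neg h, if_neg h]
  · rw [if_neg (by rintro rfl; exact hl rfl)]
    exact τ.state_of_mem_spectral (by omega) (hs μ ν)

/-- On `b = S_μ S_{jν}*` the left side pairs words one letter longer than those left after `S_j*
S_i` cancels on the right; that letter is the factor `n⁻¹`. For `b = S_μ` both sides have positive
degree and vanish. -/
theorem state_S_mul (i : Fin n) {b : A} (hb : b ∈ O.alg) :
    τ.state (O.S i * b) = (n : ℂ)⁻¹ * τ.state (b * O.S i) := by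
  induction hb using Submodule.span_induction with
  | mem x hx =>
    obtain ⟨μ, ν, rfl⟩ := hx
    rw [← mul_assoc, ← word_cons, state_word]
    cases ν with
    | nil =>
      have h : O.word μ * star (O.word []) * O.S i = O.word (μ ++ [i]) * star (O.word []) := by
        simp [word_append, word_cons]
      rw [h, state_word]
      simp
    | cons j ν =>
      rw [word_cons, star_mul, mul_assoc, mul_assoc, O.star_S_mul_S]
      by_cases hij : i = j
      · subst hij
        rw [if_pos rfl, mul_one, state_word]
        by_cases h : μ = ν
        · simp [h, pow_succ, mul_comm]
        · simp [h]
      · simp [hij, Ne.symm hij]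
  | zero => simp
  | add x y _ _ hx hy => simp only [mul_add, add_mul, map_add, hx, hy]
  | smul c x _ hx =>
    simp only [mul_smul_comm, smul_mul_assoc, map_smul, hx, smul_eq_mul]
    ring

variable [NeZero n]

theorem state_word_mul (μ : List (Fin n)) {b : A} (hb : b ∈ O.alg) :
    τ.state (O.word μ * b) = (n : ℂ) ^ (-(μ.length : ℤ)) * τ.state (b * O.word μ) := by
  induction μ generalizing b with
  | nil => simp
  | cons i μ ih =>
    have hi : O.S i ∈ O.alg := by simpa [word_cons] using O.word_mem_alg [i]
    rw [word_cons, mul_assoc, τ.state_S_mul i (O.mul_mem_alg (O.word_mem_alg μ) hb), mul_assoc,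
      ih (O.mul_mem_alg hb hi), ← mul_assoc, ← mul_assoc]
    congr 1
    rw [List.length_cons, Nat.cast_succ, neg_add, zpow_add₀ (NeZero.ne _), zpow_neg_one, mul_comm]

theorem state_star_word_mul (μ : List (Fin n)) {b : A} (hb : b ∈ O.alg) :
    τ.state (star (O.word μ) * b) = (n : ℂ) ^ (μ.length : ℤ) * τ.state (b * star (O.word μ)) := by
  have h := congrArg star (τ.state_word_mul μ (O.star_mem_alg hb))
  rw [← state_star, star_mul, star_star, star_mul', ← state_star, star_mul, star_star] at h
  rw [h]
  simp [← mul_assoc]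

/-- The KMS property of `ψ`. -/
theorem state_homog_mul {m : ℤ} {a b : A} (ha : a ∈ O.homog m) (hb : b ∈ O.alg) :
    τ.state (a * b) = (n : ℂ) ^ (-m) * τ.state (b * a) := by
  induction ha using Submodule.span_induction with
  | mem x hx =>
    obtain ⟨μ, ν, rfl, rfl⟩ := hx
    have hν := O.star_mem_alg (O.word_mem_alg ν)
    rw [mul_assoc, τ.state_word_mul μ (O.mul_mem_alg hν hb), mul_assoc,
      τ.state_star_word_mul ν (O.mul_mem_alg hb (O.word_mem_alg μ)), ← mul_assoc, mul_assoc b,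
      ← zpow_add₀ (NeZero.ne _)]
    congr 2
    ring
  | zero => simp
  | add x y _ _ hx hy => simp only [mul_add, add_mul, map_add, hx, hy]
  | smul c x _ hx =>
    simp only [mul_smul_comm, smul_mul_assoc, map_smul, hx, smul_eq_mul]
    ring

end CuntzAlgebra.FaithfulTrace

/-! ### The GNS representation. -/

namespace CuntzAlgebra.FaithfulTrace

variable {n : ℕ} {A : Type u} [CStarAlgebra A] [PartialOrder A] [StarOrderedRing A]
  {O : CuntzAlgebra n A} (τ : O.FaithfulTrace)

theorem inner_vec (a b : A) : ⟪τ.vec a, τ.vec b⟫_ℂ = τ.state (star a * b) :=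
  UniformSpace.Completion.inner_coe _ _

theorem rep_vec (a b : A) : τ.rep a (τ.vec b) = τ.vec (a * b) := by
  change τ.state.gnsNonUnitalStarAlgHom a (((τ.state.toPreGNS b : τ.state.PreGNS)) : τ.state.GNS) = _
  rw [PositiveLinearMap.gnsNonUnitalStarAlgHom_apply_coe]
  rfl

theorem rep_mul (a b : A) : τ.rep (a * b) = τ.rep a * τ.rep b := map_mul τ.state.gnsStarAlgHom a b

theorem rep_add (a b : A) : τ.rep (a + b) = τ.rep a + τ.rep b := map_add τ.state.gnsStarAlgHom a b

theorem rep_one : τ.rep 1 = 1 := map_one τ.state.gnsStarAlgHom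

theorem rep_zero : τ.rep 0 = 0 := map_zero τ.state.gnsStarAlgHom

theorem rep_sum {ι : Type*} (s : Finset ι) (f : ι → A) :
    τ.rep (∑ i ∈ s, f i) = ∑ i ∈ s, τ.rep (f i) := map_sum τ.state.gnsStarAlgHom f s

theorem rep_smul (c : ℂ) (a : A) : τ.rep (c • a) = c • τ.rep a := map_smul τ.state.gnsStarAlgHom c a

theorem adjoint_rep (a : A) : ContinuousLinearMap.adjoint (τ.rep a) = τ.rep (star a) :=
  (map_star τ.state.gnsStarAlgHom a).symm

theorem continuous_vec : Continuous τ.vec := by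
  have h : ∀ a, τ.vec a = τ.rep a (τ.vec 1) := fun a => by rw [rep_vec, mul_one]
  have hc : Continuous fun a => τ.rep a :=
    AddMonoidHomClass.continuous_of_bound τ.state.gnsStarAlgHom 1 fun a => by
      rw [one_mul]; exact NonUnitalStarAlgHom.norm_apply_le τ.state.gnsStarAlgHom a
  rw [funext h]
  exact hc.clm_apply continuous_const

theorem denseRange_vec : DenseRange τ.vec := by
  have h : DenseRange ((↑) : τ.state.PreGNS → τ.state.GNS) :=
    UniformSpace.Completion.denseRange_coe
  exact h.comp τ.state.toPreGNS.surjective.denseRange (UniformSpace.Completion.continuous_coe _)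

theorem dense_vec_alg : Dense (τ.vec '' (O.alg : Set A)) :=
  τ.denseRange_vec.dense_image τ.continuous_vec O.dense_alg

/-- Homogeneous elements span a dense subspace of `H`, so operator identities below are checked on
them alone. -/
theorem clm_ext {E : Type*} [NormedAddCommGroup E] [NormedSpace ℂ E] {T T' : τ.H →L[ℂ] E}
    (h : ∀ m, ∀ a ∈ O.homog m, T (τ.vec a) = T' (τ.vec a)) : T = T' := by
  refine ContinuousLinearMap.coeFn_injective
    (Continuous.ext_on τ.dense_vec_alg T.continuous T'.continuous ?_)
  rintro _ ⟨a, ha, rfl⟩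
  refine O.alg_induction (p := fun a => T (τ.vec a) = T' (τ.vec a)) h (fun a _ b _ ha hb => ?_) ha
  simp only [map_add, ha, hb]

theorem eq_of_inner_vec {x y : τ.H} (h : ∀ m, ∀ a ∈ O.homog m, ⟪x, τ.vec a⟫_ℂ = ⟪y, τ.vec a⟫_ℂ) :
    x = y := by
  have : innerSL ℂ x = innerSL ℂ y := τ.clm_ext h
  exact (ext_inner_right ℂ fun v => DFunLike.congr_fun this v)

/-! ### The spectral projections of the gauge action -/

theorem proj_vec_spectral {l : ℤ} (m : ℤ) {b : A} (hb : b ∈ O.spectral l) :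
    τ.proj m (τ.vec b) = if m = l then τ.vec b else 0 := by
  unfold proj
  split_ifs with h
  · subst h
    exact Submodule.starProjection_eq_self_iff.2
      (Submodule.le_topologicalClosure _ (Submodule.mem_map_of_mem hb))
  · rw [Submodule.starProjection_apply_eq_zero_iff, Submodule.orthogonal_closure,
      Submodule.mem_orthogonal]
    rintro _ ⟨a, ha, rfl⟩
    rw [inner_vec]
    -- Different spectral subspaces are orthogonal because `a* b` has nonzero degree.
    exact τ.state_of_mem_spectral (m := -m + l) (by omega) (O.spectral_mul (O.spectral_star ha) hb)

theorem proj_vec {l : ℤ} (m : ℤ) {b : A} (hb : b ∈ O.homog l) :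
    τ.proj m (τ.vec b) = if m = l then τ.vec b else 0 :=
  τ.proj_vec_spectral m (O.homog_le_spectral l hb)

theorem inner_proj_left (m : ℤ) (x y : τ.H) : ⟪τ.proj m x, y⟫_ℂ = ⟪x, τ.proj m y⟫_ℂ :=
  Submodule.inner_starProjection_left_eq_right _ x y

theorem adjoint_proj (m : ℤ) : ContinuousLinearMap.adjoint (τ.proj m) = τ.proj m :=
  ((ContinuousLinearMap.eq_adjoint_iff _ _).2 (τ.inner_proj_left m)).symm

theorem proj_proj (m l : ℤ) (x : τ.H) : τ.proj m (τ.proj l x) = if m = l then τ.proj l x else 0 := by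
  have h : τ.proj m ∘L τ.proj l = if m = l then τ.proj l else 0 := by
    refine τ.clm_ext fun j a ha => ?_
    rw [ContinuousLinearMap.comp_apply, τ.proj_vec l ha]
    by_cases h1 : l = j
    · subst h1
      by_cases h2 : m = l
      · subst h2; simp [τ.proj_vec _ ha]
      · simp [h2, τ.proj_vec _ ha]
    · by_cases h2 : m = l
      · subst h2; simp [h1, τ.proj_vec _ ha]
      · simp [h1, h2]
  have := DFunLike.congr_fun h x
  rw [ContinuousLinearMap.comp_apply] at this
  rw [this]
  split_ifs <;> rfl

/-- An element of degree `j` shifts the spectral subspaces by `j`. -/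
theorem rep_proj {j : ℤ} {a : A} (ha : a ∈ O.homog j) (l : ℤ) (x : τ.H) :
    τ.rep a (τ.proj l x) = τ.proj (j + l) (τ.rep a x) := by
  have h : τ.rep a ∘L τ.proj l = τ.proj (j + l) ∘L τ.rep a := by
    refine τ.clm_ext fun i b hb => ?_
    rw [ContinuousLinearMap.comp_apply, ContinuousLinearMap.comp_apply, τ.proj_vec l hb, rep_vec,
      τ.proj_vec (j + l) (O.mul_mem_homog ha hb)]
    by_cases h : l = i
    · simp [h, rep_vec]
    · simp [h]
  exact DFunLike.congr_fun h x

theorem inner_proj_proj {m l : ℤ} (h : m ≠ l) (x y : τ.H) : ⟪τ.proj m x, τ.proj l y⟫_ℂ = 0 := by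
  rw [inner_proj_left, proj_proj, if_neg h, inner_zero_right]

theorem orthogonalFamily_proj : OrthogonalFamily ℂ
    (fun m : ℤ => ((O.spectral m).map τ.vec).topologicalClosure)
    fun m => ((O.spectral m).map τ.vec).topologicalClosure.subtypeₗᵢ := by
  intro m l hml v w
  have hv : τ.proj m v = v := Submodule.starProjection_eq_self_iff.2 v.2
  have hw : τ.proj l w = w := Submodule.starProjection_eq_self_iff.2 w.2
  change ⟪(v : τ.H), (w : τ.H)⟫_ℂ = 0
  rw [← hv, ← hw]
  exact τ.inner_proj_proj hml _ _

theorem norm_sq_sum_of_proj {f : ℤ → τ.H} (hf : ∀ m, τ.proj m (f m) = f m) (s : Finset ℤ) :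
    ‖∑ m ∈ s, f m‖ ^ 2 = ∑ m ∈ s, ‖f m‖ ^ 2 :=
  τ.orthogonalFamily_proj.norm_sum
    (fun m => ⟨f m, Submodule.starProjection_eq_self_iff.1 (hf m)⟩) s

theorem summable_iff_of_proj {f : ℤ → τ.H} (hf : ∀ m, τ.proj m (f m) = f m) :
    Summable f ↔ Summable fun m => ‖f m‖ ^ 2 :=
  τ.orthogonalFamily_proj.summable_iff_norm_sq_summable
    (fun m => ⟨f m, Submodule.starProjection_eq_self_iff.1 (hf m)⟩)

theorem proj_idem (m : ℤ) (x : τ.H) : τ.proj m (τ.proj m x) = τ.proj m x := by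
  rw [proj_proj, if_pos rfl]

theorem inner_proj_self (m : ℤ) (x : τ.H) : ⟪x, τ.proj m x⟫_ℂ = ((‖τ.proj m x‖ ^ 2 : ℝ) : ℂ) := by
  rw [← proj_idem, ← inner_proj_left, inner_self_eq_norm_sq_to_K, proj_idem]
  norm_cast

/-- Bessel's inequality, from `‖y‖² = ⟨x, y⟩ ≤ ‖x‖ ‖y‖` for the partial sum `y` of the projections
of `x`. -/
theorem sum_norm_sq_proj_le (s : Finset ℤ) (x : τ.H) : ∑ m ∈ s, ‖τ.proj m x‖ ^ 2 ≤ ‖x‖ ^ 2 := by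
  have h1 := τ.norm_sq_sum_of_proj (fun m => τ.proj_idem m x) s
  have h2 : ⟪x, ∑ m ∈ s, τ.proj m x⟫_ℂ = ((∑ m ∈ s, ‖τ.proj m x‖ ^ 2 : ℝ) : ℂ) := by
    rw [inner_sum, Complex.ofReal_sum]
    exact Finset.sum_congr rfl fun m _ => τ.inner_proj_self m x
  have h3 := norm_inner_le_norm (𝕜 := ℂ) x (∑ m ∈ s, τ.proj m x)
  rw [h2, ← h1, Complex.norm_real, Real.norm_of_nonneg (by positivity)] at h3
  rw [← h1]
  have : ‖∑ m ∈ s, τ.proj m x‖ ≤ ‖x‖ := by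
    by_contra! hlt
    nlinarith [norm_nonneg x]
  gcongr

theorem summable_norm_sq_proj (x : τ.H) : Summable fun m => ‖τ.proj m x‖ ^ 2 :=
  summable_of_sum_le (fun _ => by positivity) fun s => τ.sum_norm_sq_proj_le s x

/-- A vector is determined by its inner products with homogeneous vectors, and each of these sees a
single spectral component. -/
theorem hasSum_of_proj {f : ℤ → τ.H} (hf : ∀ m, τ.proj m (f m) = f m) (hs : Summable f) {x : τ.H}
    (hx : ∀ m, τ.proj m x = f m) : HasSum f x := by
  convert hs.hasSum
  refine τ.eq_of_inner_vec fun l a ha => ?_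
  have hp : ∀ y, ⟪y, τ.vec a⟫_ℂ = ⟪τ.proj l y, τ.vec a⟫_ℂ := fun y => by
    rw [inner_proj_left, τ.proj_vec l ha, if_pos rfl]
  rw [hp x, hp (∑' m, f m), hx, (τ.proj l).map_tsum hs, tsum_eq_single l, hf]
  intro m hm
  rw [← hf, proj_proj, if_neg hm.symm]

theorem hasSum_proj (x : τ.H) : HasSum (fun m => τ.proj m x) x :=
  τ.hasSum_of_proj (fun m => τ.proj_idem m x)
    ((τ.summable_iff_of_proj fun m => τ.proj_idem m x).2 (τ.summable_norm_sq_proj x)) fun _ => rfl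

theorem eq_of_proj {x y : τ.H} (h : ∀ m, τ.proj m x = τ.proj m y) : x = y :=
  (τ.hasSum_proj x).unique (by simpa only [h] using τ.hasSum_proj y)

theorem proj_of_hasSum {f : ℤ → τ.H} (hf : ∀ m, τ.proj m (f m) = f m) {x : τ.H} (hx : HasSum f x)
    (l : ℤ) : τ.proj l x = f l := by
  have h := hx.mapL (τ.proj l)
  refine h.unique ?_
  have := hasSum_single (f := fun m => τ.proj l (f m)) l fun m hm => by
    rw [← hf, proj_proj, if_neg hm.symm]
  rwa [hf] at this

/-! ### Functions of the generator -/

/-- `B = ∑ h(m) Φ_m`. -/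
def IsDiag (h : ℤ → ℝ) (B : τ.H →L[ℂ] τ.H) : Prop :=
  ∀ x, HasSum (fun m => (h m : ℂ) • τ.proj m x) (B x)

/-- The components are orthogonal, so convergence and the norm bound reduce to Bessel's inequality.
-/
theorem exists_isDiag {h : ℤ → ℝ} {C : ℝ} (hC : ∀ m, |h m| ≤ C) : ∃ B, τ.IsDiag h B := by
  have hp : ∀ x m, τ.proj m ((h m : ℂ) • τ.proj m x) = (h m : ℂ) • τ.proj m x := fun x m => by
    rw [map_smul, proj_idem]
  have hle : ∀ x m, ‖(h m : ℂ) • τ.proj m x‖ ^ 2 ≤ C ^ 2 * ‖τ.proj m x‖ ^ 2 := fun x m => by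
    rw [norm_smul, mul_pow, Complex.norm_real, Real.norm_eq_abs]
    gcongr
    exact hC m
  have hs : ∀ x, Summable fun m => (h m : ℂ) • τ.proj m x := fun x =>
    (τ.summable_iff_of_proj (hp x)).2 (Summable.of_nonneg_of_le (fun _ => by positivity) (hle x)
      ((τ.summable_norm_sq_proj x).mul_left _))
  let L : τ.H →ₗ[ℂ] τ.H :=
    { toFun := fun x => ∑' m, (h m : ℂ) • τ.proj m x
      map_add' := fun x y => by
        simp only [map_add, smul_add]; exact (hs x).tsum_add (hs y)
      map_smul' := fun c x => by
        simp only [map_smul, RingHom.id_apply, smul_comm _ c]; exact (hs x).tsum_const_smul c }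
  refine ⟨L.mkContinuous C fun x => ?_, fun x => (hs x).hasSum⟩
  have hC0 : 0 ≤ C := (abs_nonneg _).trans (hC 0)
  refine le_of_tendsto (hs x).hasSum.norm (Filter.Eventually.of_forall fun s => ?_)
  rw [← sq_le_sq₀ (norm_nonneg _) (by positivity), τ.norm_sq_sum_of_proj (hp x), mul_pow]
  calc _ ≤ ∑ m ∈ s, C ^ 2 * ‖τ.proj m x‖ ^ 2 := Finset.sum_le_sum fun m _ => hle x m
    _ ≤ _ := by
      rw [← Finset.mul_sum]
      gcongr
      exact τ.sum_norm_sq_proj_le s x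

variable {τ}

theorem IsDiag.proj_apply {h : ℤ → ℝ} {B : τ.H →L[ℂ] τ.H} (hB : τ.IsDiag h B) (m : ℤ) (x : τ.H) :
    τ.proj m (B x) = (h m : ℂ) • τ.proj m x :=
  τ.proj_of_hasSum (f := fun m => (h m : ℂ) • τ.proj m x)
    (fun m => by rw [map_smul, proj_idem]) (hB x) m

theorem IsDiag.adjoint_eq {h : ℤ → ℝ} {B : τ.H →L[ℂ] τ.H} (hB : τ.IsDiag h B) :
    ContinuousLinearMap.adjoint B = B := by
  symm
  rw [ContinuousLinearMap.eq_adjoint_iff]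
  intro x y
  have h1 := ((hB x).mapL (innerSL ℂ y)).star
  have h2 := (hB y).mapL (innerSL ℂ x)
  simp only [innerSL_apply_apply, Complex.star_def, inner_conj_symm] at h1 h2
  refine h1.unique ?_
  convert h2 using 2 with m
  rw [inner_smul_left, inner_smul_right, Complex.conj_ofReal, inner_proj_left]

theorem IsDiag.hasSum_inner {h : ℤ → ℝ} {B : τ.H →L[ℂ] τ.H} (hB : τ.IsDiag h B) (x : τ.H) :
    HasSum (fun m => h m * ‖τ.proj m x‖ ^ 2) (⟪x, B x⟫_ℂ).re := by
  have h2 := ((hB x).mapL (innerSL ℂ x)).mapL Complex.reCLM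
  simpa only [innerSL_apply_apply, inner_smul_right, Complex.reCLM_apply, Complex.re_ofReal_mul,
    inner_proj_self, Complex.ofReal_re] using h2

theorem IsDiag.isPositive {h : ℤ → ℝ} {B : τ.H →L[ℂ] τ.H} (hB : τ.IsDiag h B) (hh : ∀ m, 0 ≤ h m) :
    B.IsPositive := by
  rw [ContinuousLinearMap.isPositive_def']
  refine ⟨hB.adjoint_eq, fun x => ?_⟩
  rw [ContinuousLinearMap.reApplyInnerSelf_apply, inner_re_symm]
  exact (hB.hasSum_inner x).nonneg fun m => by have := hh m; positivity

theorem IsDiag.sub {h h' : ℤ → ℝ} {B B' : τ.H →L[ℂ] τ.H} (hB : τ.IsDiag h B)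
    (hB' : τ.IsDiag h' B') : τ.IsDiag (h - h') (B - B') := fun x => by
  simpa [sub_smul] using (hB x).sub (hB' x)

variable (τ)

theorem isDiag_proj (m : ℤ) : τ.IsDiag (Pi.single m 1) (τ.proj m) := fun x => by
  have := hasSum_single (f := fun l => ((Pi.single m 1 : ℤ → ℝ) l : ℂ) • τ.proj l x) m
    fun l hl => by simp [hl]
  simpa using this

/-! ### The von Neumann algebra -/

theorem proj_zero_vec {a : A} (ha : a ∈ O.alg) : τ.proj 0 (τ.vec a) = τ.vec (O.expectation a) := by
  refine O.alg_induction (p := fun a => τ.proj 0 (τ.vec a) = τ.vec (O.expectation a))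
    (fun m a ha => ?_) (fun a _ b _ ha hb => ?_) ha
  · rw [τ.proj_vec 0 ha, O.expectation_of_mem_spectral (O.homog_le_spectral m ha)]
    by_cases h : m = 0
    · simp [h]
    · simp [h, Ne.symm h]
  · have h : O.expectation (a + b) = O.expectation a + O.expectation b :=
      congrArg Subtype.val (O.expectationMap.map_add a b)
    rw [map_add, map_add, ha, hb, h, map_add]

theorem rep_proj_zero_rep_mem_finiteRank {a b : A} (ha : a ∈ O.alg) (hb : b ∈ O.alg) :
    τ.rep a * τ.proj 0 * τ.rep (star b) ∈ τ.finiteRank := by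
  refine Submodule.subset_span ⟨a, ha, b, hb, fun z hz => ?_⟩
  change τ.rep a (τ.proj 0 (τ.rep (star b) (τ.vec z))) = _
  rw [rep_vec, τ.proj_zero_vec (O.mul_mem_alg (O.star_mem_alg hb) hz), rep_vec]

/-- Each `Φ_m` is itself of finite rank over `F`. For `r ≥ 0`, `Φ_r = ∑_{|μ|=r} S_μ Φ_0 S_μ*`, while
`Φ_{-r} = S_μ* Φ_0 S_μ` for any single word `μ` of length `r`. -/
theorem rep_proj_rep_mem_finiteRank [NeZero n] {a b : A} (ha : a ∈ O.alg) (hb : b ∈ O.alg) (m : ℤ) :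
    τ.rep a * τ.proj m * τ.rep (star b) ∈ τ.finiteRank := by
  obtain ⟨r, rfl | rfl⟩ := m.eq_nat_or_neg
  · have h : τ.rep a * τ.proj r * τ.rep (star b) = ∑ μ ∈ words n r,
        τ.rep (a * O.word μ) * τ.proj 0 * τ.rep (star (b * O.word μ)) := by
      have h1 : τ.proj r = ∑ μ ∈ words n r, τ.rep (O.word μ) * τ.proj 0 * τ.rep (star (O.word μ)) := by
        ext x
        have h2 : ∀ μ ∈ words n r, (τ.rep (O.word μ) * τ.proj 0 * τ.rep (star (O.word μ))) x =
            τ.proj r (τ.rep (O.word μ * star (O.word μ)) x) := fun μ hμ => by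
          change τ.rep (O.word μ) (τ.proj 0 (τ.rep (star (O.word μ)) x)) = _
          rw [τ.rep_proj (O.word_mem_homog μ), mem_words.1 hμ, add_zero, rep_mul]
          rfl
        rw [sum_apply, Finset.sum_congr rfl h2, ← map_sum,
          ← sum_apply, ← rep_sum, O.sum_word_mul_star, rep_one]
        rfl
      rw [h1, Finset.mul_sum, Finset.sum_mul]
      simp only [star_mul, rep_mul, mul_assoc]
    rw [h]
    exact sum_mem fun μ _ => τ.rep_proj_zero_rep_mem_finiteRank
      (O.mul_mem_alg ha (O.word_mem_alg μ)) (O.mul_mem_alg hb (O.word_mem_alg μ))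
  · obtain ⟨μ, hμ⟩ : ∃ μ : List (Fin n), μ.length = r := ⟨List.replicate r 0, by simp⟩
    have h1 : τ.proj (-r) = τ.rep (star (O.word μ)) * τ.proj 0 * τ.rep (O.word μ) := by
      ext x
      change _ = τ.rep (star (O.word μ)) (τ.proj 0 (τ.rep (O.word μ) x))
      rw [τ.rep_proj (O.star_word_mem_homog μ), hμ, add_zero]
      change _ = τ.proj (-r) ((τ.rep (star (O.word μ)) * τ.rep (O.word μ)) x)
      rw [← rep_mul, O.star_word_mul_word, rep_one]
      rfl
    have h2 := τ.rep_proj_zero_rep_mem_finiteRank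
      (O.mul_mem_alg ha (O.star_mem_alg (O.word_mem_alg μ)))
      (O.mul_mem_alg hb (O.star_mem_alg (O.word_mem_alg μ)))
    rw [h1]
    simpa only [star_mul, rep_mul, mul_assoc, star_star] using h2

-- The operator is a strong sum of finite rank endomorphisms, and anything commuting with each term
-- commutes with the sum.
variable {τ} in
theorem IsDiag.rep_mul_mul_rep_mem_vN [NeZero n] {h : ℤ → ℝ} {B : τ.H →L[ℂ] τ.H}
    (hB : τ.IsDiag h B) {a b : A} (ha : a ∈ O.alg) (hb : b ∈ O.alg) :
    τ.rep a * B * τ.rep (star b) ∈ τ.vN := by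
  have hs : ∀ x, HasSum (fun m => (h m : ℂ) • (τ.rep a * τ.proj m * τ.rep (star b)) x)
      ((τ.rep a * B * τ.rep (star b)) x) := fun x => by
    have := (hB (τ.rep (star b) x)).mapL (τ.rep a)
    simp only [map_smul] at this
    exact this
  refine Set.mem_centralizer_iff.2 fun T hT => ?_
  ext x
  have h1 := (hs x).mapL T
  refine h1.unique ?_
  have h2 : ∀ m, T ((h m : ℂ) • (τ.rep a * τ.proj m * τ.rep (star b)) x) =
      (h m : ℂ) • (τ.rep a * τ.proj m * τ.rep (star b)) (T x) := fun m => by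
    rw [map_smul]
    congr 1
    exact (DFunLike.congr_fun (Set.mem_centralizer_iff.1 hT _
      (τ.rep_proj_rep_mem_finiteRank ha hb m)) x).symm
  simp only [h2]
  exact hs (T x)

theorem zero_mem_vN : (0 : τ.H →L[ℂ] τ.H) ∈ τ.vN := Set.zero_mem_centralizer

theorem sum_mem_vN {ι : Type*} (s : Finset ι) (f : ι → τ.H →L[ℂ] τ.H) (hf : ∀ i ∈ s, f i ∈ τ.vN) :
    ∑ i ∈ s, f i ∈ τ.vN := by
  classical
  induction s using Finset.induction_on with
  | empty => simpa using τ.zero_mem_vN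
  | insert i s hi ih =>
    rw [Finset.sum_insert hi]
    exact Set.add_mem_centralizer (hf i (by simp)) (ih fun j hj => hf j (by simp [hj]))

end CuntzAlgebra.FaithfulTrace

namespace CuntzAlgebra.FaithfulTrace

variable {n : ℕ} {A : Type u} [CStarAlgebra A] [PartialOrder A] [StarOrderedRing A]
  {O : CuntzAlgebra n A} (τ : O.FaithfulTrace)

/-! ### The modular operator -/

/-- Since `a* a` has degree `0`, faithfulness of `τ` on `F` applies to it. -/
theorem eq_zero_of_vec_eq_zero_of_homog {m : ℤ} {a : A} (ha : a ∈ O.homog m) (h : τ.vec a = 0) :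
    a = 0 := by
  have h1 : star a * a ∈ O.fixed := by
    rw [mem_fixed_iff]
    simpa using O.homog_le_spectral _ (O.mul_mem_homog (O.star_mem_homog ha) ha)
  have h2 : τ.state (star a * a) = 0 := by rw [← inner_vec, h, inner_zero_left]
  rw [τ.state_coe ⟨_, h1⟩] at h2
  exact (CStarRing.star_mul_self_eq_zero_iff _).1
    (congrArg Subtype.val (τ.faithful ⟨_, h1⟩ (star_mul_self_nonneg a) h2))

theorem proj_vec_sum {c : ℤ →₀ A} (hc : ∀ j, c j ∈ O.homog j) (m : ℤ) :
    τ.proj m (τ.vec (∑ j ∈ c.support, c j)) = τ.vec (c m) := by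
  rw [map_sum, map_sum, Finset.sum_congr rfl fun j _ => τ.proj_vec m (hc j), Finset.sum_ite_eq]
  split_ifs with h
  · rfl
  · rw [Finsupp.notMem_support_iff.1 h, map_zero]

theorem vec_injOn : Set.InjOn τ.vec O.alg := by
  intro a ha b hb hab
  obtain ⟨c, hc, h⟩ := O.exists_decomp (sub_mem ha hb)
  have h0 : τ.vec (a - b) = 0 := by rw [map_sub, hab, sub_self]
  have h1 : ∀ j, c j = 0 := fun j => by
    refine τ.eq_zero_of_vec_eq_zero_of_homog (hc j) ?_
    rw [← τ.proj_vec_sum hc, ← h, h0, map_zero]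
  rw [← sub_eq_zero, h]
  simp [h1]

theorem exists_vec_eq_proj (m : ℤ) {a : A} (ha : a ∈ O.alg) :
    ∃ b ∈ O.homog m, τ.vec b = τ.proj m (τ.vec a) := by
  obtain ⟨c, hc, rfl⟩ := O.exists_decomp ha
  exact ⟨c m, hc m, (τ.proj_vec_sum hc m).symm⟩

section Modular

variable [NeZero n]

/-- On `O_{nc}` this is the KMS relation; it is a closed condition on the pair, so it passes to the
closure of the graph. -/
theorem inner_of_mem_tomitaGraph {x s : τ.H} (h : (x, s) ∈ τ.tomitaGraph) {l : ℤ} {b : A}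
    (hb : b ∈ O.homog l) : ⟪τ.vec b, s⟫_ℂ = (n : ℂ) ^ l * ⟪x, τ.vec (star b)⟫_ℂ := by
  have hcl : IsClosed {p : τ.H × τ.H |
      ⟪τ.vec b, p.2⟫_ℂ = (n : ℂ) ^ l * ⟪p.1, τ.vec (star b)⟫_ℂ} :=
    isClosed_eq (by fun_prop) (by fun_prop)
  refine closure_minimal ?_ hcl h
  rintro _ ⟨c, hc, rfl⟩
  change ⟪τ.vec b, τ.vec (star c)⟫_ℂ = (n : ℂ) ^ l * ⟪τ.vec c, τ.vec (star b)⟫_ℂ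
  rw [inner_vec, inner_vec, τ.state_homog_mul (O.star_mem_homog hb) (O.star_mem_alg hc), neg_neg]

theorem norm_sq_vec_star {m : ℤ} {b : A} (hb : b ∈ O.homog m) :
    ‖τ.vec (star b)‖ ^ 2 = (n : ℝ) ^ (-m) * ‖τ.vec b‖ ^ 2 := by
  have h := τ.state_homog_mul hb (O.star_mem_alg (O.homog_le_alg _ hb))
  rw [← inner_vec, ← star_star b, star_star (star b), ← inner_vec, star_star,
    inner_self_eq_norm_sq_to_K, inner_self_eq_norm_sq_to_K] at h
  refine Complex.ofReal_injective ?_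
  push_cast
  exact h

/-- On elements of degree `m`, `a ↦ a*` multiplies norms by the constant `n^{-m/2}`
(`norm_sq_vec_star`). Its closure is therefore defined on the whole `m`-th subspace of `H`, with
values in the `(-m)`-th. -/
theorem exists_mem_tomitaGraph_proj (m : ℤ) (x : τ.H) : ∃ s, (τ.proj m x, s) ∈ τ.tomitaGraph ∧
    τ.proj (-m) s = s ∧ ‖s‖ ^ 2 = (n : ℝ) ^ (-m) * ‖τ.proj m x‖ ^ 2 := by
  obtain ⟨v, hv, hvx⟩ := mem_closure_iff_seq_limit.1 (τ.dense_vec_alg x)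
  have hb : ∀ k, ∃ b ∈ O.homog m, τ.vec b = τ.proj m (v k) := fun k => by
    obtain ⟨a, ha, h⟩ := hv k
    rw [← h]
    exact τ.exists_vec_eq_proj m ha
  choose b hb hbv using hb
  have hbx : Filter.Tendsto (fun k => τ.vec (b k)) Filter.atTop (nhds (τ.proj m x)) := by
    simp only [hbv]
    exact ((τ.proj m).continuous.tendsto x).comp hvx
  have hcau : CauchySeq fun k => τ.vec (star (b k)) := by
    have h1 : ∀ k l, dist (τ.vec (star (b k))) (τ.vec (star (b l))) =
        Real.sqrt ((n : ℝ) ^ (-m)) * dist (τ.vec (b k)) (τ.vec (b l)) := fun k l => by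
      rw [dist_eq_norm, dist_eq_norm, ← map_sub, ← map_sub, ← star_sub,
        ← Real.sqrt_sq (norm_nonneg (τ.vec (star _))),
        τ.norm_sq_vec_star (sub_mem (hb k) (hb l)), Real.sqrt_mul (by positivity),
        Real.sqrt_sq (norm_nonneg _)]
    have h2 := hbx.cauchySeq
    rw [cauchySeq_iff_tendsto_dist_atTop_0] at h2 ⊢
    simp only [h1]
    simpa using h2.const_mul (Real.sqrt ((n : ℝ) ^ (-m)))
  obtain ⟨s, hs⟩ := cauchySeq_tendsto_of_complete hcau
  refine ⟨s, mem_closure_of_tendsto (hbx.prodMk_nhds hs) (Filter.Eventually.of_forall fun k =>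
    ⟨b k, O.homog_le_alg _ (hb k), rfl⟩), ?_, ?_⟩
  · refine tendsto_nhds_unique (((τ.proj (-m)).continuous.tendsto s).comp hs) ?_
    convert hs using 2 with k
    exact (τ.proj_vec (-m) (O.star_mem_homog (hb k))).trans (if_pos rfl)
  · refine tendsto_nhds_unique (hs.norm.pow 2) ?_
    simp only [τ.norm_sq_vec_star (hb _)]
    exact (hbx.norm.pow 2).const_mul _

/-- `Δ` acts on the `m`-th spectral subspace by `n^{-m}`, with maximal domain. -/
theorem mem_modularGraph_iff {x y : τ.H} : (x, y) ∈ τ.modularGraph ↔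
    ∀ m : ℤ, τ.proj m y = (n : ℂ) ^ (-m) • τ.proj m x := by
  constructor
  · rintro ⟨s, hs, h⟩ m
    -- Pairing with homogeneous `a` turns the adjoint relation for `𝓕`, combined with the KMS
    -- relation for `𝓢`, into the eigenvalue equation.
    refine τ.eq_of_inner_vec fun l a ha => ?_
    rw [inner_smul_left, inner_proj_left, inner_proj_left, τ.proj_vec m ha]
    split_ifs with hml
    · subst hml
      rw [← h a (O.homog_le_alg m ha), τ.inner_of_mem_tomitaGraph hs (O.star_mem_homog ha), star_star]
      simp
    · simp
  · intro h
    -- Conversely, `𝓢 x` is assembled from its components `s m`, where `s m` has degree `-m`; hence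
    -- the reindexing by negation.
    choose s hs hps hns using fun m => τ.exists_mem_tomitaGraph_proj m x
    have hsum : Summable s := by
      rw [← (Equiv.neg ℤ).summable_iff,
        τ.summable_iff_of_proj (f := s ∘ Equiv.neg ℤ) fun m => by simpa using hps (-m),
        ← (Equiv.neg ℤ).summable_iff]
      refine Summable.of_nonneg_of_le (fun _ => sq_nonneg _) (fun m => ?_)
        ((τ.summable_norm_sq_proj x).add (τ.summable_norm_sq_proj y))
      have h1 : ‖τ.proj m y‖ = (n : ℝ) ^ (-m) * ‖τ.proj m x‖ := by
        rw [h m, norm_smul, norm_zpow, Complex.norm_natCast]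
      simp only [Function.comp_apply, Equiv.neg_apply, neg_neg]
      -- `‖s m‖² = n^{-m} ‖Φ_m x‖² = ‖Φ_m y‖ ‖Φ_m x‖`, which is bounded by the sum of the two
      -- squares.
      rw [hns, pow_two ‖τ.proj m x‖, ← mul_assoc, ← h1]
      nlinarith [sq_nonneg (‖τ.proj m x‖ - ‖τ.proj m y‖), sq_nonneg ‖τ.proj m x‖,
        sq_nonneg ‖τ.proj m y‖]
    have hmem : (x, ∑' m, s m) ∈ τ.tomitaGraph := by
      refine IsClosed.mem_of_tendsto (isClosed_closure) ((τ.hasSum_proj x).prodMk hsum.hasSum)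
        (Filter.Eventually.of_forall fun t => ?_)
      classical
      induction t using Finset.induction_on with
      | empty => simpa using τ.tomitaGraph_zero
      | insert m t hm ih =>
        rw [Finset.sum_insert hm]
        exact τ.tomitaGraph_add (hs m) ih
    refine ⟨_, hmem, fun a ha => ?_⟩
    refine O.alg_induction (p := fun a => ⟪τ.vec (star a), ∑' m, s m⟫_ℂ = ⟪y, τ.vec a⟫_ℂ)
      (fun m a ha => ?_) (fun a _ b _ ha hb => ?_) ha
    · have hp : τ.vec a = τ.proj m (τ.vec a) := by rw [τ.proj_vec m ha, if_pos rfl]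
      rw [τ.inner_of_mem_tomitaGraph hmem (O.star_mem_homog ha), star_star, hp, ← inner_proj_left,
        ← inner_proj_left, h m, inner_smul_left]
      simp
    · rw [star_add, map_add, map_add, inner_add_left, inner_add_right, ha, hb]

theorem modular_graph : τ.modular.graph = τ.modularGraph := by
  refine Submodule.toLinearPMap_graph_eq _ ?_
  rintro ⟨x, y⟩ h (rfl : x = 0)
  rw [mem_modularGraph_iff] at h
  exact τ.eq_of_proj fun m => by simpa using h m

theorem mem_modular_graph_iff {x y : τ.H} : (x, y) ∈ τ.modular.graph ↔
    ∀ m : ℤ, τ.proj m y = (n : ℂ) ^ (-m) • τ.proj m x := by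
  rw [modular_graph, mem_modularGraph_iff]

theorem proj_modular (x : τ.modular.domain) (m : ℤ) :
    τ.proj m (τ.modular x) = (n : ℂ) ^ (-m) • τ.proj m x :=
  τ.mem_modular_graph_iff.1 (τ.modular.mem_graph x) m

theorem exists_modular_eq {x y : τ.H} (h : ∀ m : ℤ, τ.proj m y = (n : ℂ) ^ (-m) • τ.proj m x) :
    ∃ hx : x ∈ τ.modular.domain, τ.modular ⟨x, hx⟩ = y := by
  obtain ⟨z, hz, hy⟩ := (LinearPMap.mem_graph_iff _).1 (τ.mem_modular_graph_iff.2 h)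
  dsimp only at hz hy
  subst hz
  exact ⟨z.2, hy⟩

theorem proj_mem_modular_domain (m : ℤ) (x : τ.H) : τ.proj m x ∈ τ.modular.domain := by
  refine (τ.exists_modular_eq (y := (n : ℂ) ^ (-m) • τ.proj m x) fun l => ?_).1
  rw [map_smul, proj_proj]
  split_ifs with h
  · rw [h]
  · simp

theorem modularCut_eq (N : ℕ) (x : τ.H) :
    τ.modularCut N x = ∑ m ∈ Finset.Icc (-(N : ℤ)) N, (n : ℂ) ^ (-m) • τ.proj m x := by
  obtain ⟨h, h'⟩ := τ.exists_modular_eq (x := ∑ m ∈ Finset.Icc (-(N : ℤ)) N, τ.proj m x)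
    (y := ∑ m ∈ Finset.Icc (-(N : ℤ)) N, (n : ℂ) ^ (-m) • τ.proj m x) fun l => by
      simp only [map_sum, Finset.smul_sum, map_smul, proj_proj]
      refine Finset.sum_congr rfl fun m _ => ?_
      split_ifs with hlm
      · rw [hlm]
      · simp
  unfold modularCut applyZero
  rw [dif_pos h, h']

/-! ### The automorphism `σ` -/

/-- The element chosen in `sigma` is unique: `Δ` is injective, and so is `vec` on `O_{nc}`. -/
theorem sigma_eq {a c : A} (hc : c ∈ O.alg)
    (h : ∀ m : ℤ, τ.proj m (τ.vec a) = (n : ℂ) ^ (-m) • τ.proj m (τ.vec c)) : τ.sigma a = c := by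
  have h1 : τ.sigma a ∈ O.alg ∧ (τ.vec (τ.sigma a), τ.vec a) ∈ τ.modular.graph :=
    Classical.epsilon_spec (p := fun c => c ∈ O.alg ∧ (τ.vec c, τ.vec a) ∈ τ.modular.graph)
      ⟨c, hc, τ.mem_modular_graph_iff.2 h⟩
  refine τ.vec_injOn h1.1 hc (τ.eq_of_proj fun m => ?_)
  have h2 := τ.mem_modular_graph_iff.1 h1.2 m
  rw [h m] at h2
  have hn : (n : ℂ) ≠ 0 := NeZero.ne _
  exact (smul_right_injective τ.H (zpow_ne_zero (-m) hn) h2).symm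

theorem sigma_homog {m : ℤ} {a : A} (ha : a ∈ O.homog m) : τ.sigma a = (n : ℂ) ^ m • a := by
  have hn : (n : ℂ) ≠ 0 := NeZero.ne _
  refine τ.sigma_eq (O.alg.smul_mem _ (O.homog_le_alg m ha)) fun l => ?_
  rw [map_smul, map_smul, τ.proj_vec l ha]
  split_ifs with h
  · rw [h, smul_smul, ← zpow_add₀ hn, neg_add_cancel, zpow_zero, one_smul]
  · simp

theorem sigma_spec {a : A} (ha : a ∈ O.alg) : τ.sigma a ∈ O.alg ∧
    ∀ m : ℤ, τ.proj m (τ.vec a) = (n : ℂ) ^ (-m) • τ.proj m (τ.vec (τ.sigma a)) := by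
  obtain ⟨c, hc, h⟩ : ∃ c ∈ O.alg, ∀ m : ℤ,
      τ.proj m (τ.vec a) = (n : ℂ) ^ (-m) • τ.proj m (τ.vec c) := by
    refine O.alg_induction (p := fun a => ∃ c ∈ O.alg, ∀ m : ℤ,
      τ.proj m (τ.vec a) = (n : ℂ) ^ (-m) • τ.proj m (τ.vec c)) (fun l a ha => ?_) ?_ ha
    · have hn : (n : ℂ) ≠ 0 := NeZero.ne _
      refine ⟨(n : ℂ) ^ l • a, O.alg.smul_mem _ (O.homog_le_alg l ha), fun m => ?_⟩
      rw [map_smul, map_smul, τ.proj_vec m ha]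
      split_ifs with h
      · rw [h, smul_smul, ← zpow_add₀ hn, neg_add_cancel, zpow_zero, one_smul]
      · simp
    · rintro a - b - ⟨c, hc, h⟩ ⟨d, hd, h'⟩
      exact ⟨c + d, add_mem hc hd, fun m => by simp only [map_add, smul_add, h, h']⟩
  rw [τ.sigma_eq hc h]
  exact ⟨hc, h⟩

theorem sigma_mem_alg {a : A} (ha : a ∈ O.alg) : τ.sigma a ∈ O.alg := (τ.sigma_spec ha).1

theorem sigma_add {a b : A} (ha : a ∈ O.alg) (hb : b ∈ O.alg) :
    τ.sigma (a + b) = τ.sigma a + τ.sigma b :=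
  τ.sigma_eq (add_mem (τ.sigma_mem_alg ha) (τ.sigma_mem_alg hb)) fun m => by
    simp only [map_add, smul_add, (τ.sigma_spec ha).2 m, (τ.sigma_spec hb).2 m]

theorem sigma_mul {a b : A} (ha : a ∈ O.alg) (hb : b ∈ O.alg) :
    τ.sigma (a * b) = τ.sigma a * τ.sigma b := by
  refine O.alg_induction (p := fun a => τ.sigma (a * b) = τ.sigma a * τ.sigma b)
    (fun m a ha => ?_) (fun a ha a' ha' h h' => ?_) ha
  · refine O.alg_induction (p := fun b => τ.sigma (a * b) = τ.sigma a * τ.sigma b)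
      (fun l b hb => ?_) (fun b hb b' hb' h h' => ?_) hb
    · have hn : (n : ℂ) ≠ 0 := NeZero.ne _
      rw [τ.sigma_homog ha, τ.sigma_homog hb, τ.sigma_homog (O.mul_mem_homog ha hb),
        smul_mul_smul_comm, zpow_add₀ hn]
    · have ha := O.homog_le_alg m ha
      rw [mul_add, τ.sigma_add (O.mul_mem_alg ha hb) (O.mul_mem_alg ha hb'), h, h',
        τ.sigma_add hb hb', mul_add]
  · rw [add_mul, τ.sigma_add (O.mul_mem_alg ha hb) (O.mul_mem_alg ha' hb), h, h',
      τ.sigma_add ha ha', add_mul]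

theorem sigma_one : τ.sigma 1 = 1 := by simpa using τ.sigma_homog O.one_mem_homog

theorem sigma_zero : τ.sigma 0 = 0 := by simpa using τ.sigma_homog (zero_mem (O.homog 0))

theorem sigma_sum {ι : Type*} (s : Finset ι) {f : ι → A} (hf : ∀ i, f i ∈ O.alg) :
    τ.sigma (∑ i ∈ s, f i) = ∑ i ∈ s, τ.sigma (f i) := by
  classical
  induction s using Finset.induction_on with
  | empty => simpa using τ.sigma_zero
  | insert i s hi ih =>
    rw [Finset.sum_insert hi, Finset.sum_insert hi, τ.sigma_add (hf i) (sum_mem fun j _ => hf j), ih]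

/-- A component of degree `j` fixed by `σ` is zero unless `n^{-j} = 1`, and `n ≥ 2` then forces `j =
0`. -/
theorem mem_fixed_of_sigma_eq (hn : 2 ≤ n) {a : A} (ha : a ∈ O.alg) (h : τ.sigma a = a) :
    a ∈ O.fixed := by
  obtain ⟨c, hc, hac⟩ := O.exists_decomp ha
  have h0 : ∀ j, j ≠ 0 → c j = 0 := fun j hj => by
    refine τ.eq_zero_of_vec_eq_zero_of_homog (hc j) ?_
    have h1 := (τ.sigma_spec ha).2 j
    rw [h, hac, τ.proj_vec_sum hc] at h1
    by_contra h2
    have h3 : (n : ℂ) ^ (-j) = 1 := smul_left_injective ℂ h2 (by simpa using h1.symm)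
    have h4 : (n : ℝ) ^ (-j) = 1 := Complex.ofReal_injective (by push_cast; exact h3)
    rw [zpow_eq_one_iff_right₀ (by positivity) (by norm_cast; omega)] at h4
    omega
  have h1 : a = c 0 := by
    rw [hac]
    exact Finset.sum_eq_single 0 (fun j _ hj => h0 j hj) fun h => Finsupp.notMem_support_iff.1 h
  rw [mem_fixed_iff, h1]
  exact O.homog_le_spectral 0 (hc 0)

/-- `Δ π(σ(a)) = π(a) Δ`. -/
theorem proj_rep_of_modular {a : A} (ha : a ∈ O.alg) {x y : τ.H}
    (h : ∀ m : ℤ, τ.proj m y = (n : ℂ) ^ (-m) • τ.proj m x) (m : ℤ) :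
    τ.proj m (τ.rep a y) = (n : ℂ) ^ (-m) • τ.proj m (τ.rep (τ.sigma a) x) := by
  refine O.alg_induction (p := fun a =>
    τ.proj m (τ.rep a y) = (n : ℂ) ^ (-m) • τ.proj m (τ.rep (τ.sigma a) x))
    (fun j a ha => ?_) (fun a ha b hb h h' => ?_) ha
  · have hn : (n : ℂ) ≠ 0 := NeZero.ne _
    have h1 : ∀ z, τ.proj m (τ.rep a z) = τ.rep a (τ.proj (m - j) z) := fun z => by
      rw [τ.rep_proj ha, add_sub_cancel]
    rw [τ.sigma_homog ha, rep_smul, smul_apply, map_smul, h1, h1, h, map_smul,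
      smul_smul, ← zpow_add₀ hn]
    congr 2
    ring
  · simp only [τ.sigma_add ha hb, rep_add, add_apply, map_add, smul_add, h, h']

end Modular

end CuntzAlgebra.FaithfulTrace

/-! ### Words indexing the levels of the weight. -/

namespace CuntzAlgebra

variable {n : ℕ} {A : Type u} [CStarAlgebra A] (O : CuntzAlgebra n A)

theorem card_words (r : ℕ) : (words n r).card = n ^ r := by simp [words]

/-- `S_μ` for `m ≥ 0` and `S_μ*` for `m < 0`; with `|μ| = |m|` this has degree `m`. -/
def signedWord (m : ℤ) (μ : List (Fin n)) : A := if 0 ≤ m then O.word μ else star (O.word μ)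

theorem signedWord_mem_homog {m : ℤ} {μ : List (Fin n)} (hμ : μ ∈ words n m.natAbs) :
    O.signedWord m μ ∈ O.homog m := by
  unfold signedWord
  split_ifs with h
  · convert O.word_mem_homog μ using 2
    rw [mem_words.1 hμ]; omega
  · convert O.star_word_mem_homog μ using 2
    rw [mem_words.1 hμ]; omega

theorem sum_Icc_neg {M : Type*} [AddCommMonoid M] (f : ℤ → M) (N : ℕ) :
    ∑ m ∈ Finset.Icc (-(N : ℤ)) N, f m = f 0 + ∑ r ∈ Finset.Icc 1 N, (f r + f (-r)) := by
  induction N with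
  | zero => simp
  | succ N ih =>
    have h : Finset.Icc (-((N + 1 : ℕ) : ℤ)) (N + 1 : ℕ) =
        insert ((N + 1 : ℕ) : ℤ) (insert (-((N + 1 : ℕ) : ℤ)) (Finset.Icc (-(N : ℤ)) N)) := by
      ext m
      simp only [Finset.mem_Icc, Finset.mem_insert]
      omega
    rw [h, Finset.sum_insert, Finset.sum_insert, ih, Finset.sum_Icc_succ_top (by omega)]
    · abel
    · simp only [Finset.mem_Icc]; omega
    · simp only [Finset.mem_Icc, Finset.mem_insert]; omega

end CuntzAlgebra

/-! ### The weight `τ_Δ` on conjugates of functions of `D`. -/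

namespace CuntzAlgebra.FaithfulTrace

variable {n : ℕ} {A : Type u} [CStarAlgebra A] [PartialOrder A] [StarOrderedRing A]
  {O : CuntzAlgebra n A} (τ : O.FaithfulTrace)

/-- The contribution of the `m`-th spectral subspace to `τ_Δ(T)`. -/
def level (m : ℤ) (T : τ.H → τ.H) : ℂ :=
  (if 0 ≤ m then (n : ℂ) ^ (-m) else 1) * ∑ μ ∈ words n m.natAbs,
    ⟪τ.vec (O.signedWord m μ), T (τ.vec (O.signedWord m μ))⟫_ℂ

theorem re_level (m : ℤ) (T : τ.H → τ.H) : (τ.level m T).re =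
    (if 0 ≤ m then (n : ℝ) ^ (-m) else 1) * ∑ μ ∈ words n m.natAbs,
      (⟪τ.vec (O.signedWord m μ), T (τ.vec (O.signedWord m μ))⟫_ℂ).re := by
  have h : (if 0 ≤ m then (n : ℂ) ^ (-m) else 1) =
      ((if 0 ≤ m then (n : ℝ) ^ (-m) else 1 : ℝ) : ℂ) := by
    split_ifs <;> push_cast <;> rfl
  rw [level, h, Complex.re_ofReal_mul, Complex.re_sum]

theorem re_level_nonneg (m : ℤ) {T : τ.H →L[ℂ] τ.H} (hT : T.IsPositive) :
    0 ≤ (τ.level m T).re := by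
  rw [re_level]
  refine mul_nonneg (by split_ifs <;> positivity) (Finset.sum_nonneg fun μ _ => ?_)
  exact (RCLike.nonneg_iff.1 (hT.inner_nonneg_right _)).1

theorem level_add (m : ℤ) (T T' : τ.H →L[ℂ] τ.H) :
    τ.level m ⇑(T + T') = τ.level m T + τ.level m T' := by
  simp only [level, add_apply, inner_add_right, Finset.sum_add_distrib, mul_add]

theorem state_sum_mul_star {c : ℤ →₀ A} (hc : ∀ j, c j ∈ O.homog j) :
    τ.state ((∑ j ∈ c.support, c j) * star (∑ j ∈ c.support, c j)) =
      ∑ j ∈ c.support, τ.state (c j * star (c j)) := by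
  rw [star_sum, Finset.sum_mul_sum, map_sum]
  refine Finset.sum_congr rfl fun i hi => ?_
  rw [map_sum]
  refine Finset.sum_eq_single i (fun j _ hj => ?_) fun h => (h hi).elim
  exact τ.state_of_mem_spectral (m := i + -j) (by omega)
    (O.homog_le_spectral _ (O.mul_mem_homog (hc i) (O.star_mem_homog (hc j))))

theorem state_mul_star_nonneg (a : A) : 0 ≤ (τ.state (a * star a)).re := by
  have := τ.state.map_nonneg (mul_star_self_nonneg a)
  exact (RCLike.nonneg_iff.1 this).1

variable {τ} in
theorem IsDiag.isPositive_conj {h : ℤ → ℝ} {B : τ.H →L[ℂ] τ.H} (hB : τ.IsDiag h B)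
    (hh : ∀ m, 0 ≤ h m) (a : A) : (τ.rep a * B * τ.rep (star a)).IsPositive := by
  rw [← adjoint_rep]
  exact (hB.isPositive hh).conj_adjoint (τ.rep a)

section

variable [NeZero n]

theorem inner_vec_modularCut {l : ℤ} {a : A} (ha : a ∈ O.homog l) (N : ℕ) (x : τ.H) :
    ⟪τ.vec a, τ.modularCut N x⟫_ℂ =
      if l ∈ Finset.Icc (-(N : ℤ)) N then (n : ℂ) ^ (-l) * ⟪τ.vec a, x⟫_ℂ else 0 := by
  have h : ∀ m, ⟪τ.vec a, (n : ℂ) ^ (-m) • τ.proj m x⟫_ℂ =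
      if m = l then (n : ℂ) ^ (-l) * ⟪τ.vec a, x⟫_ℂ else 0 := fun m => by
    rw [inner_smul_right, ← inner_proj_left, τ.proj_vec m ha]
    split_ifs with h
    · rw [h]
    · simp
  rw [modularCut_eq, inner_sum, Finset.sum_congr rfl fun m _ => h m, Finset.sum_ite_eq']

/-- Words are grouped by length, and the cutoff leaves only lengths at most `N`. On `S_μ` the
operator `Δ` contributes `n^{-|μ|}`; on `S_μ*` it contributes `n^{|μ|}`, which cancels the
coefficient in `τ̃`. This is the source of the two cases in `level`. -/
theorem tildeTau_modularCut (N : ℕ) (T : τ.H → τ.H) :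
    τ.tildeTau (fun x => τ.modularCut N (T x)) = ∑ m ∈ Finset.Icc (-(N : ℤ)) N, τ.level m T := by
  have hn : (n : ℂ) ≠ 0 := NeZero.ne _
  rw [sum_Icc_neg]
  unfold tildeTau
  congr 1
  · have : words n 0 = {[]} := by ext; simp [mem_words]
    rw [τ.inner_vec_modularCut O.one_mem_homog]
    simp [level, this, signedWord]
  · let f : List (Fin n) → ℂ := fun μ =>
      ⟪τ.vec (O.word μ), τ.modularCut N (T (τ.vec (O.word μ)))⟫_ℂ + (1 / (n : ℂ) ^ μ.length) *
        ⟪τ.vec (star (O.word μ)), τ.modularCut N (T (τ.vec (star (O.word μ))))⟫_ℂ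
    have hf : ∀ μ, f μ = if μ.length ≤ N then (n : ℂ) ^ (-(μ.length : ℤ)) *
        ⟪τ.vec (O.word μ), T (τ.vec (O.word μ))⟫_ℂ +
        ⟪τ.vec (star (O.word μ)), T (τ.vec (star (O.word μ)))⟫_ℂ else 0 := fun μ => by
      have h1 : (μ.length : ℤ) ∈ Finset.Icc (-(N : ℤ)) N ↔ μ.length ≤ N := by
        simp only [Finset.mem_Icc]; omega
      have h2 : -(μ.length : ℤ) ∈ Finset.Icc (-(N : ℤ)) N ↔ μ.length ≤ N := by
        simp only [Finset.mem_Icc]; omega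
      simp only [f, τ.inner_vec_modularCut (O.word_mem_homog μ),
        τ.inner_vec_modularCut (O.star_word_mem_homog μ), h1, h2]
      split_ifs
      · rw [neg_neg, zpow_natCast, ← mul_assoc, one_div, inv_mul_cancel₀ (pow_ne_zero _ hn), one_mul]
      · simp
    change ∑' μ : ({μ : List (Fin n) | μ ≠ []} : Set _), f μ = _
    rw [tsum_subtype, tsum_eq_sum (s := (Finset.Icc 1 N).biUnion (words n)), Finset.sum_biUnion]
    · refine Finset.sum_congr rfl fun r hr => ?_
      rw [Finset.mem_Icc] at hr
      have h0 : ¬ 0 ≤ -(r : ℤ) := by omega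
      simp only [level, h0, signedWord, Int.natAbs_neg, Int.natAbs_natCast, if_false, one_mul,
        Int.natCast_nonneg, if_true, Finset.mul_sum]
      rw [← Finset.sum_add_distrib]
      refine Finset.sum_congr rfl fun μ hμ => ?_
      rw [mem_words] at hμ
      rw [Set.indicator_of_mem (by rintro rfl; simp at hμ; omega), hf, if_pos (by omega), hμ]
    · intro r _ s _ hrs
      rw [Function.onFun, Finset.disjoint_left]
      intro μ h h'
      rw [mem_words] at h h'
      omega
    · intro μ hμ
      by_cases h : μ = []
      · simp [h]
      · rw [Set.indicator_of_mem h, hf, if_neg]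
        intro hN
        have := List.length_pos_iff.2 h
        exact hμ (Finset.mem_biUnion.2 ⟨μ.length, by simp; omega, mem_words.2 rfl⟩)

/-- The levels of a positive operator are nonnegative and the symmetric intervals exhaust ℤ, so the
supremum is an unconditional sum. -/
theorem weight_eq_tsum {T : τ.H →L[ℂ] τ.H} (hT : T.IsPositive) :
    τ.weight T = ∑' m, ENNReal.ofReal (τ.level m T).re := by
  rw [ENNReal.tsum_eq_iSup_sum' fun N : ℕ => Finset.Icc (-(N : ℤ)) N]
  · unfold weight
    refine iSup_congr fun N => ?_
    rw [tildeTau_modularCut, Complex.re_sum,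
      ENNReal.ofReal_sum_of_nonneg fun m _ => τ.re_level_nonneg m hT]
  · intro t
    refine ⟨t.sup Int.natAbs, fun m hm => ?_⟩
    have := Finset.le_sup (f := Int.natAbs) hm
    rw [Finset.mem_Icc]
    omega

theorem weight_add {T T' : τ.H →L[ℂ] τ.H} (hT : T.IsPositive) (hT' : T'.IsPositive) :
    τ.weight (T + T') = τ.weight T + τ.weight T' := by
  rw [τ.weight_eq_tsum hT, τ.weight_eq_tsum hT', τ.weight_eq_tsum (hT.add hT'), ← ENNReal.tsum_add]
  refine tsum_congr fun m => ?_
  rw [level_add, Complex.add_re,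
    ENNReal.ofReal_add (τ.re_level_nonneg m hT) (τ.re_level_nonneg m hT')]

theorem weight_zero : τ.weight 0 = 0 := by
  rw [τ.weight_eq_tsum ContinuousLinearMap.isPositive_zero]
  simp [level]

theorem weight_sum {ι : Type*} (s : Finset ι) {f : ι → τ.H →L[ℂ] τ.H}
    (hf : ∀ i, (f i).IsPositive) : τ.weight (∑ i ∈ s, f i) = ∑ i ∈ s, τ.weight (f i) := by
  classical
  induction s using Finset.induction_on with
  | empty => simpa using τ.weight_zero
  | insert i s hi ih =>
    rw [Finset.sum_insert hi, Finset.sum_insert hi, τ.weight_add (hf i) _, ih]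
    exact ContinuousLinearMap.isPositive_sum s fun i _ => hf i

/-- On the fixed point algebra, every spectral subspace contributes the trace. -/
theorem sum_state_signedWord (m : ℤ) {b : A} (hb : b ∈ O.alg) :
    (if 0 ≤ m then (n : ℂ) ^ (-m) else 1) * ∑ μ ∈ words n m.natAbs,
      τ.state (star (O.signedWord m μ) * b * O.signedWord m μ) = τ.state b := by
  have hn : (n : ℂ) ≠ 0 := NeZero.ne _
  obtain ⟨r, hr⟩ : ∃ r, r = m.natAbs := ⟨_, rfl⟩
  rw [← hr]
  by_cases hm : 0 ≤ m
  · obtain rfl : m = r := by omega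
    simp only [signedWord, hm, if_true]
    have h : ∀ μ ∈ words n r, τ.state (star (O.word μ) * b * O.word μ) =
        (n : ℂ) ^ (r : ℤ) * τ.state (b * (O.word μ * star (O.word μ))) := fun μ hμ => by
      rw [mul_assoc, τ.state_star_word_mul μ (O.mul_mem_alg hb (O.word_mem_alg μ)), mem_words.1 hμ,
        mul_assoc]
    -- For `m ≥ 0`, the KMS relation gathers the words into `∑ S_μ S_μ* = 1`, and its factor `n^r`
    -- cancels the prefactor.
    rw [Finset.sum_congr rfl h, ← Finset.mul_sum, ← map_sum, ← Finset.mul_sum, O.sum_word_mul_star,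
      mul_one, ← mul_assoc, ← zpow_add₀ hn, neg_add_cancel, zpow_zero, one_mul]
  · simp only [signedWord, hm, if_false, one_mul, star_star]
    have h : ∀ μ ∈ words n r, τ.state (O.word μ * b * star (O.word μ)) =
        (n : ℂ) ^ (-(r : ℤ)) * τ.state b := fun μ hμ => by
      rw [mul_assoc, τ.state_word_mul μ (O.mul_mem_alg hb (O.star_mem_alg (O.word_mem_alg μ))),
        mem_words.1 hμ, mul_assoc, O.star_word_mul_word, mul_one]
    -- For `m < 0`, each of the `n^r` words contributes `n^{-r} ψ(b)`, since `S_μ* S_μ = 1`.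
    rw [Finset.sum_congr rfl h, Finset.sum_const, card_words, nsmul_eq_mul, ← mul_assoc]
    push_cast
    rw [← zpow_natCast, ← zpow_add₀ hn, add_neg_cancel, zpow_zero, one_mul]

variable {τ}

/-- `τ_Δ(π(a) h(D) π(a)*) = ∑ h(l) · ψ(a a*)`. -/
theorem IsDiag.weight_conj {h : ℤ → ℝ} {B : τ.H →L[ℂ] τ.H} (hB : τ.IsDiag h B)
    (hh : ∀ m, 0 ≤ h m) {a : A} (ha : a ∈ O.alg) :
    τ.weight (τ.rep a * B * τ.rep (star a)) =
      (∑' l, ENNReal.ofReal (h l)) * ENNReal.ofReal (τ.state (a * star a)).re := by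
  obtain ⟨c, hc, hac⟩ := O.exists_decomp ha
  let q : ℤ → ℝ := fun j => (τ.state (c j * star (c j))).re
  have hq : ∀ j, 0 ≤ q j := fun j => τ.state_mul_star_nonneg (c j)
  -- For `e` of degree `m`, only the adjoint of the component of `a` of degree `m - l` takes `e` to
  -- degree `l`.
  have hproj : ∀ (m l : ℤ) {e : A}, e ∈ O.homog m →
      τ.proj l (τ.vec (star a * e)) = τ.vec (star (c (m - l)) * e) := by
    intro m l e he
    rw [hac, star_sum, Finset.sum_mul, map_sum, map_sum, Finset.sum_congr rfl fun j _ =>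
      τ.proj_vec l (O.mul_mem_homog (O.star_mem_homog (hc j)) he), Finset.sum_eq_single (m - l)]
    · rw [if_pos (by ring)]
    · intro j _ hj
      rw [if_neg (by omega)]
    · intro hj
      simp [Finsupp.notMem_support_iff.1 hj]
  -- Level `m` is the convolution of `h` with `q`: spectral component `l` contributes `h(l)` times
  -- the weighted sum over words, which is `ψ(c c*)` for `c = c_{m-l}`.
  have hlevel : ∀ m, HasSum (fun l => h l * q (m - l))
      (τ.level m ⇑(τ.rep a * B * τ.rep (star a))).re := by
    intro m
    rw [re_level]
    have h1 : ∀ μ ∈ words n m.natAbs, HasSum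
        (fun l => h l * (τ.state (star (O.signedWord m μ) * (c (m - l) * star (c (m - l))) *
          O.signedWord m μ)).re)
        (⟪τ.vec (O.signedWord m μ),
          (τ.rep a * B * τ.rep (star a)) (τ.vec (O.signedWord m μ))⟫_ℂ).re := by
      intro μ hμ
      have h2 := hB.hasSum_inner (τ.rep (star a) (τ.vec (O.signedWord m μ)))
      rw [← adjoint_rep, ContinuousLinearMap.adjoint_inner_left, adjoint_rep] at h2
      have h3 : ∀ l, h l * ‖τ.proj l (τ.rep (star a) (τ.vec (O.signedWord m μ)))‖ ^ 2 = h l *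
          (τ.state (star (O.signedWord m μ) * (c (m - l) * star (c (m - l))) *
            O.signedWord m μ)).re := fun l => ?_
      · rw [← funext h3]
        exact h2
      congr 1
      rw [rep_vec, hproj m l (O.signedWord_mem_homog hμ)]
      have h4 : star (O.signedWord m μ) * (c (m - l) * star (c (m - l))) * O.signedWord m μ =
          star (star (c (m - l)) * O.signedWord m μ) * (star (c (m - l)) * O.signedWord m μ) := by
        simp only [star_mul, star_star, mul_assoc]
      rw [h4, ← inner_vec, inner_self_eq_norm_sq_to_K]
      norm_cast
    have h2 := (hasSum_sum h1).mul_left (if 0 ≤ m then (n : ℝ) ^ (-m) else 1)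
    have h3 : ∀ l, (if 0 ≤ m then (n : ℝ) ^ (-m) else 1) * ∑ μ ∈ words n m.natAbs, h l *
        (τ.state (star (O.signedWord m μ) * (c (m - l) * star (c (m - l))) *
          O.signedWord m μ)).re = h l * q (m - l) := fun l => ?_
    · rw [funext h3] at h2
      exact h2
    have h4 := congrArg Complex.re (τ.sum_state_signedWord m (O.mul_mem_alg
      (O.homog_le_alg _ (hc (m - l))) (O.star_mem_alg (O.homog_le_alg _ (hc (m - l))))))
    have h5 : (if 0 ≤ m then (n : ℂ) ^ (-m) else 1) =
        ((if 0 ≤ m then (n : ℝ) ^ (-m) else 1 : ℝ) : ℂ) := by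
      split_ifs <;> push_cast <;> rfl
    rw [h5, Complex.re_ofReal_mul, Complex.re_sum] at h4
    rw [← Finset.mul_sum, mul_left_comm, h4]
  rw [τ.weight_eq_tsum (hB.isPositive_conj hh a)]
  calc _ = ∑' m, ∑' l, ENNReal.ofReal (h l) * ENNReal.ofReal (q (m - l)) := by
        refine tsum_congr fun m => ?_
        rw [← (hlevel m).tsum_eq, ENNReal.ofReal_tsum_of_nonneg
          (fun l => mul_nonneg (hh l) (hq _)) (hlevel m).summable]
        exact tsum_congr fun l => ENNReal.ofReal_mul (hh l)
    _ = ∑' l, ENNReal.ofReal (h l) * ∑' j, ENNReal.ofReal (q j) := by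
        rw [ENNReal.tsum_comm]
        refine tsum_congr fun l => ?_
        rw [ENNReal.tsum_mul_left]
        congr 1
        -- For fixed `l`, the difference `j = m - l` runs over all of ℤ as `m` does.
        exact (Equiv.subRight l).tsum_eq fun j => ENNReal.ofReal (q j)
    _ = _ := by
        rw [ENNReal.tsum_mul_right]
        congr 1
        rw [hac, τ.state_sum_mul_star hc, Complex.re_sum,
          ENNReal.ofReal_sum_of_nonneg fun j _ => hq j]
        refine tsum_eq_sum fun j hj => ?_
        simp [q, Finsupp.notMem_support_iff.1 hj]

end

end CuntzAlgebra.FaithfulTrace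

section Operators

variable {E : Type*} [NormedAddCommGroup E] [InnerProductSpace ℂ E] [CompleteSpace E]

/-! ### The linear extension of a weight -/

/-- Comparing self-adjoint and skew-adjoint parts of two decompositions gives `P₀ + Q₁ = Q₀ + P₁`
and `P₂ + Q₃ = Q₂ + P₃`. These are sums of positive operators, where additivity of `φ` suffices. -/
theorem IsWeightValue.unique {N : Set (E →L[ℂ] E)} {φ : (E →L[ℂ] E) → ℝ≥0∞}
    (hφ : ∀ P Q : E →L[ℂ] E, P.IsPositive → Q.IsPositive → φ (P + Q) = φ P + φ Q)
    {T : E →L[ℂ] E} {z w : ℂ} (hz : IsWeightValue N φ T z) (hw : IsWeightValue N φ T w) :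
    z = w := by
  obtain ⟨P, hP, hPT, rfl⟩ := hz
  obtain ⟨Q, hQ, hQT, rfl⟩ := hw
  have hsP : ∀ j, star (P j) = P j := fun j => (hP j).2.1.isSelfAdjoint
  have hsQ : ∀ j, star (Q j) = Q j := fun j => (hQ j).2.1.isSelfAdjoint
  have hI : star Complex.I = -Complex.I := Complex.conj_I
  have h1 : P 0 - P 1 + Complex.I • (P 2 - P 3) = Q 0 - Q 1 + Complex.I • (Q 2 - Q 3) :=
    hPT.symm.trans hQT
  have h2 := congrArg star h1
  simp only [star_add, star_sub, star_smul, hsP, hsQ, hI] at h2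
  have h3 : P 0 + Q 1 = Q 0 + P 1 := by
    have h : (2 : ℂ) • (P 0 + Q 1) = (2 : ℂ) • (Q 0 + P 1) := by
      calc (2 : ℂ) • (P 0 + Q 1) = (P 0 - P 1 + Complex.I • (P 2 - P 3)) +
            (P 0 - P 1 + -Complex.I • (P 2 - P 3)) + (2 : ℂ) • (P 1 + Q 1) := by module
        _ = (Q 0 - Q 1 + Complex.I • (Q 2 - Q 3)) +
            (Q 0 - Q 1 + -Complex.I • (Q 2 - Q 3)) + (2 : ℂ) • (P 1 + Q 1) := by rw [h1, h2]
        _ = _ := by module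
    exact smul_right_injective _ two_ne_zero h
  have h4 : P 2 + Q 3 = Q 2 + P 3 := by
    have h : (2 * Complex.I) • (P 2 + Q 3) = (2 * Complex.I) • (Q 2 + P 3) := by
      calc (2 * Complex.I) • (P 2 + Q 3) = (P 0 - P 1 + Complex.I • (P 2 - P 3)) -
            (P 0 - P 1 + -Complex.I • (P 2 - P 3)) + (2 * Complex.I) • (P 3 + Q 3) := by module
        _ = (Q 0 - Q 1 + Complex.I • (Q 2 - Q 3)) -
            (Q 0 - Q 1 + -Complex.I • (Q 2 - Q 3)) + (2 * Complex.I) • (P 3 + Q 3) := by rw [h1, h2]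
        _ = _ := by module
    exact smul_right_injective _ (mul_ne_zero two_ne_zero Complex.I_ne_zero) h
  have key : ∀ i j i' j', P i + Q j = Q i' + P j' →
      (φ (P i)).toReal + (φ (Q j)).toReal = (φ (Q i')).toReal + (φ (P j')).toReal := by
    intro i j i' j' h
    have : (φ (P i + Q j)).toReal = (φ (Q i' + P j')).toReal := by rw [h]
    rwa [hφ _ _ (hP i).2.1 (hQ j).2.1, hφ _ _ (hQ i').2.1 (hP j').2.1,
      ENNReal.toReal_add (hP i).2.2.ne (hQ j).2.2.ne,
      ENNReal.toReal_add (hQ i').2.2.ne (hP j').2.2.ne] at this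
  have h5 : ((φ (P 0)).toReal : ℂ) + (φ (Q 1)).toReal = (φ (Q 0)).toReal + (φ (P 1)).toReal := by
    exact_mod_cast key _ _ _ _ h3
  have h6 : ((φ (P 2)).toReal : ℂ) + (φ (Q 3)).toReal = (φ (Q 2)).toReal + (φ (P 3)).toReal := by
    exact_mod_cast key _ _ _ _ h4
  linear_combination h5 + Complex.I * h6

theorem weightValue_eq {N : Set (E →L[ℂ] E)} {φ : (E →L[ℂ] E) → ℝ≥0∞}
    (hφ : ∀ P Q : E →L[ℂ] E, P.IsPositive → Q.IsPositive → φ (P + Q) = φ P + φ Q)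
    {T : E →L[ℂ] E} {z : ℂ} (hz : IsWeightValue N φ T z) : weightValue N φ T = z :=
  IsWeightValue.unique hφ (Classical.epsilon_spec (p := IsWeightValue N φ T) ⟨z, hz⟩) hz

omit [CompleteSpace E] in
theorem isWeightValue_sub {N : Set (E →L[ℂ] E)} {φ : (E →L[ℂ] E) → ℝ≥0∞} (h0 : 0 ∈ N)
    (hφ0 : φ 0 = 0) {P Q : E →L[ℂ] E} (hP : P ∈ N) (hP' : P.IsPositive) (hPφ : φ P < ∞) (hQ : Q ∈ N)
    (hQ' : Q.IsPositive) (hQφ : φ Q < ∞) :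
    IsWeightValue N φ (P - Q) ((φ P).toReal - (φ Q).toReal) := by
  refine ⟨![P, Q, 0, 0], fun j => ?_, ?_, ?_⟩
  · fin_cases j
    · exact ⟨hP, hP', hPφ⟩
    · exact ⟨hQ, hQ', hQφ⟩
    · exact ⟨h0, ContinuousLinearMap.isPositive_zero, by simp [hφ0]⟩
    · exact ⟨h0, ContinuousLinearMap.isPositive_zero, by simp [hφ0]⟩
  · simp
  · simp [hφ0]

/-! ### Functional calculus and kernels -/

-- Two bounded candidates agree on the eigenvectors, whose span is dense.
omit [CompleteSpace E] in
theorem IsFunctionOf.functionOf_eq {T : E →ₗ.[ℂ] E} {h : ℝ → ℝ} {B : E →L[ℂ] E}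
    (hB : IsFunctionOf T h B) : functionOf T h = B := by
  have hF : IsFunctionOf T h (functionOf T h) :=
    Classical.epsilon_spec (p := IsFunctionOf T h) ⟨B, hB⟩
  refine ContinuousLinearMap.ext_on
    (s := {x : E | ∃ (l : ℝ) (hx : x ∈ T.domain), T ⟨x, hx⟩ = (l : ℂ) • x}) ?_ ?_
  · exact (Submodule.dense_iff_topologicalClosure_eq_top).2 hB.1
  · rintro x ⟨l, hx, hl⟩
    rw [hF.2 l x hx hl, hB.2 l x hx hl]

/-- `P` is the orthogonal projection onto the kernel of `T`. -/
structure IsKerProj (T : E →ₗ.[ℂ] E) (P : E →L[ℂ] E) : Prop where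
  adjoint_eq : ContinuousLinearMap.adjoint P = P
  idem : ∀ x, P (P x) = P x
  apply_eq_iff : ∀ x, P x = x ↔ ∃ hx : x ∈ T.domain, T ⟨x, hx⟩ = 0

theorem IsKerProj.kerProj_eq {T : E →ₗ.[ℂ] E} {P : E →L[ℂ] E} (hP : IsKerProj T P) :
    kerProj T = P := by
  have hmem : ∀ x, x ∈ (LinearMap.ker T.toFun).map T.domain.subtype ↔ P x = x := fun x => by
    rw [hP.apply_eq_iff, Submodule.mem_map]
    constructor
    · rintro ⟨y, hy, rfl⟩; exact ⟨y.2, hy⟩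
    · rintro ⟨hx, h⟩; exact ⟨⟨x, hx⟩, h, rfl⟩
  ext x
  unfold kerProj
  refine Submodule.eq_starProjection_of_mem_of_inner_eq_zero
    (Submodule.le_topologicalClosure _ ((hmem _).2 (hP.idem x))) ?_
  intro w hw
  have hcl : IsClosed {w | ⟪x - P x, w⟫_ℂ = 0} := isClosed_eq (by fun_prop) continuous_const
  refine closure_minimal (fun w hw => ?_) hcl hw
  change ⟪x - P x, w⟫_ℂ = 0
  rw [← (hmem w).1 hw, ← ContinuousLinearMap.adjoint_inner_left, hP.adjoint_eq, map_sub, hP.idem,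
    sub_self, inner_zero_left]

section Conj

variable {U : E →L[ℂ] E} (h1 : ContinuousLinearMap.adjoint U * U = 1)
  (h2 : U * ContinuousLinearMap.adjoint U = 1)

include h1 h2

/-- Eigenvectors of `U T U*` are the `U`-images of those of `T`; kernels and functional calculus are
transported through this. -/
theorem conjBy_apply_eq_iff (T : E →ₗ.[ℂ] E) (c : ℂ) (x : E) :
    (∃ hx : x ∈ (conjBy U T).domain, conjBy U T ⟨x, hx⟩ = c • x) ↔
      ∃ hx : ContinuousLinearMap.adjoint U x ∈ T.domain,
        T ⟨ContinuousLinearMap.adjoint U x, hx⟩ = c • ContinuousLinearMap.adjoint U x := by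
  have h1' : ∀ x, ContinuousLinearMap.adjoint U (U x) = x := fun x => DFunLike.congr_fun h1 x
  have h2' : ∀ x, U (ContinuousLinearMap.adjoint U x) = x := fun x => DFunLike.congr_fun h2 x
  constructor
  · rintro ⟨hx, h⟩
    refine ⟨hx, ?_⟩
    have := congrArg (ContinuousLinearMap.adjoint U) h
    rw [map_smul] at this
    rw [← this]
    exact (h1' _).symm
  · rintro ⟨hx, h⟩
    refine ⟨hx, ?_⟩
    change U (T ⟨ContinuousLinearMap.adjoint U x, hx⟩) = c • x
    rw [h, map_smul, h2']

theorem IsKerProj.conjBy {T : E →ₗ.[ℂ] E} {P : E →L[ℂ] E} (hP : IsKerProj T P) :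
    IsKerProj (conjBy U T) (U * P * ContinuousLinearMap.adjoint U) := by
  have h1' : ∀ x, ContinuousLinearMap.adjoint U (U x) = x := fun x => DFunLike.congr_fun h1 x
  have h2' : ∀ x, U (ContinuousLinearMap.adjoint U x) = x := fun x => DFunLike.congr_fun h2 x
  refine ⟨?_, fun x => ?_, fun x => ?_⟩
  · have hP' : star P = P := hP.adjoint_eq
    rw [← ContinuousLinearMap.star_eq_adjoint, ← ContinuousLinearMap.star_eq_adjoint, star_mul,
      star_mul, star_star, hP', mul_assoc]
  · change U (P (ContinuousLinearMap.adjoint U (U (P (ContinuousLinearMap.adjoint U x))))) = _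
    rw [h1', hP.idem]
    rfl
  · have h := conjBy_apply_eq_iff h1 h2 T 0 x
    simp only [zero_smul] at h
    rw [h, ← hP.apply_eq_iff]
    change U (P (ContinuousLinearMap.adjoint U x)) = x ↔ _
    constructor
    · intro hx
      rw [← h1' (P _), hx]
    · intro hx
      rw [hx, h2']

theorem IsFunctionOf.conjBy {T : E →ₗ.[ℂ] E} {h : ℝ → ℝ} {B : E →L[ℂ] E}
    (hB : IsFunctionOf T h B) :
    IsFunctionOf (conjBy U T) h (U * B * ContinuousLinearMap.adjoint U) := by
  have h1' : ∀ x, ContinuousLinearMap.adjoint U (U x) = x := fun x => DFunLike.congr_fun h1 x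
  have h2' : ∀ x, U (ContinuousLinearMap.adjoint U x) = x := fun x => DFunLike.congr_fun h2 x
  constructor
  · rw [← Submodule.dense_iff_topologicalClosure_eq_top]
    have hU : Function.Surjective U := fun x => ⟨_, h2' x⟩
    have hd := hU.denseRange.dense_image U.continuous
      (Submodule.dense_iff_topologicalClosure_eq_top.2 hB.1)
    refine hd.mono ?_
    rintro _ ⟨x, hx, rfl⟩
    have hmap := Submodule.mem_map_of_mem (f := (U : E →ₗ[ℂ] E)) hx
    rw [Submodule.map_span] at hmap
    refine Submodule.span_mono ?_ hmap
    rintro _ ⟨y, ⟨l, hy⟩, rfl⟩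
    refine ⟨l, (conjBy_apply_eq_iff h1 h2 T l _).2 ?_⟩
    change ∃ hx : ContinuousLinearMap.adjoint U (U y) ∈ T.domain,
      T ⟨ContinuousLinearMap.adjoint U (U y), hx⟩ = (l : ℂ) • ContinuousLinearMap.adjoint U (U y)
    simpa only [h1'] using hy
  · intro l x hx hl
    obtain ⟨hx', hl'⟩ := (conjBy_apply_eq_iff h1 h2 T l x).1 ⟨hx, hl⟩
    change U (B (ContinuousLinearMap.adjoint U x)) = _
    rw [hB.2 l _ hx' hl', map_smul, h2']

end Conj

-- Injectivity of `P` determines `R` on `dom P`, and density with continuity determines it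
-- everywhere.
omit [CompleteSpace E] in
theorem IsSpatial.unique {P : E →ₗ.[ℂ] E} (hd : Dense (P.domain : Set E))
    (hinj : ∀ x : P.domain, P x = 0 → x = 0) {T R R' : E →L[ℂ] E} (hR : IsSpatial P T R)
    (hR' : IsSpatial P T R') : R = R' := by
  refine ContinuousLinearMap.coeFn_injective (Continuous.ext_on hd R.continuous R'.continuous ?_)
  intro x hx
  obtain ⟨h, e⟩ := hR x hx
  obtain ⟨h', e'⟩ := hR' x hx
  have h0 := hinj (⟨R x, h⟩ - ⟨R' x, h'⟩) (by rw [P.map_sub, e, e', sub_self])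
  exact congrArg Subtype.val (sub_eq_zero.1 h0)

omit [CompleteSpace E] in
theorem IsSpatial.spatial_eq {P : E →ₗ.[ℂ] E} (hd : Dense (P.domain : Set E))
    (hinj : ∀ x : P.domain, P x = 0 → x = 0) {T R : E →L[ℂ] E} (hR : IsSpatial P T R) :
    spatial P T = R :=
  IsSpatial.unique hd hinj (Classical.epsilon_spec (p := IsSpatial P T) ⟨R, hR⟩) hR

end Operators

/-! ### Amplifications -/

section Amplification

variable {E : Type*} [NormedAddCommGroup E] [InnerProductSpace ℂ E] {k : ℕ}

theorem opMatrix_apply (m : Matrix (Fin k) (Fin k) (E →L[ℂ] E)) (x : Amp E k) (i : Fin k) :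
    opMatrix m x i = ∑ j, m i j (x j) := by
  simp [opMatrix]

theorem entry_apply (T : Amp E k →L[ℂ] Amp E k) (i j : Fin k) (x : E) :
    entry T i j x = T (WithLp.toLp 2 (Pi.single j x)) i := rfl

theorem entry_opMatrix (m : Matrix (Fin k) (Fin k) (E →L[ℂ] E)) (i j : Fin k) :
    entry (opMatrix m) i j = m i j := by
  ext x
  rw [entry_apply, opMatrix_apply, Finset.sum_eq_single j]
  · simp
  · intro l _ hl
    simp [Pi.single_eq_of_ne hl]
  · simp

theorem entry_add (T T' : Amp E k →L[ℂ] Amp E k) (i j : Fin k) :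
    entry (T + T') i j = entry T i j + entry T' i j := rfl

theorem entry_zero (i j : Fin k) : entry (0 : Amp E k →L[ℂ] Amp E k) i j = 0 := rfl

theorem opMatrix_mul (a b : Matrix (Fin k) (Fin k) (E →L[ℂ] E)) :
    opMatrix (a * b) = opMatrix a * opMatrix b := by
  ext x i
  change opMatrix (a * b) x i = opMatrix a (opMatrix b x) i
  simp only [opMatrix_apply, Matrix.mul_apply, sum_apply, map_sum]
  rw [Finset.sum_comm]
  rfl

theorem opMatrix_one : opMatrix (1 : Matrix (Fin k) (Fin k) (E →L[ℂ] E)) = 1 := by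
  ext x i
  rw [opMatrix_apply, Finset.sum_eq_single i]
  · simp
  · intro j _ hj
    simp [Matrix.one_apply_ne hj.symm]
  · simp

theorem opMatrix_add (a b : Matrix (Fin k) (Fin k) (E →L[ℂ] E)) :
    opMatrix (a + b) = opMatrix a + opMatrix b := by
  ext x i
  change opMatrix (a + b) x i = opMatrix a x i + opMatrix b x i
  simp only [opMatrix_apply, Matrix.add_apply, add_apply, Finset.sum_add_distrib]

theorem opMatrix_smul (c : ℂ) (a : Matrix (Fin k) (Fin k) (E →L[ℂ] E)) :
    opMatrix (c • a) = c • opMatrix a := by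
  ext x i
  change opMatrix (c • a) x i = c • opMatrix a x i
  simp only [opMatrix_apply, Matrix.smul_apply, smul_apply, Finset.smul_sum]

/-- `T ⊗ 1_k` for a bounded operator `T`. -/
def scalarOp (k : ℕ) (B : E →L[ℂ] E) : Amp E k →L[ℂ] Amp E k :=
  opMatrix (Matrix.diagonal fun _ => B)

theorem scalarOp_apply (B : E →L[ℂ] E) (x : Amp E k) (i : Fin k) :
    scalarOp k B x i = B (x i) := by
  rw [scalarOp, opMatrix_apply, Finset.sum_eq_single i]
  · simp
  · intro j _ hj
    simp [Matrix.diagonal_apply_ne' _ hj]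
  · simp

theorem scalarOp_sub (B B' : E →L[ℂ] E) : scalarOp k (B - B') = scalarOp k B - scalarOp k B' := by
  ext x i
  change scalarOp k (B - B') x i = scalarOp k B x i - scalarOp k B' x i
  simp only [scalarOp_apply, sub_apply]

omit [InnerProductSpace ℂ E] in
theorem Amp.sum_single (x : Amp E k) : ∑ i, WithLp.toLp 2 (Pi.single i (x i)) = x := by
  ext j
  simp [Finset.sum_apply, Finset.sum_pi_single]

theorem dense_ampl_domain {T : E →ₗ.[ℂ] E} (hT : Dense (T.domain : Set E)) :
    Dense ((ampl T k).domain : Set (Amp E k)) := by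
  have h1 : Dense (Set.univ.pi fun _ : Fin k => (T.domain : Set E)) :=
    dense_pi _ fun _ _ => hT
  have h2 := h1.preimage (PiLp.homeomorph 2 (fun _ : Fin k => E)).isOpenMap
  refine h2.mono fun x hx i => ?_
  exact hx i (Set.mem_univ i)

variable [CompleteSpace E]

theorem adjoint_opMatrix (m : Matrix (Fin k) (Fin k) (E →L[ℂ] E)) :
    ContinuousLinearMap.adjoint (opMatrix m) = opMatrix (m.conjTranspose) := by
  symm
  rw [ContinuousLinearMap.eq_adjoint_iff]
  intro x y
  simp only [PiLp.inner_apply, opMatrix_apply, sum_inner, inner_sum, Matrix.conjTranspose_apply,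
    ContinuousLinearMap.star_eq_adjoint, ContinuousLinearMap.adjoint_inner_left]
  exact Finset.sum_comm

theorem isPositive_scalarOp {B : E →L[ℂ] E} (hB : B.IsPositive) : (scalarOp k B).IsPositive := by
  rw [ContinuousLinearMap.isPositive_def']
  have hs : star B = B := hB.isSelfAdjoint
  refine ⟨?_, fun x => ?_⟩
  · change ContinuousLinearMap.adjoint _ = _
    rw [scalarOp, adjoint_opMatrix, Matrix.diagonal_conjTranspose]
    congr 2
    funext i
    exact hs
  · rw [ContinuousLinearMap.reApplyInnerSelf_apply, PiLp.inner_apply, map_sum]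
    refine Finset.sum_nonneg fun i _ => ?_
    rw [scalarOp_apply]
    exact (RCLike.nonneg_iff.1 (hB.inner_nonneg_left (x i))).1

theorem isPositive_entry {T : Amp E k →L[ℂ] Amp E k} (hT : T.IsPositive) (i : Fin k) :
    (entry T i i).IsPositive := by
  have h : ∀ (S : Amp E k →L[ℂ] Amp E k) (x y : E), ⟪entry S i i x, y⟫_ℂ =
      ⟪S (WithLp.toLp 2 (Pi.single i x)), (WithLp.toLp 2 (Pi.single i y) : Amp E k)⟫_ℂ := by
    intro S x y
    rw [PiLp.inner_apply, Finset.sum_eq_single i]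
    · simp [entry_apply]
    · intro j _ hj
      simp [Pi.single_eq_of_ne hj]
    · simp
  rw [ContinuousLinearMap.isPositive_def']
  refine ⟨?_, fun x => ?_⟩
  · have hs : ContinuousLinearMap.adjoint T = T := hT.isSelfAdjoint
    change ContinuousLinearMap.adjoint _ = _
    symm
    rw [ContinuousLinearMap.eq_adjoint_iff]
    intro x y
    rw [h, ← inner_conj_symm x, h, inner_conj_symm, ← ContinuousLinearMap.adjoint_inner_left, hs]
  · rw [ContinuousLinearMap.reApplyInnerSelf_apply, h]
    exact (RCLike.nonneg_iff.1 (hT.inner_nonneg_left _)).1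

omit [CompleteSpace E] in
theorem ampl_apply_eq_iff (T : E →ₗ.[ℂ] E) (c : ℂ) (x : Amp E k) :
    (∃ hx : x ∈ (ampl T k).domain, ampl T k ⟨x, hx⟩ = c • x) ↔
      ∀ i, ∃ hx : x i ∈ T.domain, T ⟨x i, hx⟩ = c • x i := by
  constructor
  · rintro ⟨hx, h⟩ i
    exact ⟨hx i, congrArg (fun y : Amp E k => y i) h⟩
  · intro h
    refine ⟨fun i => (h i).1, ?_⟩
    ext i
    exact (h i).2

theorem IsKerProj.ampl {T : E →ₗ.[ℂ] E} {P : E →L[ℂ] E} (hP : IsKerProj T P) :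
    IsKerProj (ampl T k) (scalarOp k P) := by
  have hs : star P = P := hP.adjoint_eq
  refine ⟨?_, fun x => ?_, fun x => ?_⟩
  · rw [scalarOp, adjoint_opMatrix, Matrix.diagonal_conjTranspose]
    congr 2
    funext i
    exact hs
  · ext i
    rw [scalarOp_apply, scalarOp_apply, hP.idem]
  · have h := ampl_apply_eq_iff T 0 x
    have h' := hP.apply_eq_iff
    simp only [zero_smul] at h
    rw [h]
    simp only [← h']
    constructor
    · intro hx i
      conv_rhs => rw [← hx]
      rw [scalarOp_apply]
    · intro hx
      ext i
      rw [scalarOp_apply, hx]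

-- Each coordinate embedding carries eigenvectors of `T` to eigenvectors of `T ⊗ 1_k`, and every
-- vector is a finite sum of its embedded coordinates.
omit [CompleteSpace E] in
theorem IsFunctionOf.ampl {T : E →ₗ.[ℂ] E} {h : ℝ → ℝ} {B : E →L[ℂ] E} (hB : IsFunctionOf T h B) :
    IsFunctionOf (ampl T k) h (scalarOp k B) := by
  constructor
  · set S := Submodule.span ℂ {x : Amp E k | ∃ (l : ℝ) (hx : x ∈ (CuntzModular.ampl T k).domain),
      CuntzModular.ampl T k ⟨x, hx⟩ = (l : ℂ) • x} with hS
    rw [eq_top_iff]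
    intro x _
    rw [← Amp.sum_single x]
    refine sum_mem fun i _ => ?_
    let L : E →L[ℂ] Amp E k :=
      (PiLp.continuousLinearEquiv 2 ℂ (fun _ : Fin k => E)).symm.toContinuousLinearMap ∘L
        ContinuousLinearMap.single ℂ (fun _ : Fin k => E) i
    have hL : ∀ y, L y = WithLp.toLp 2 (Pi.single i y) := fun y => rfl
    rw [← hL]
    have hx : x i ∈ (Submodule.span ℂ {x : E | ∃ (l : ℝ) (hx : x ∈ T.domain),
      T ⟨x, hx⟩ = (l : ℂ) • x}).topologicalClosure := by rw [hB.1]; trivial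
    refine map_mem_closure L.continuous hx fun y hy => ?_
    have hmap := Submodule.mem_map_of_mem (f := (L : E →ₗ[ℂ] Amp E k)) hy
    rw [Submodule.map_span] at hmap
    refine Submodule.span_mono ?_ hmap
    rintro _ ⟨z, ⟨l, hz⟩, rfl⟩
    refine ⟨l, (ampl_apply_eq_iff T l _).2 fun j => ?_⟩
    change ∃ hx : (L z) j ∈ T.domain, T ⟨(L z) j, hx⟩ = (l : ℂ) • (L z) j
    by_cases hj : j = i
    · subst hj
      have : (L z) j = z := by simp [hL]
      rwa [this]
    · have : (L z) j = 0 := by rw [hL]; exact Pi.single_eq_of_ne hj _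
      rw [this]
      exact ⟨T.domain.zero_mem, by rw [smul_zero]; exact T.map_zero⟩
  · intro l x hx hl
    have hi := (ampl_apply_eq_iff T l x).1 ⟨hx, hl⟩
    ext i
    obtain ⟨hx', hl'⟩ := hi i
    rw [scalarOp_apply, hB.2 l _ hx' hl']
    rfl

end Amplification

/-! ### Heat functions -/

theorem heat_neg (t l : ℝ) : heat t (-l) = -heat t l := by simp [heat]

theorem summable_heat {t : ℝ} (ht : 0 < t) : Summable fun m : ℤ => |heat t m| := by
  have h : Summable fun m : ℕ => |heat t m| := by
    refine Summable.of_nonneg_of_le (fun _ => abs_nonneg _) (fun m => ?_)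
      (Real.summable_pow_mul_exp_neg_nat_mul 1 ht)
    -- Since `m ≤ m²` for natural `m`, the Gaussian is dominated by `exp(-tm)`.
    have hm : (m : ℝ) ≤ (m : ℝ) ^ 2 := by exact_mod_cast Nat.le_self_pow two_ne_zero m
    rw [heat, abs_of_nonneg (by positivity), pow_one]
    refine mul_le_mul_of_nonneg_left (Real.exp_le_exp.2 ?_) (by positivity)
    nlinarith
  refine Summable.of_nat_of_neg (by simpa using h) ?_
  simpa [heat_neg] using h

/-! ### Eta invariants with vanishing integrand. -/

section Eta

variable {E : Type*} [NormedAddCommGroup E] [InnerProductSpace ℂ E] [CompleteSpace E]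

theorem eta_of_isWeightValue_zero {N : Set (E →L[ℂ] E)} {φ : (E →L[ℂ] E) → ℝ≥0∞}
    (hφ : ∀ P Q : E →L[ℂ] E, P.IsPositive → Q.IsPositive → φ (P + Q) = φ P + φ Q)
    {T : E →ₗ.[ℂ] E} (hT : ∀ t : ℝ, 0 < t → ∃ F, IsFunctionOf T (heat t) F ∧ IsWeightValue N φ F 0)
    {ε : ℝ} (hε : 0 < ε) : EtaDefined N φ T ε ∧ eta N φ T ε = 0 := by
  have h0 : ∀ t ∈ Set.Ioi ε, etaIntegrand N φ T t = 0 := fun t ht => by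
    obtain ⟨F, hF, hw⟩ := hT t (hε.trans ht)
    rw [etaIntegrand, hF.functionOf_eq, weightValue_eq hφ hw, zero_mul]
  refine ⟨⟨fun t ht => ?_, ?_⟩, ?_⟩
  · obtain ⟨F, hF, hw⟩ := hT t ht
    rw [hF.functionOf_eq]
    exact ⟨hF, 0, hw⟩
  · exact (MeasureTheory.integrableOn_congr_fun h0 measurableSet_Ioi).2
      MeasureTheory.integrableOn_zero
  · rw [eta, MeasureTheory.setIntegral_congr_fun measurableSet_Ioi h0]
    simp

theorem conjBy_one (T : E →ₗ.[ℂ] E) : conjBy 1 T = T := by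
  have h1 : ∀ x : E, ContinuousLinearMap.adjoint (1 : E →L[ℂ] E) x = x := fun x => by
    rw [← ContinuousLinearMap.star_eq_adjoint, star_one]
    rfl
  refine LinearPMap.ext ?_ ?_
  · ext x
    change ContinuousLinearMap.adjoint (1 : E →L[ℂ] E) x ∈ T.domain ↔ _
    rw [h1]
  · intro x hx hx'
    change T ⟨ContinuousLinearMap.adjoint (1 : E →L[ℂ] E) x, hx⟩ = _
    congr 1
    exact Subtype.ext (h1 x)

end Eta

theorem CuntzAlgebra.one_apply_mem_alg {n : ℕ} {A : Type u} [CStarAlgebra A]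
    (O : CuntzAlgebra n A) {k : ℕ} (i j : Fin k) : (1 : Matrix (Fin k) (Fin k) A) i j ∈ O.alg := by
  rw [Matrix.one_apply]
  split_ifs
  · exact O.one_mem_alg
  · exact zero_mem _

namespace CuntzAlgebra.FaithfulTrace

variable {n : ℕ} {A : Type u} [CStarAlgebra A] [PartialOrder A] [StarOrderedRing A]
  {O : CuntzAlgebra n A} (τ : O.FaithfulTrace)

/-! ### The generator of the gauge action -/

theorem proj_D (x : τ.D.domain) (m : ℤ) : τ.proj m (τ.D x) = (m : ℂ) • τ.proj m x :=
  τ.proj_of_hasSum (f := fun m : ℤ => (m : ℂ) • τ.proj m (x : τ.H))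
    (fun m => by rw [map_smul, proj_idem]) (Summable.hasSum x.2) m

theorem exists_D_eq {x y : τ.H} (h : ∀ m : ℤ, τ.proj m y = (m : ℂ) • τ.proj m x) :
    ∃ hx : x ∈ τ.D.domain, τ.D ⟨x, hx⟩ = y := by
  have hs : Summable fun m : ℤ => (m : ℂ) • τ.proj m x := by
    simpa only [← h] using (τ.hasSum_proj y).summable
  exact ⟨hs, τ.eq_of_proj fun m => by rw [proj_D, h]⟩

/-- Eigenvectors of `D` are recognised componentwise, which settles their membership in the maximal
domain at once. -/
theorem D_eq_smul_iff {x : τ.H} (c : ℂ) : (∃ hx : x ∈ τ.D.domain, τ.D ⟨x, hx⟩ = c • x) ↔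
    ∀ m : ℤ, (m : ℂ) • τ.proj m x = c • τ.proj m x := by
  constructor
  · rintro ⟨hx, h⟩ m
    rw [← map_smul _ c, ← h, proj_D]
  · intro h
    exact τ.exists_D_eq fun m => by rw [map_smul, h]

variable {τ} in
theorem IsDiag.isFunctionOf {h : ℝ → ℝ} {B : τ.H →L[ℂ] τ.H} (hB : τ.IsDiag (fun m => h m) B) :
    IsFunctionOf τ.D h B := by
  constructor
  · rw [← Submodule.dense_iff_topologicalClosure_eq_top]
    refine τ.dense_vec_alg.mono ?_
    rintro _ ⟨a, ha, rfl⟩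
    refine O.alg_induction (p := fun a => τ.vec a ∈ (Submodule.span ℂ {x : τ.H | ∃ (l : ℝ)
      (hx : x ∈ τ.D.domain), τ.D ⟨x, hx⟩ = (l : ℂ) • x})) (fun m a ha => ?_)
      (fun a _ b _ ha hb => ?_) ha
    · refine Submodule.subset_span ⟨m, (τ.D_eq_smul_iff _).2 fun l => ?_⟩
      rw [τ.proj_vec l ha]
      split_ifs with hl
      · rw [hl, Complex.ofReal_intCast]
      · simp
    · rw [map_add]; exact add_mem ha hb
  · intro l x hx hl
    have h1 := (τ.D_eq_smul_iff _).1 ⟨hx, hl⟩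
    refine τ.eq_of_proj fun m => ?_
    rw [hB.proj_apply, map_smul]
    by_cases hm : (m : ℝ) = l
    · rw [hm]
    · have h2 : ((m : ℂ) - l) • τ.proj m x = 0 := by rw [sub_smul, h1, sub_self]
      have h3 : (m : ℂ) - l ≠ 0 := sub_ne_zero.2 (by exact_mod_cast hm)
      rw [(smul_eq_zero_iff_right h3).1 h2, smul_zero, smul_zero]

/-- The weight of the heat operator has to be evaluated through a difference of positive operators.
The positive and negative parts of the heat function are exchanged by `m ↦ -m`, so their sums agree.
-/
theorem exists_isDiag_heat {t : ℝ} (ht : 0 < t) : ∃ B B' : τ.H →L[ℂ] τ.H,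
    τ.IsDiag (fun m => max (heat t m) 0) B ∧ τ.IsDiag (fun m => max (-heat t m) 0) B' ∧
    τ.IsDiag (fun m => heat t m) (B - B') ∧ (Summable fun m : ℤ => max (heat t m) 0) ∧
    (Summable fun m : ℤ => max (-heat t m) 0) ∧
    ∑' m : ℤ, max (heat t m) 0 = ∑' m : ℤ, max (-heat t m) 0 := by
  have hs := summable_heat ht
  have hle : ∀ m : ℤ, |heat t m| ≤ ∑' l : ℤ, |heat t l| := fun m =>
    hs.le_tsum m fun _ _ => abs_nonneg _
  have h1 : ∀ m : ℤ, |max (heat t m) 0| ≤ |heat t m| := fun m => by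
    rw [abs_of_nonneg (le_max_right _ _)]
    exact max_le (le_abs_self _) (abs_nonneg _)
  have h2 : ∀ m : ℤ, |max (-heat t m) 0| ≤ |heat t m| := fun m => by
    rw [abs_of_nonneg (le_max_right _ _)]
    exact max_le (neg_le_abs _) (abs_nonneg _)
  obtain ⟨B, hB⟩ := τ.exists_isDiag fun m => (h1 m).trans (hle m)
  obtain ⟨B', hB'⟩ := τ.exists_isDiag fun m => (h2 m).trans (hle m)
  refine ⟨B, B', hB, hB', ?_, .of_norm_bounded hs h1, .of_norm_bounded hs h2, ?_⟩
  · convert hB.sub hB' using 1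
    funext m
    exact (max_zero_sub_max_neg_zero_eq_self _).symm
  · rw [← (Equiv.neg ℤ).tsum_eq]
    simp [heat_neg]

theorem isKerProj_D : IsKerProj τ.D (τ.proj 0) := by
  refine ⟨τ.adjoint_proj 0, τ.proj_idem 0, fun x => ?_⟩
  have h := τ.D_eq_smul_iff (x := x) 0
  simp only [zero_smul] at h
  rw [h]
  constructor
  · intro hx m
    rw [← hx, proj_proj]
    split_ifs with hm
    · simp [hm]
    · simp
  · intro hx
    refine τ.eq_of_proj fun m => ?_
    rw [proj_proj]
    split_ifs with hm
    · rw [hm]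
    · exact ((smul_eq_zero_iff_right (by exact_mod_cast hm)).1 (hx m)).symm

section

variable [NeZero n]

theorem dense_modular_domain : Dense (τ.modular.domain : Set τ.H) := by
  refine τ.dense_vec_alg.mono ?_
  rintro _ ⟨a, ha, rfl⟩
  refine O.alg_induction (p := fun a => τ.vec a ∈ τ.modular.domain) (fun m a ha => ?_)
    (fun a _ b _ ha hb => ?_) ha
  · have := τ.proj_mem_modular_domain m (τ.vec a)
    rwa [τ.proj_vec m ha, if_pos rfl] at this
  · rw [map_add]; exact add_mem ha hb

theorem modular_injective (x : τ.modular.domain) (hx : τ.modular x = 0) : x = 0 := by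
  have hn : (n : ℂ) ≠ 0 := NeZero.ne _
  refine Subtype.ext (τ.eq_of_proj fun m => ?_)
  have h := τ.proj_modular x m
  rw [hx, map_zero] at h
  rw [(smul_eq_zero_iff_right (zpow_ne_zero (-m) hn)).1 h.symm]
  exact (map_zero _).symm

end

/-! ### Matrices -/

section Matrices

variable {k : ℕ}

theorem repMatrix_mul (a b : Matrix (Fin k) (Fin k) A) :
    τ.repMatrix (a * b) = τ.repMatrix a * τ.repMatrix b := by
  rw [repMatrix, repMatrix, repMatrix, ← opMatrix_mul]
  congr 1
  ext1 i j
  simp only [Matrix.map_apply, Matrix.mul_apply, rep_sum, rep_mul]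

theorem repMatrix_one : τ.repMatrix (1 : Matrix (Fin k) (Fin k) A) = 1 := by
  rw [repMatrix, ← opMatrix_one, Matrix.map_one _ τ.rep_zero τ.rep_one]

theorem repMatrix_add (a b : Matrix (Fin k) (Fin k) A) :
    τ.repMatrix (a + b) = τ.repMatrix a + τ.repMatrix b := by
  rw [repMatrix, repMatrix, repMatrix, ← opMatrix_add, Matrix.map_add _ τ.rep_add]

theorem repMatrix_sub (a b : Matrix (Fin k) (Fin k) A) :
    τ.repMatrix (a - b) = τ.repMatrix a - τ.repMatrix b := by
  rw [eq_sub_iff_add_eq, ← repMatrix_add, sub_add_cancel]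

theorem repMatrix_smul (c : ℂ) (a : Matrix (Fin k) (Fin k) A) :
    τ.repMatrix (c • a) = c • τ.repMatrix a := by
  rw [repMatrix, repMatrix, ← opMatrix_smul, Matrix.map_smul _ _ (τ.rep_smul c)]

theorem adjoint_repMatrix (a : Matrix (Fin k) (Fin k) A) :
    ContinuousLinearMap.adjoint (τ.repMatrix a) = τ.repMatrix a.conjTranspose := by
  rw [repMatrix, adjoint_opMatrix, repMatrix]
  congr 1
  ext1 i j
  exact τ.adjoint_rep _

/-- `ψ ⊗ Tr`. -/
def stateMatrix (b : Matrix (Fin k) (Fin k) A) : ℂ := ∑ i, τ.state (b i i)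

theorem stateMatrix_add (a b : Matrix (Fin k) (Fin k) A) :
    τ.stateMatrix (a + b) = τ.stateMatrix a + τ.stateMatrix b := by
  simp only [stateMatrix, Matrix.add_apply, map_add, Finset.sum_add_distrib]

theorem stateMatrix_sub (a b : Matrix (Fin k) (Fin k) A) :
    τ.stateMatrix (a - b) = τ.stateMatrix a - τ.stateMatrix b := by
  simp only [stateMatrix, Matrix.sub_apply, map_sub, Finset.sum_sub_distrib]

theorem stateMatrix_smul (c : ℂ) (a : Matrix (Fin k) (Fin k) A) :
    τ.stateMatrix (c • a) = c * τ.stateMatrix a := by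
  simp only [stateMatrix, Matrix.smul_apply, map_smul, smul_eq_mul, Finset.mul_sum]

theorem stateMatrix_mul_conjTranspose (b : Matrix (Fin k) (Fin k) A) :
    τ.stateMatrix (b * b.conjTranspose) =
      ((∑ i, ∑ j, (τ.state (b i j * star (b i j))).re : ℝ) : ℂ) := by
  simp only [stateMatrix, Matrix.mul_apply, Matrix.conjTranspose_apply, map_sum, Complex.ofReal_sum]
  refine Finset.sum_congr rfl fun i _ => Finset.sum_congr rfl fun j _ => ?_
  have := τ.state.map_nonneg (mul_star_self_nonneg (b i j))
  exact (Complex.eq_re_of_ofReal_le this)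

theorem entry_conj (a b : Matrix (Fin k) (Fin k) A) (B : τ.H →L[ℂ] τ.H) (i j : Fin k) :
    entry (τ.repMatrix a * scalarOp k B * τ.repMatrix b.conjTranspose) i j =
      ∑ l, τ.rep (a i l) * B * τ.rep (star (b j l)) := by
  rw [repMatrix, repMatrix, scalarOp, ← opMatrix_mul, ← opMatrix_mul, entry_opMatrix,
    Matrix.mul_apply]
  simp only [Matrix.mul_diagonal, Matrix.map_apply, Matrix.conjTranspose_apply]

section

variable [NeZero n]

theorem weightMatrix_add (P Q : Amp τ.H k →L[ℂ] Amp τ.H k) (hP : P.IsPositive) (hQ : Q.IsPositive) :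
    τ.weightMatrix k (P + Q) = τ.weightMatrix k P + τ.weightMatrix k Q := by
  simp only [weightMatrix, entry_add, ← Finset.sum_add_distrib]
  exact Finset.sum_congr rfl fun i _ => τ.weight_add (isPositive_entry hP i) (isPositive_entry hQ i)

theorem weightMatrix_zero : τ.weightMatrix k 0 = 0 := by
  simp [weightMatrix, entry_zero, weight_zero]

omit [NeZero n] in
theorem zero_mem_vNMatrix : 0 ∈ τ.vNMatrix k := fun i j => by
  rw [entry_zero]; exact τ.zero_mem_vN

variable {τ}

theorem IsDiag.conj_mem_vNMatrix {h : ℤ → ℝ} {B : τ.H →L[ℂ] τ.H} (hB : τ.IsDiag h B)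
    {b : Matrix (Fin k) (Fin k) A} (hb : ∀ i j, b i j ∈ O.alg) :
    τ.repMatrix b * scalarOp k B * τ.repMatrix b.conjTranspose ∈ τ.vNMatrix k := fun i j => by
  rw [entry_conj]
  exact τ.sum_mem_vN _ _ fun l _ => hB.rep_mul_mul_rep_mem_vN (hb i l) (hb j l)

omit [NeZero n] in
theorem IsDiag.isPositive_conjMatrix {h : ℤ → ℝ} {B : τ.H →L[ℂ] τ.H} (hB : τ.IsDiag h B)
    (hh : ∀ m, 0 ≤ h m) (b : Matrix (Fin k) (Fin k) A) :
    (τ.repMatrix b * scalarOp k B * τ.repMatrix b.conjTranspose).IsPositive := by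
  rw [← adjoint_repMatrix]
  exact (isPositive_scalarOp (hB.isPositive hh)).conj_adjoint (τ.repMatrix b)

theorem IsDiag.weightMatrix_conj {h : ℤ → ℝ} {B : τ.H →L[ℂ] τ.H} (hB : τ.IsDiag h B)
    (hh : ∀ m, 0 ≤ h m) (hs : Summable h) {b : Matrix (Fin k) (Fin k) A}
    (hb : ∀ i j, b i j ∈ O.alg) :
    τ.weightMatrix k (τ.repMatrix b * scalarOp k B * τ.repMatrix b.conjTranspose) =
      ENNReal.ofReal ((∑' m, h m) * ∑ i, ∑ j, (τ.state (b i j * star (b i j))).re) := by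
  have hq : ∀ i j, 0 ≤ (τ.state (b i j * star (b i j))).re := fun i j => τ.state_mul_star_nonneg _
  rw [ENNReal.ofReal_mul (tsum_nonneg hh), ENNReal.ofReal_tsum_of_nonneg hh hs,
    ENNReal.ofReal_sum_of_nonneg fun i _ => Finset.sum_nonneg fun j _ => hq i j, Finset.mul_sum]
  unfold weightMatrix
  refine Finset.sum_congr rfl fun i _ => ?_
  -- A diagonal entry is `∑_l π(b_{il}) h(D) π(b_{il})*`, a sum of positive operators to which the
  -- scalar formula applies.
  rw [entry_conj, τ.weight_sum _ fun l => hB.isPositive_conj hh _,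
    ENNReal.ofReal_sum_of_nonneg fun j _ => hq i j, Finset.mul_sum]
  exact Finset.sum_congr rfl fun j _ => hB.weight_conj hh (hb i j)

theorem IsDiag.weightMatrix_conj_lt_top {h : ℤ → ℝ} {B : τ.H →L[ℂ] τ.H} (hB : τ.IsDiag h B)
    (hh : ∀ m, 0 ≤ h m) (hs : Summable h) {b : Matrix (Fin k) (Fin k) A}
    (hb : ∀ i j, b i j ∈ O.alg) :
    τ.weightMatrix k (τ.repMatrix b * scalarOp k B * τ.repMatrix b.conjTranspose) < ∞ := by
  rw [hB.weightMatrix_conj hh hs hb]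
  exact ENNReal.ofReal_lt_top

/-- `τ_Δ(π(b) h(D) π(b)*) = ∑ h(m) · ψ(b b*)`. -/
theorem IsDiag.toReal_weightMatrix_conj {h : ℤ → ℝ} {B : τ.H →L[ℂ] τ.H} (hB : τ.IsDiag h B)
    (hh : ∀ m, 0 ≤ h m) (hs : Summable h) {b : Matrix (Fin k) (Fin k) A}
    (hb : ∀ i j, b i j ∈ O.alg) :
    ((τ.weightMatrix k
      (τ.repMatrix b * scalarOp k B * τ.repMatrix b.conjTranspose)).toReal : ℂ) =
      ((∑' m, h m : ℝ) : ℂ) * τ.stateMatrix (b * b.conjTranspose) := by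
  rw [hB.weightMatrix_conj hh hs hb, ENNReal.toReal_ofReal, stateMatrix_mul_conjTranspose,
    Complex.ofReal_mul]
  exact mul_nonneg (tsum_nonneg hh) (Finset.sum_nonneg fun i _ => Finset.sum_nonneg fun j _ =>
    τ.state_mul_star_nonneg _)

theorem IsDiag.isWeightValue_conj_sub {h h' : ℤ → ℝ} {B B' : τ.H →L[ℂ] τ.H} (hB : τ.IsDiag h B)
    (hB' : τ.IsDiag h' B') (hh : ∀ m, 0 ≤ h m) (hh' : ∀ m, 0 ≤ h' m) (hs : Summable h)
    (hs' : Summable h') {b b' : Matrix (Fin k) (Fin k) A} (hb : ∀ i j, b i j ∈ O.alg)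
    (hb' : ∀ i j, b' i j ∈ O.alg) :
    IsWeightValue (τ.vNMatrix k) (τ.weightMatrix k)
      (τ.repMatrix b * scalarOp k B * τ.repMatrix b.conjTranspose -
        τ.repMatrix b' * scalarOp k B' * τ.repMatrix b'.conjTranspose)
      (((∑' m, h m : ℝ) : ℂ) * τ.stateMatrix (b * b.conjTranspose) -
        ((∑' m, h' m : ℝ) : ℂ) * τ.stateMatrix (b' * b'.conjTranspose)) := by
  rw [← hB.toReal_weightMatrix_conj hh hs hb, ← hB'.toReal_weightMatrix_conj hh' hs' hb']
  exact isWeightValue_sub τ.zero_mem_vNMatrix τ.weightMatrix_zero (hB.conj_mem_vNMatrix hb)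
    (hB.isPositive_conjMatrix hh b) (hB.weightMatrix_conj_lt_top hh hs hb)
    (hB'.conj_mem_vNMatrix hb') (hB'.isPositive_conjMatrix hh' b')
    (hB'.weightMatrix_conj_lt_top hh' hs' hb')

variable (τ)

/-- `τ_Δ(π(g) [ker D]) = ψ(g)`. -/
theorem isWeightValue_repMatrix_mul_proj_zero {g : Matrix (Fin k) (Fin k) A}
    (hg : ∀ i j, g i j ∈ O.alg) :
    IsWeightValue (τ.vNMatrix k) (τ.weightMatrix k) (τ.repMatrix g * scalarOp k (τ.proj 0))
      (τ.stateMatrix g) := by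
  have hB := τ.isDiag_proj 0
  have hh : ∀ m, 0 ≤ (Pi.single 0 1 : ℤ → ℝ) m := fun m => by
    rw [Pi.single_apply]; split_ifs <;> norm_num
  have hs : HasSum (Pi.single 0 1 : ℤ → ℝ) 1 := hasSum_pi_single 0 1
  -- Polarisation: with `P c = π(b c) Φ_0 π(b c)*`, the sum of `c P c` over `c = ±1, ±i` is `π(g)
  -- Φ_0`, because the sums of `c`, `c²` and `c|c|²` vanish. The four `P c` are positive of finite
  -- weight, as the definition of the extension demands.
  let b : ℂ → Matrix (Fin k) (Fin k) A := fun c => (1 / 2 : ℂ) • (g + c • 1)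
  have hb : ∀ c i j, b c i j ∈ O.alg := fun c i j =>
    O.alg.smul_mem _ (add_mem (hg i j) (O.alg.smul_mem c (O.one_apply_mem_alg i j)))
  let P : ℂ → Amp τ.H k →L[ℂ] Amp τ.H k := fun c =>
    τ.repMatrix (b c) * scalarOp k (τ.proj 0) * τ.repMatrix (b c).conjTranspose
  have hP : ∀ c, P c ∈ τ.vNMatrix k ∧ (P c).IsPositive ∧ τ.weightMatrix k (P c) < ∞ := fun c =>
    ⟨hB.conj_mem_vNMatrix (hb c), hB.isPositive_conjMatrix hh _,
      hB.weightMatrix_conj_lt_top hh hs.summable (hb c)⟩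
  have hw : ∀ c, ((τ.weightMatrix k (P c)).toReal : ℂ) =
      τ.stateMatrix (b c * (b c).conjTranspose) := fun c => by
    rw [hB.toReal_weightMatrix_conj hh hs.summable (hb c), hs.tsum_eq, Complex.ofReal_one, one_mul]
  have hbs : ∀ c, (b c).conjTranspose = (1 / 2 : ℂ) • (g.conjTranspose + star c • 1) := fun c => by
    simp [b, Matrix.conjTranspose_smul, Matrix.conjTranspose_add]
  refine ⟨![P 1, P (-1), P Complex.I, P (-Complex.I)], fun j => ?_, ?_, ?_⟩
  · fin_cases j <;> exact hP _
  · change _ = P 1 - P (-1) + Complex.I • (P Complex.I - P (-Complex.I))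
    have hP' : ∀ c, P c = (1 / 4 : ℂ) • (τ.repMatrix g * scalarOp k (τ.proj 0) *
        τ.repMatrix g.conjTranspose + star c • (τ.repMatrix g * scalarOp k (τ.proj 0)) +
        c • (scalarOp k (τ.proj 0) * τ.repMatrix g.conjTranspose) +
        (c * star c) • scalarOp k (τ.proj 0)) := fun c => by
      change τ.repMatrix (b c) * _ * _ = _
      rw [hbs, show b c = (1 / 2 : ℂ) • (g + c • 1) from rfl]
      simp only [repMatrix_smul, repMatrix_add, repMatrix_one, add_mul, mul_add,
        smul_mul_assoc, mul_smul_comm, one_mul, mul_one, smul_add, smul_smul]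
      module
    rw [hP', hP', hP', hP']
    simp only [star_neg, star_one, Complex.star_def, Complex.conj_I]
    match_scalars <;> ring_nf <;> simp only [Complex.I_sq] <;> ring
  · change _ = ((τ.weightMatrix k (P 1)).toReal : ℂ) - (τ.weightMatrix k (P (-1))).toReal +
      Complex.I * ((τ.weightMatrix k (P Complex.I)).toReal -
        (τ.weightMatrix k (P (-Complex.I))).toReal)
    have hb' : ∀ c, τ.stateMatrix (b c * (b c).conjTranspose) = 1 / 4 * (
        τ.stateMatrix (g * g.conjTranspose) + star c * τ.stateMatrix g +
        c * τ.stateMatrix g.conjTranspose + c * star c * τ.stateMatrix 1) := fun c => by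
      rw [hbs, show b c = (1 / 2 : ℂ) • (g + c • 1) from rfl]
      simp only [add_mul, mul_add, smul_mul_assoc, mul_smul_comm, one_mul, mul_one,
        smul_add, smul_smul, stateMatrix_add, stateMatrix_smul]
      ring
    rw [hw, hw, hw, hw, hb', hb', hb', hb']
    simp only [star_neg, star_one, Complex.star_def, Complex.conj_I]
    ring_nf
    simp only [Complex.I_sq]
    ring

/-! ### The kernel corrections and the eta invariants -/

/-- The factor `n^m` from `σ` cancels the KMS factor `n^{-m}`. -/
theorem state_sigma_mul {a b : A} (ha : a ∈ O.alg) (hb : b ∈ O.alg) :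
    τ.state (τ.sigma a * b) = τ.state (b * a) := by
  have hn : (n : ℂ) ≠ 0 := NeZero.ne _
  refine O.alg_induction (p := fun a => τ.state (τ.sigma a * b) = τ.state (b * a))
    (fun m a ha => ?_) (fun a ha a' ha' h h' => ?_) ha
  · rw [τ.sigma_homog ha, smul_mul_assoc, map_smul, τ.state_homog_mul ha hb, smul_eq_mul,
      ← mul_assoc, ← zpow_add₀ hn, add_neg_cancel, zpow_zero, one_mul]
  · rw [τ.sigma_add ha ha', add_mul, mul_add, map_add, map_add, h, h']

theorem stateMatrix_sigma_mul {a b : Matrix (Fin k) (Fin k) A} (ha : ∀ i j, a i j ∈ O.alg)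
    (hb : ∀ i j, b i j ∈ O.alg) : τ.stateMatrix (a.map τ.sigma * b) = τ.stateMatrix (b * a) := by
  simp only [stateMatrix, Matrix.mul_apply, map_sum, Matrix.map_apply]
  rw [Finset.sum_comm]
  exact Finset.sum_congr rfl fun i _ => Finset.sum_congr rfl fun j _ =>
    τ.state_sigma_mul (ha j i) (hb i j)

theorem map_sigma_mul {a b : Matrix (Fin k) (Fin k) A} (ha : ∀ i j, a i j ∈ O.alg)
    (hb : ∀ i j, b i j ∈ O.alg) : (a * b).map τ.sigma = a.map τ.sigma * b.map τ.sigma := by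
  ext1 i j
  simp only [Matrix.map_apply, Matrix.mul_apply]
  rw [τ.sigma_sum _ fun l => O.mul_mem_alg (ha i l) (hb l j)]
  exact Finset.sum_congr rfl fun l _ => τ.sigma_mul (ha i l) (hb l j)

theorem isSpatial_repMatrix {a : Matrix (Fin k) (Fin k) A} (ha : ∀ i j, a i j ∈ O.alg) :
    IsSpatial (ampl τ.modular k) (τ.repMatrix a) (τ.repMatrix (a.map τ.sigma)) := by
  intro x hx
  have h : ∀ i, ∃ h : τ.repMatrix (a.map τ.sigma) x i ∈ τ.modular.domain,
      τ.modular ⟨_, h⟩ = τ.repMatrix a (ampl τ.modular k ⟨x, hx⟩) i := fun i => by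
    refine τ.exists_modular_eq fun m => ?_
    rw [repMatrix, opMatrix_apply, repMatrix, opMatrix_apply, map_sum, map_sum, Finset.smul_sum]
    exact Finset.sum_congr rfl fun j _ => τ.proj_rep_of_modular (ha i j)
      (τ.proj_modular ⟨x j, hx j⟩) m
  refine ⟨fun i => (h i).1, ?_⟩
  ext i
  exact (h i).2

theorem sigmaI_repMatrix {a : Matrix (Fin k) (Fin k) A} (ha : ∀ i j, a i j ∈ O.alg) :
    τ.sigmaI (τ.repMatrix a) = τ.repMatrix (a.map τ.sigma) := by
  refine IsSpatial.spatial_eq (dense_ampl_domain τ.dense_modular_domain) (fun x hx => ?_)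
    (τ.isSpatial_repMatrix ha)
  refine Subtype.ext ?_
  ext i
  exact congrArg Subtype.val (τ.modular_injective ⟨x.1 i, x.2 i⟩
    (congrArg (fun y : Amp τ.H k => y i) hx))

variable {τ}

section ModularUnitary

variable {u : Matrix (Fin k) (Fin k) A} (hu : τ.IsModularUnitary u)

include hu

omit [NeZero n] in
theorem IsModularUnitary.adjoint_mul :
    ContinuousLinearMap.adjoint (τ.repMatrix u) * τ.repMatrix u = 1 := by
  rw [adjoint_repMatrix, ← repMatrix_mul, hu.star_mul_self, repMatrix_one]

omit [NeZero n] in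
theorem IsModularUnitary.mul_adjoint :
    τ.repMatrix u * ContinuousLinearMap.adjoint (τ.repMatrix u) = 1 := by
  rw [adjoint_repMatrix, ← repMatrix_mul, hu.mul_star_self, repMatrix_one]

omit [NeZero n] in
theorem IsModularUnitary.conjTranspose_mem (i j : Fin k) : u.conjTranspose i j ∈ O.alg :=
  O.star_mem_alg (hu.mem j i)

theorem IsModularUnitary.sigma_mul_mem_alg (i j : Fin k) :
    (u.conjTranspose.map τ.sigma * u) i j ∈ O.alg := by
  rw [Matrix.mul_apply]
  exact sum_mem fun l _ => O.mul_mem_alg (τ.sigma_mem_alg (hu.conjTranspose_mem i l)) (hu.mem l j)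

/-- `σ(u*) u` is gauge invariant, being the inverse of `u* σ(u)`. -/
theorem IsModularUnitary.sigma_mul_mem_fixed (hn : 2 ≤ n) (i j : Fin k) :
    (u.conjTranspose.map τ.sigma * u) i j ∈ O.fixed := by
  set v := u.conjTranspose * u.map τ.sigma with hv
  set w := u.conjTranspose.map τ.sigma * u with hw
  have h1 : (1 : Matrix (Fin k) (Fin k) A).map τ.sigma = 1 :=
    Matrix.map_one _ τ.sigma_zero τ.sigma_one
  have hwv : w * v = 1 := by
    rw [hv, hw, mul_assoc, ← mul_assoc u, hu.mul_star_self, one_mul,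
      ← τ.map_sigma_mul hu.conjTranspose_mem hu.mem, hu.star_mul_self, h1]
  have hvw : v * w = 1 := by
    rw [hv, hw, mul_assoc, ← mul_assoc (u.map _), ← τ.map_sigma_mul hu.mem hu.conjTranspose_mem,
      hu.mul_star_self, h1, one_mul, hu.star_mul_self]
  intro z
  have hvz : v.map (O.gauge z) = v := by
    ext1 i j
    exact τ.mem_fixed_of_sigma_eq hn (hu.modular_right i j).1 (hu.modular_right i j).2 z
  -- Applying the gauge automorphism to `wv = 1` makes its image of `w` another left inverse of `v`;
  -- since `v` is invertible, that image is `w`.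
  have hwz : w.map (O.gauge z) = w := by
    have h2 := congrArg (fun M : Matrix (Fin k) (Fin k) A => M.map (O.gauge z)) hwv
    simp only [Matrix.map_mul, Matrix.map_one _ (map_zero (O.gauge z)) (map_one (O.gauge z)),
      hvz] at h2
    rw [← mul_one (w.map _), ← hvw, ← mul_assoc, h2, one_mul]
  exact congrFun (congrFun hwz i) j

end ModularUnitary

variable (τ)

-- This makes `D_k` the case `v = 1` of the statements about `v D_k v*`.
omit [NeZero n] in
theorem DMatrix_eq_DConj_one : τ.DMatrix k = τ.DConj (1 : Matrix (Fin k) (Fin k) A) := by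
  rw [DConj, repMatrix_one, conjBy_one]

/-- `π(v) h(D) π(v)*`, for the heat function `h`, has weight zero by the symmetry `m ↦ -m`. -/
theorem exists_isFunctionOf_heat {v : Matrix (Fin k) (Fin k) A} (hv : ∀ i j, v i j ∈ O.alg)
    (h1 : v.conjTranspose * v = 1) (h2 : v * v.conjTranspose = 1) {t : ℝ} (ht : 0 < t) :
    ∃ F, IsFunctionOf (τ.DConj v) (heat t) F ∧
      IsWeightValue (τ.vNMatrix k) (τ.weightMatrix k) F 0 := by
  obtain ⟨B, B', hB, hB', hsub, hs, hs', hsum⟩ := τ.exists_isDiag_heat ht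
  refine ⟨τ.repMatrix v * scalarOp k (B - B') * τ.repMatrix v.conjTranspose, ?_, ?_⟩
  · rw [← adjoint_repMatrix]
    refine hsub.isFunctionOf.ampl.conjBy ?_ ?_
    · rw [adjoint_repMatrix, ← repMatrix_mul, h1, repMatrix_one]
    · rw [adjoint_repMatrix, ← repMatrix_mul, h2, repMatrix_one]
  -- The two positive parts have weights `(∑ h) ψ(vv*)` with the same total, so the difference is
  -- `0`.
  · have h := hB.isWeightValue_conj_sub hB' (fun _ => le_max_right _ _) (fun _ => le_max_right _ _)
      hs hs' hv hv
    rw [hsum, sub_self, ← sub_mul, ← mul_sub, ← scalarOp_sub] at h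
    exact h

/-- `h(D)`, for the heat function `h`, has weight zero by the symmetry `m ↦ -m`. -/
theorem exists_isFunctionOf_D_heat {t : ℝ} (ht : 0 < t) :
    ∃ F, IsFunctionOf τ.D (heat t) F ∧ IsWeightValue τ.vN τ.weight F 0 := by
  obtain ⟨B, B', hB, hB', hsub, hs, hs', hsum⟩ := τ.exists_isDiag_heat ht
  refine ⟨B - B', hsub.isFunctionOf, ?_⟩
  have hw : ∀ {h : ℤ → ℝ} {B : τ.H →L[ℂ] τ.H}, τ.IsDiag h B → (∀ m, 0 ≤ h m) → Summable h →
      B ∈ τ.vN ∧ B.IsPositive ∧ τ.weight B = ENNReal.ofReal (∑' m, h m) := by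
    intro h B hB hh hs
    have h1 : τ.rep 1 * B * τ.rep (star 1) = B := by rw [star_one, rep_one, one_mul, mul_one]
    refine ⟨?_, hB.isPositive hh, ?_⟩
    · have := hB.rep_mul_mul_rep_mem_vN O.one_mem_alg O.one_mem_alg
      rwa [h1] at this
    · have := hB.weight_conj hh O.one_mem_alg
      rw [h1, star_one, mul_one, state_one, Complex.one_re, ENNReal.ofReal_one, mul_one,
        ← ENNReal.ofReal_tsum_of_nonneg hh hs] at this
      exact this
  obtain ⟨h1, h2, h3⟩ := hw hB (fun _ => le_max_right _ _) hs
  obtain ⟨h1', h2', h3'⟩ := hw hB' (fun _ => le_max_right _ _) hs'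
  have h := isWeightValue_sub τ.zero_mem_vN τ.weight_zero h1 h2 (by rw [h3]; exact ENNReal.ofReal_lt_top)
    h1' h2' (by rw [h3']; exact ENNReal.ofReal_lt_top)
  rwa [h3, h3', hsum, sub_self] at h

end

end Matrices

end CuntzAlgebra.FaithfulTrace

end CuntzModular

end

/-! ### The kernel corrections and the eta invariants assembled. -/

open CuntzModular in
theorem lemma5p3 {n : ℕ} (hn : 2 ≤ n) {A : Type u} [CStarAlgebra A] [PartialOrder A]
    [StarOrderedRing A] (O : CuntzAlgebra n A) (τ : O.FaithfulTrace) {k : ℕ}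
    (u : Matrix (Fin k) (Fin k) A) (hu : τ.IsModularUnitary u) :
    -- `σ(u*) u` is a matrix `f` over `F`
    ∃ f : Matrix (Fin k) (Fin k) O.fixed,
      f.map (fun x : O.fixed => (x : A)) = u.conjTranspose.map τ.sigma * u ∧
      -- the kernel corrections
      (τ.TauFinite (kerProj (τ.DMatrix k) - kerProj (τ.DConj u)) ∧
        τ.SigmaIDefined (τ.repMatrix u.conjTranspose) ∧
        τ.TauFinite ((1 - τ.sigmaI (τ.repMatrix u.conjTranspose) * τ.repMatrix u) *
          kerProj (τ.DMatrix k)) ∧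
        τ.tauDelta (kerProj (τ.DMatrix k) - kerProj (τ.DConj u)) =
          τ.tauDelta ((1 - τ.sigmaI (τ.repMatrix u.conjTranspose) * τ.repMatrix u) *
            kerProj (τ.DMatrix k)) ∧
        τ.tauDelta ((1 - τ.sigmaI (τ.repMatrix u.conjTranspose) * τ.repMatrix u) *
            kerProj (τ.DMatrix k)) =
          τ.tauMatrix (1 - f)) ∧
      -- the eta invariants
      ∀ ε : ℝ, 0 < ε →
        EtaDefined τ.vN τ.weight τ.D ε ∧
        EtaDefined (τ.vNMatrix k) (τ.weightMatrix k) (τ.DMatrix k) ε ∧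
        EtaDefined (τ.vNMatrix k) (τ.weightMatrix k) (τ.DConj u) ε ∧
        eta (τ.vNMatrix k) (τ.weightMatrix k) (τ.DConj u) ε =
          τ.tauMatrix f * eta τ.vN τ.weight τ.D ε ∧
        eta (τ.vNMatrix k) (τ.weightMatrix k) (τ.DConj u) ε =
          τ.tauMatrix f * eta (τ.vNMatrix k) (τ.weightMatrix k) (τ.DMatrix k) ε := by
  have : NeZero n := ⟨by omega⟩
  let f : Matrix (Fin k) (Fin k) O.fixed :=
    Matrix.of fun i j => ⟨_, hu.sigma_mul_mem_fixed hn i j⟩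
  have hf : f.map (fun x : O.fixed => (x : A)) = u.conjTranspose.map τ.sigma * u := rfl
  have hτf : τ.tauMatrix (1 - f) = τ.stateMatrix (1 - u.conjTranspose.map τ.sigma * u) := by
    refine Finset.sum_congr rfl fun i _ => ?_
    rw [← τ.state_coe]
    congr 1
    simp only [Matrix.sub_apply, Matrix.one_apply_eq]
    rfl
  have hmem : ∀ i j, (1 - u.conjTranspose.map τ.sigma * u) i j ∈ O.alg := fun i j =>
    sub_mem (O.one_apply_mem_alg i j) (hu.sigma_mul_mem_alg i j)
  have hkD : kerProj (τ.DMatrix k) = scalarOp k (τ.proj 0) := τ.isKerProj_D.ampl.kerProj_eq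
  have hkDu : kerProj (τ.DConj u) =
      τ.repMatrix u * scalarOp k (τ.proj 0) * τ.repMatrix u.conjTranspose := by
    rw [← τ.adjoint_repMatrix]
    exact (τ.isKerProj_D.ampl.conjBy hu.adjoint_mul hu.mul_adjoint).kerProj_eq
  have hw1 : IsWeightValue (τ.vNMatrix k) (τ.weightMatrix k)
      (kerProj (τ.DMatrix k) - kerProj (τ.DConj u)) (τ.tauMatrix (1 - f)) := by
    have hh : ∀ m, 0 ≤ (Pi.single 0 1 : ℤ → ℝ) m := fun m => by
      rw [Pi.single_apply]; split_ifs <;> norm_num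
    have hs : HasSum (Pi.single 0 1 : ℤ → ℝ) 1 := hasSum_pi_single 0 1
    -- Both kernel projections have the form `π(b) Φ_0 π(b)*`, with `b = 1` and `b = u`, and `Φ_0`
    -- is `h(D)` with `∑ h = 1`.
    have h := (τ.isDiag_proj 0).isWeightValue_conj_sub (τ.isDiag_proj 0) hh hh hs.summable
      hs.summable O.one_apply_mem_alg hu.mem
    rw [hs.tsum_eq, Complex.ofReal_one, Matrix.conjTranspose_one, τ.repMatrix_one] at h
    simp only [one_mul, mul_one] at h
    -- The twisted trace replaces `ψ(uu*)` by `ψ(σ(u*)u)`.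
    rw [← τ.stateMatrix_sigma_mul hu.conjTranspose_mem hu.mem, ← τ.stateMatrix_sub, ← hτf] at h
    rwa [hkD, hkDu]
  have hσ : τ.sigmaI (τ.repMatrix u.conjTranspose) =
      τ.repMatrix (u.conjTranspose.map τ.sigma) := τ.sigmaI_repMatrix hu.conjTranspose_mem
  have hw2 : IsWeightValue (τ.vNMatrix k) (τ.weightMatrix k)
      ((1 - τ.sigmaI (τ.repMatrix u.conjTranspose) * τ.repMatrix u) * kerProj (τ.DMatrix k))
      (τ.tauMatrix (1 - f)) := by
    have h := τ.isWeightValue_repMatrix_mul_proj_zero hmem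
    rwa [← hτf, τ.repMatrix_sub, τ.repMatrix_one, τ.repMatrix_mul, ← hσ, ← hkD] at h
  refine ⟨f, hf, ⟨⟨_, hw1⟩, ?_, ⟨_, hw2⟩, ?_, ?_⟩, fun ε hε => ?_⟩
  · unfold CuntzAlgebra.FaithfulTrace.SigmaIDefined
    rw [hσ]
    exact τ.isSpatial_repMatrix hu.conjTranspose_mem
  · exact (weightValue_eq τ.weightMatrix_add hw1).trans (weightValue_eq τ.weightMatrix_add hw2).symm
  · exact weightValue_eq τ.weightMatrix_add hw2
  · obtain ⟨h1, h1'⟩ := eta_of_isWeightValue_zero (fun P Q hP hQ => τ.weight_add hP hQ)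
      (fun t ht => τ.exists_isFunctionOf_D_heat ht) hε
    have h1k : (1 : Matrix (Fin k) (Fin k) A).conjTranspose = 1 := Matrix.conjTranspose_one
    obtain ⟨h2, h2'⟩ := eta_of_isWeightValue_zero (T := τ.DMatrix k) τ.weightMatrix_add
      (fun t ht => by
        rw [τ.DMatrix_eq_DConj_one]
        exact τ.exists_isFunctionOf_heat O.one_apply_mem_alg (by rw [h1k, mul_one])
          (by rw [h1k, mul_one]) ht) hε
    obtain ⟨h3, h3'⟩ := eta_of_isWeightValue_zero τ.weightMatrix_add (fun t ht =>
      τ.exists_isFunctionOf_heat hu.mem hu.star_mul_self hu.mul_star_self ht) hε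
    -- All three eta invariants are zero, so the trace factor multiplies `0`.
    exact ⟨h1, h2, h3, by rw [h3', h1', mul_zero], by rw [h3', h2', mul_zero]⟩
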